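/- **Setting.** Let $N\in\mathbb N$ and $C^+(\mathbb R^N)=\{h\in C(\mathbb R^N): 1<h^-\le h^+<\infty\}$, where $h^-=\inf h$ and $h^+=\sup h$. Let $p\in C^+(\mathbb R^N)$ be Lipschitz continuous with $p^+<N$, and put $p^\star(x)=Np(x)/(N-p(x))$. Let $L^{p(x)}(\mathbb R^N)$ be the space of (classes of) measurable $u$ with $\int_{\mathbb R^N}|u(x)|^{p(x)}dx<\infty$, with the Luxemburg norm $\|u\|_{L^{p(x)}}=\inf\{\alpha>0:\int_{\mathbb R^N}|u(x)/\alpha|^{p(x)}dx\le 1\}$, and let $W^{1,p(x)}(\mathbb R^N)$ be the space of $u\in L^{p(x)}(\mathbb R^N)$ with a weak gradient $\nabla u$ such that $|\nabla u|\in L^{p(x)}(\mathbb R^N)$, with norm $\|u\|_{L^{p(x)}}+\|\nabla u\|_{L^{p(x)}}$. Let $q\in C^+(\mathbb R^N)$ and let $\lambda:\mathbb R^N\times\mathbb R^N\to\mathbb R$ satisfy $$\frac1{q(x)}+\frac{\lambda(x,y)}{N}+\frac1{q(y)}=2\quad\text{for all }x,y\in\mathbb R^N,\qquad \lambda^+:=\sup_{x,y}\lambda(x,y)<N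 .$$ Let $\mathcal M$ be the set of $r\in C^+(\mathbb R^N)$ with $p(x)\le r(x)q^-\le r(x)q^+\le p^\star(x)$ for all $x\in\mathbb R^N$. Let $f:\mathbb R^N\times\mathbb R\to\mathbb R$ be continuous and suppose that there are $r,s\in\mathcal M$ and $C_1>0$ with $$|f(x,t)|\le C_1\big(|t|^{r(x)-1}+|t|^{s(x)-1}\big)\quad\text{for all }(x,t)\in\mathbb R^N\times\mathbb R .$$ Put $F(x,t)=\int_0^t f(x,\tau)\,d\tau$. **Claim.** For every $u\in W^{1,p(x)}(\mathbb R^N)$ the function $(x,y)\mapsto F(x,u(x))F(y,u(y))/|x-y|^{\lambda(x,y)}$ is integrable on $\mathbb R^N\times\mathbb R^N$, so that $$\Psi(u)=\frac12\int_{\mathbb R^N}\int_{\mathbb R^N}\frac{F(x,u(x))F(y,u(y))}{|x-y|^{\lambda(x,y)}}\,dx\,dy$$ is well defined. The functional $\Psi$ belongs to $C^1(W^{1,p(x)}(\mathbb R^N),\mathbb R)$. For all $u,v\in W^{1,p(x)}(\mathbb R^N)$ the function $(x,y)\mapsto F(x,u(x))f(y,u(y))v(y)/|x-y|^{\lambda(x,y)}$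 is integrable on $\mathbb R^N\times\mathbb R^N$, and $$\Psi'(u)v=\int_{\mathbb R^N}\int_{\mathbb R^N}\frac{F(x,u(x))f(y,u(y))v(y)}{|x-y|^{\lambda(x,y)}}\,dx\,dy .$$ -/

import Mathlib

open MeasureTheory Set Filter
open scoped ENNReal NNReal ContDiff

noncomputable section

/-- `ℝᴺ` with its Euclidean norm. -/
abbrev Eu (N : ℕ) : Type := EuclideanSpace ℝ (Fin N)

/-- `C⁺(ℝᴺ)`: continuous functions `h : ℝᴺ → ℝ` with `1 < h⁻ ≤ h⁺ < ∞`. (If `h` were unbounded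
below, the real `⨅` would be `0`, so the second field does force `1 < inf h`.) -/
structure CPlus (N : ℕ) where
  toFun : Eu N → ℝ
  continuous_toFun : Continuous toFun
  one_lt_iInf : 1 < ⨅ x, toFun x
  bddAbove_range : BddAbove (range toFun)

namespace CPlus

variable {N : ℕ}

instance : CoeFun (CPlus N) (fun _ => Eu N → ℝ) := ⟨CPlus.toFun⟩

/-- `h⁻ = inf h`. -/
def lo (h : CPlus N) : ℝ := ⨅ x, h x

/-- `h⁺ = sup h`. -/
def hi (h : CPlus N) : ℝ := ⨆ x, h x

theorem bddBelow_range (h : CPlus N) : BddBelow (range h.toFun) := by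
  by_contra hb
  have h1 := h.one_lt_iInf
  rw [Real.iInf_of_not_bddBelow hb] at h1
  linarith

theorem lo_le (h : CPlus N) (x : Eu N) : h.lo ≤ h x := ciInf_le h.bddBelow_range x

theorem le_hi (h : CPlus N) (x : Eu N) : h x ≤ h.hi := le_ciSup h.bddAbove_range x

theorem one_lt (h : CPlus N) (x : Eu N) : 1 < h x := lt_of_lt_of_le h.one_lt_iInf (h.lo_le x)

theorem pos (h : CPlus N) (x : Eu N) : 0 < h x := zero_lt_one.trans (h.one_lt x)

end CPlus

set_option linter.unusedSectionVars false

section Lebesgue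

variable {N : ℕ} {G : Type*} [NormedAddCommGroup G] [NormedSpace ℝ G]

/-- The modular `ρ_p(u) = ∫ |u(x)|^{p(x)} dx`, with values in `[0, ∞]`. -/
def modular (p : CPlus N) (u : Eu N → G) : ℝ≥0∞ := ∫⁻ x, ‖u x‖ₑ ^ (p x)

/-- `u ∈ L^{p(x)}(ℝᴺ)`. -/
def MemLpVar (p : CPlus N) (u : Eu N → G) : Prop :=
  AEStronglyMeasurable u volume ∧ modular p u < ⊤

/-- The Luxemburg norm `inf {α > 0 : ∫ |u(x)/α|^{p(x)} dx ≤ 1}`. -/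
def luxNorm (p : CPlus N) (u : Eu N → G) : ℝ :=
  sInf {α : ℝ | 0 < α ∧ modular p (fun x => α⁻¹ • u x) ≤ 1}

theorem modular_congr (p : CPlus N) {u v : Eu N → G} (h : u =ᵐ[volume] v) :
    modular p u = modular p v :=
  lintegral_congr_ae (h.mono fun x hx => by simp only [hx])

theorem luxNorm_congr (p : CPlus N) {u v : Eu N → G} (h : u =ᵐ[volume] v) :
    luxNorm p u = luxNorm p v := by
  unfold luxNorm
  congr 1
  ext α
  have : (fun x => α⁻¹ • u x) =ᵐ[volume] fun x => α⁻¹ • v x := h.mono fun x hx => by simp only [hx]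
  simp only [mem_ofPred_eq, modular_congr p this]

theorem aemeasurable_modular (p : CPlus N) {u : Eu N → G} (hu : AEStronglyMeasurable u volume) :
    AEMeasurable (fun x => ‖u x‖ₑ ^ (p x)) volume :=
  hu.enorm.pow p.continuous_toFun.measurable.aemeasurable

theorem modular_convex (p : CPlus N) {u v : Eu N → G} (hu : AEStronglyMeasurable u volume)
    {a b : ℝ} (ha : 0 ≤ a) (hb : 0 ≤ b) (hab : a + b = 1) :
    modular p (fun x => a • u x + b • v x)
      ≤ ENNReal.ofReal a * modular p u + ENNReal.ofReal b * modular p v := by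
  unfold modular
  rw [← lintegral_const_mul' _ _ ENNReal.ofReal_ne_top,
    ← lintegral_const_mul' _ _ ENNReal.ofReal_ne_top,
    ← lintegral_add_left' ((aemeasurable_modular p hu).const_mul _)]
  refine lintegral_mono fun x => ?_
  have h1 : ENNReal.ofReal a + ENNReal.ofReal b = 1 := by
    rw [← ENNReal.ofReal_add ha hb, hab, ENNReal.ofReal_one]
  refine le_trans ?_
    (ENNReal.rpow_arith_mean_le_arith_mean2_rpow _ _ ‖u x‖ₑ ‖v x‖ₑ h1 (p.one_lt x).le)
  refine ENNReal.rpow_le_rpow ?_ (p.pos x).le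
  refine (enorm_add_le _ _).trans (le_of_eq ?_)
  simp [enorm_smul, Real.enorm_eq_ofReal ha, Real.enorm_eq_ofReal hb]

theorem modular_smul_le (p : CPlus N) (u : Eu N → G) {c : ℝ} (hc : 0 ≤ c) (hc1 : c ≤ 1) :
    modular p (fun x => c • u x) ≤ ENNReal.ofReal c * modular p u := by
  unfold modular
  rw [← lintegral_const_mul' _ _ ENNReal.ofReal_ne_top]
  refine lintegral_mono fun x => ?_
  simp only [enorm_smul, Real.enorm_eq_ofReal hc]
  rw [ENNReal.mul_rpow_of_nonneg _ _ (p.pos x).le]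
  gcongr
  have h1 : ENNReal.ofReal c ≤ 1 := by simpa using ENNReal.ofReal_le_ofReal hc1
  simpa using ENNReal.rpow_le_rpow_of_exponent_ge h1 (p.one_lt x).le

theorem modular_smul_lt_top (p : CPlus N) {u : Eu N → G} (hu : modular p u < ⊤) (c : ℝ) :
    modular p (fun x => c • u x) < ⊤ := by
  set M : ℝ≥0∞ := max 1 ‖c‖ₑ with hM
  have hMtop : M ^ p.hi ≠ ⊤ := by
    refine (ENNReal.rpow_lt_top_of_nonneg ((p.pos 0).le.trans (p.le_hi 0)) ?_).ne
    simp [hM]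
  refine lt_of_le_of_lt ?_ (ENNReal.mul_lt_top hMtop.lt_top hu)
  unfold modular
  rw [← lintegral_const_mul' _ _ hMtop]
  refine lintegral_mono fun x => ?_
  simp only [enorm_smul]
  rw [ENNReal.mul_rpow_of_nonneg _ _ (p.pos x).le]
  gcongr
  exact (ENNReal.rpow_le_rpow (le_max_right _ _) (p.pos x).le).trans
    (ENNReal.rpow_le_rpow_of_exponent_le (le_max_left _ _) (p.le_hi x))

theorem MemLpVar.congr {p : CPlus N} {u v : Eu N → G} (hu : MemLpVar p u) (h : u =ᵐ[volume] v) :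
    MemLpVar p v :=
  ⟨hu.1.congr h, modular_congr p h ▸ hu.2⟩

theorem MemLpVar.zero (p : CPlus N) : MemLpVar p (fun _ : Eu N => (0 : G)) := by
  refine ⟨aestronglyMeasurable_const, ?_⟩
  have : ∀ x, (0 : ℝ≥0∞) ^ (p x) = 0 := fun x => ENNReal.zero_rpow_of_pos (p.pos x)
  simp [modular, this]

theorem MemLpVar.smul {p : CPlus N} {u : Eu N → G} (hu : MemLpVar p u) (c : ℝ) :
    MemLpVar p (fun x => c • u x) :=
  ⟨hu.1.const_smul c, modular_smul_lt_top p hu.2 c⟩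

theorem MemLpVar.add {p : CPlus N} {u v : Eu N → G} (hu : MemLpVar p u) (hv : MemLpVar p v) :
    MemLpVar p (fun x => u x + v x) := by
  refine ⟨hu.1.add hv.1, ?_⟩
  have h := modular_convex p (u := fun x => (2 : ℝ) • u x) (v := fun x => (2 : ℝ) • v x)
    (hu.1.const_smul 2) (a := 1 / 2) (b := 1 / 2) (by norm_num) (by norm_num) (by norm_num)
  have e : (fun x => (1 / 2 : ℝ) • (2 : ℝ) • u x + (1 / 2 : ℝ) • (2 : ℝ) • v x)
      = fun x => u x + v x := by
    funext x; simp [smul_smul]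
  rw [e] at h
  exact h.trans_lt (ENNReal.add_lt_top.2
    ⟨ENNReal.mul_lt_top ENNReal.ofReal_lt_top (hu.smul 2).2,
     ENNReal.mul_lt_top ENNReal.ofReal_lt_top (hv.smul 2).2⟩)

theorem luxSet_nonempty {p : CPlus N} {u : Eu N → G} (hu : MemLpVar p u) :
    {α : ℝ | 0 < α ∧ modular p (fun x => α⁻¹ • u x) ≤ 1}.Nonempty := by
  set A : ℝ := max 1 (modular p u).toReal with hA
  have hA1 : 1 ≤ A := le_max_left _ _
  have hA0 : 0 < A := by linarith
  refine ⟨A, hA0, (modular_smul_le p u (inv_nonneg.2 hA0.le) (inv_le_one_of_one_le₀ hA1)).trans ?_⟩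
  rw [← ENNReal.ofReal_toReal hu.2.ne, ← ENNReal.ofReal_mul (inv_nonneg.2 hA0.le),
    ← ENNReal.ofReal_one]
  refine ENNReal.ofReal_le_ofReal ?_
  rw [inv_mul_le_iff₀ hA0, mul_one]
  exact le_max_right _ _

theorem luxSet_bddBelow (p : CPlus N) (u : Eu N → G) :
    BddBelow {α : ℝ | 0 < α ∧ modular p (fun x => α⁻¹ • u x) ≤ 1} :=
  ⟨0, fun _ h => h.1.le⟩

theorem luxNorm_nonneg (p : CPlus N) (u : Eu N → G) : 0 ≤ luxNorm p u :=
  Real.sInf_nonneg fun _ h => h.1.le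

theorem luxNorm_add_le {p : CPlus N} {u v : Eu N → G} (hu : MemLpVar p u) (hv : MemLpVar p v) :
    luxNorm p (fun x => u x + v x) ≤ luxNorm p u + luxNorm p v := by
  refine le_of_forall_pos_le_add fun ε hε => ?_
  obtain ⟨α, ⟨hα, hα1⟩, hαlt⟩ := exists_lt_of_csInf_lt (luxSet_nonempty hu)
    (show luxNorm p u < luxNorm p u + ε / 2 by linarith)
  obtain ⟨β, ⟨hβ, hβ1⟩, hβlt⟩ := exists_lt_of_csInf_lt (luxSet_nonempty hv)
    (show luxNorm p v < luxNorm p v + ε / 2 by linarith)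
  have hs : 0 < α + β := by linarith
  have hmem : α + β ∈ {γ : ℝ | 0 < γ ∧ modular p (fun x => γ⁻¹ • (u x + v x)) ≤ 1} := by
    refine ⟨hs, ?_⟩
    have h := modular_convex p (u := fun x => α⁻¹ • u x) (v := fun x => β⁻¹ • v x)
      (hu.1.const_smul _) (a := α / (α + β)) (b := β / (α + β)) (by positivity) (by positivity)
      (by field_simp)
    have e : (fun x => (α / (α + β)) • α⁻¹ • u x + (β / (α + β)) • β⁻¹ • v x)
        = fun x => (α + β)⁻¹ • (u x + v x) := by
      funext x
      rw [smul_smul, smul_smul, smul_add]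
      congr 2 <;> field_simp
    rw [e] at h
    refine h.trans ?_
    calc _ ≤ ENNReal.ofReal (α / (α + β)) * 1 + ENNReal.ofReal (β / (α + β)) * 1 := by gcongr
      _ = 1 := by
        rw [mul_one, mul_one, ← ENNReal.ofReal_add (by positivity) (by positivity), ← add_div,
          div_self hs.ne', ENNReal.ofReal_one]
  have := csInf_le (luxSet_bddBelow p _) hmem
  unfold luxNorm at *
  linarith

theorem luxNorm_zero (p : CPlus N) : luxNorm p (fun _ : Eu N => (0 : G)) = 0 := by
  refine le_antisymm (le_of_forall_pos_le_add fun ε hε => ?_) (luxNorm_nonneg _ _)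
  refine (csInf_le (luxSet_bddBelow p _) (a := ε) ⟨hε, ?_⟩).trans (by simp)
  have : ∀ x, (0 : ℝ≥0∞) ^ (p x) = 0 := fun x => ENNReal.zero_rpow_of_pos (p.pos x)
  simp [modular, this]

theorem luxNorm_smul_le {p : CPlus N} {u : Eu N → G} (hu : MemLpVar p u) {c : ℝ} (hc : c ≠ 0) :
    luxNorm p (fun x => c • u x) ≤ |c| * luxNorm p u := by
  have hc0 : 0 < |c| := abs_pos.2 hc
  rw [← div_le_iff₀' hc0]
  refine le_csInf (luxSet_nonempty hu) fun α hα => ?_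
  rw [div_le_iff₀' hc0]
  refine csInf_le (luxSet_bddBelow p _) ⟨mul_pos hc0 hα.1, ?_⟩
  refine le_trans (le_of_eq ?_) hα.2
  unfold modular
  refine lintegral_congr fun x => ?_
  congr 1
  simp only []
  rw [smul_smul, enorm_smul, enorm_smul]
  congr 1
  rw [← ofReal_norm, ← ofReal_norm]
  congr 1
  rw [norm_mul, norm_inv, norm_mul, norm_inv]
  simp only [Real.norm_eq_abs, abs_abs]
  field_simp

theorem luxNorm_smul {p : CPlus N} {u : Eu N → G} (hu : MemLpVar p u) (c : ℝ) :
    luxNorm p (fun x => c • u x) = |c| * luxNorm p u := by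
  rcases eq_or_ne c 0 with rfl | hc
  · simpa using luxNorm_zero (G := G) p
  · refine le_antisymm (luxNorm_smul_le hu hc) ?_
    have h := luxNorm_smul_le (hu.smul c) (inv_ne_zero hc)
    have e : (fun x => c⁻¹ • c • u x) = u := by funext x; simp [smul_smul, hc]
    rw [e, abs_inv, inv_mul_eq_div, le_div_iff₀' (abs_pos.2 hc)] at h
    exact h

theorem ae_eq_zero_of_luxNorm_eq_zero {p : CPlus N} {u : Eu N → G} (hu : MemLpVar p u)
    (h : luxNorm p u = 0) : u =ᵐ[volume] fun _ => 0 := by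
  have key : ∀ ε : ℝ, 0 < ε → ε ≤ 1 → modular p u ≤ ENNReal.ofReal ε := by
    intro ε hε hε1
    obtain ⟨α, ⟨hα, hα1⟩, hlt⟩ := exists_lt_of_csInf_lt (luxSet_nonempty hu)
      (show luxNorm p u < ε by rw [h]; exact hε)
    have h1 := modular_smul_le p (fun x => α⁻¹ • u x) hα.le (hlt.le.trans hε1)
    have e : (fun x => α • α⁻¹ • u x) = u := by funext x; simp [smul_smul, hα.ne']
    rw [e] at h1
    calc modular p u ≤ ENNReal.ofReal α * 1 := h1.trans (by gcongr)
      _ ≤ ENNReal.ofReal ε := by rw [mul_one]; exact ENNReal.ofReal_le_ofReal hlt.le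
  have h0 : modular p u = 0 := by
    by_contra hne
    have hpos : 0 < (modular p u).toReal := ENNReal.toReal_pos hne hu.2.ne
    have h2 := key (min 1 ((modular p u).toReal / 2)) (by positivity) (min_le_left _ _)
    have h3 := ENNReal.toReal_mono ENNReal.ofReal_ne_top h2
    rw [ENNReal.toReal_ofReal (by positivity)] at h3
    have := min_le_right 1 ((modular p u).toReal / 2)
    linarith
  unfold modular at h0
  rw [lintegral_eq_zero_iff' (aemeasurable_modular p hu.1)] at h0
  filter_upwards [h0] with x hx
  have h4 := (ENNReal.rpow_eq_zero_iff_of_pos (p.pos x)).1 hx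
  simpa using h4

end Lebesgue

section Sobolev

variable {N : ℕ}

/-- `g` is the weak gradient of `u` on `ℝᴺ`: both are locally integrable and
`∫ u ∂ᵢφ = - ∫ gᵢ φ` for every `φ ∈ C_c^∞(ℝᴺ)` and every coordinate `i`. -/
def HasWeakGrad (u : Eu N → ℝ) (g : Eu N → Eu N) : Prop :=
  LocallyIntegrable u volume ∧ LocallyIntegrable g volume ∧
    ∀ φ : Eu N → ℝ, ContDiff ℝ ∞ φ → HasCompactSupport φ → ∀ i : Fin N,
      ∫ x, u x * fderiv ℝ φ x (EuclideanSpace.single i 1) = - ∫ x, g x i * φ x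

theorem locallyIntegrable_coord {g : Eu N → Eu N} (hg : LocallyIntegrable g volume) (i : Fin N) :
    LocallyIntegrable (fun x => g x i) volume := fun x =>
  (EuclideanSpace.proj i : Eu N →L[ℝ] ℝ).integrableAtFilter_comp (hg x)

theorem integrable_mul_of_locallyIntegrable {u φ : Eu N → ℝ} (hu : LocallyIntegrable u volume)
    (hφ : Continuous φ) (hc : HasCompactSupport φ) : Integrable (fun x => u x * φ x) volume := by
  simpa [mul_comm, smul_eq_mul] using hu.integrable_smul_left_of_hasCompactSupport hφ hc

theorem HasWeakGrad.unique {u v : Eu N → ℝ} {g g' : Eu N → Eu N} (h : HasWeakGrad u g)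
    (h' : HasWeakGrad v g') (huv : u =ᵐ[volume] v) : g =ᵐ[volume] g' := by
  have hi : ∀ i : Fin N, ∀ᵐ x, g x i = g' x i := fun i => by
    refine ae_eq_of_integral_contDiff_smul_eq (locallyIntegrable_coord h.2.1 i)
      (locallyIntegrable_coord h'.2.1 i) fun φ hφ hc => ?_
    have h1 := h.2.2 φ hφ hc i
    have h2 := h'.2.2 φ hφ hc i
    have e : ∫ x, u x * fderiv ℝ φ x (EuclideanSpace.single i 1)
        = ∫ x, v x * fderiv ℝ φ x (EuclideanSpace.single i 1) :=
      integral_congr_ae (huv.mono fun x hx => by simp only [hx])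
    rw [h1, h2, neg_inj] at e
    simpa [mul_comm, smul_eq_mul] using e
  filter_upwards [ae_all_iff.2 hi] with x hx
  ext i
  exact hx i

theorem HasWeakGrad.congr {u v : Eu N → ℝ} {g : Eu N → Eu N} (h : HasWeakGrad u g)
    (huv : u =ᵐ[volume] v) : HasWeakGrad v g := by
  refine ⟨h.1.congr huv, h.2.1, fun φ hφ hc i => ?_⟩
  rw [← h.2.2 φ hφ hc i]
  exact integral_congr_ae (huv.mono fun x hx => by simp only [hx])

theorem HasWeakGrad.zero : HasWeakGrad (fun _ : Eu N => (0 : ℝ)) (fun _ => 0) :=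
  ⟨locallyIntegrable_const 0, locallyIntegrable_const 0, fun φ _ _ i => by simp⟩

theorem continuous_fderiv_single {φ : Eu N → ℝ} (hφ : ContDiff ℝ ∞ φ) (i : Fin N) :
    Continuous fun x => fderiv ℝ φ x (EuclideanSpace.single i 1) :=
  (hφ.continuous_fderiv (by simp)).clm_apply continuous_const

theorem HasWeakGrad.add {u v : Eu N → ℝ} {g g' : Eu N → Eu N} (h : HasWeakGrad u g)
    (h' : HasWeakGrad v g') : HasWeakGrad (fun x => u x + v x) (fun x => g x + g' x) := by
  refine ⟨h.1.add h'.1, h.2.1.add h'.2.1, fun φ hφ hc i => ?_⟩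
  have c1 := continuous_fderiv_single hφ i
  have c2 : HasCompactSupport fun x => fderiv ℝ φ x (EuclideanSpace.single i 1) :=
    hc.fderiv_apply ℝ _
  simp only [add_mul, PiLp.add_apply]
  rw [integral_add (integrable_mul_of_locallyIntegrable h.1 c1 c2)
      (integrable_mul_of_locallyIntegrable h'.1 c1 c2),
    integral_add
      (integrable_mul_of_locallyIntegrable (locallyIntegrable_coord h.2.1 i) hφ.continuous hc)
      (integrable_mul_of_locallyIntegrable (locallyIntegrable_coord h'.2.1 i) hφ.continuous hc),
    h.2.2 φ hφ hc i, h'.2.2 φ hφ hc i]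
  ring

theorem HasWeakGrad.smul {u : Eu N → ℝ} {g : Eu N → Eu N} (h : HasWeakGrad u g) (c : ℝ) :
    HasWeakGrad (fun x => c • u x) (fun x => c • g x) := by
  refine ⟨h.1.smul c, h.2.1.smul c, fun φ hφ hc i => ?_⟩
  simp only [PiLp.smul_apply, smul_eq_mul, mul_assoc, integral_const_mul]
  rw [h.2.2 φ hφ hc i]
  ring

/-- The linear space `{u ∈ L^{p(x)}(ℝᴺ) : |∇u| ∈ L^{p(x)}(ℝᴺ)}` of classes of measurable
functions modulo equality almost everywhere. -/
def w1pSubmodule (p : CPlus N) : Submodule ℝ (Eu N →ₘ[volume] ℝ) where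
  carrier := {u | MemLpVar p u ∧ ∃ g : Eu N → Eu N, HasWeakGrad u g ∧ MemLpVar p g}
  zero_mem' := by
    have h0 : (fun _ : Eu N => (0 : ℝ)) =ᵐ[volume] ((0 : Eu N →ₘ[volume] ℝ) : Eu N → ℝ) :=
      (AEEqFun.coeFn_zero (β := ℝ)).symm
    exact ⟨(MemLpVar.zero p).congr h0, _, HasWeakGrad.zero.congr h0, MemLpVar.zero p⟩
  add_mem' := by
    rintro u v ⟨hu, g, hg, hgp⟩ ⟨hv, g', hg', hgp'⟩
    have h0 : (fun x => u x + v x) =ᵐ[volume] (u + v : Eu N →ₘ[volume] ℝ) :=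
      (AEEqFun.coeFn_add u v).symm
    exact ⟨(hu.add hv).congr h0, _, (hg.add hg').congr h0, hgp.add hgp'⟩
  smul_mem' := by
    rintro c u ⟨hu, g, hg, hgp⟩
    have h0 : (fun x => c • u x) =ᵐ[volume] (c • u : Eu N →ₘ[volume] ℝ) :=
      (AEEqFun.coeFn_smul c u).symm
    exact ⟨(hu.smul c).congr h0, _, (hg.smul c).congr h0, hgp.smul c⟩

/-- The variable exponent Sobolev space `W^{1,p(x)}(ℝᴺ)`. -/
def W1p (p : CPlus N) : Type := ↥(w1pSubmodule p)

namespace W1p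

variable {p : CPlus N}

instance : AddCommGroup (W1p p) := inferInstanceAs (AddCommGroup ↥(w1pSubmodule p))

instance : Module ℝ (W1p p) := inferInstanceAs (Module ℝ ↥(w1pSubmodule p))

instance : CoeFun (W1p p) (fun _ => Eu N → ℝ) := ⟨fun u => (u.1 : Eu N → ℝ)⟩

theorem memLpVar (u : W1p p) : MemLpVar p (u : Eu N → ℝ) := u.2.1

/-- The weak gradient `∇u`. -/
def grad (u : W1p p) : Eu N → Eu N := u.2.2.choose

theorem hasWeakGrad (u : W1p p) : HasWeakGrad u u.grad := u.2.2.choose_spec.1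

theorem memLpVar_grad (u : W1p p) : MemLpVar p u.grad := u.2.2.choose_spec.2

theorem coeFn_add (u v : W1p p) : ((u + v : W1p p) : Eu N → ℝ) =ᵐ[volume] fun x => u x + v x :=
  AEEqFun.coeFn_add u.1 v.1

theorem coeFn_smul (c : ℝ) (u : W1p p) : ((c • u : W1p p) : Eu N → ℝ) =ᵐ[volume] fun x => c • u x :=
  AEEqFun.coeFn_smul c u.1

theorem grad_add (u v : W1p p) : (u + v).grad =ᵐ[volume] fun x => u.grad x + v.grad x :=
  (u + v).hasWeakGrad.unique (u.hasWeakGrad.add v.hasWeakGrad) (coeFn_add u v)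

theorem grad_smul (c : ℝ) (u : W1p p) : (c • u).grad =ᵐ[volume] fun x => c • u.grad x :=
  (c • u).hasWeakGrad.unique (u.hasWeakGrad.smul c) (coeFn_smul c u)

/-- `‖u‖_{W^{1,p(x)}} = ‖u‖_{L^{p(x)}} + ‖∇u‖_{L^{p(x)}}`. -/
instance : Norm (W1p p) := ⟨fun u => luxNorm p (u : Eu N → ℝ) + luxNorm p u.grad⟩

theorem norm_def (u : W1p p) : ‖u‖ = luxNorm p (u : Eu N → ℝ) + luxNorm p u.grad := rfl

theorem normedSpaceCore (p : CPlus N) : NormedSpace.Core ℝ (W1p p) where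
  norm_nonneg u := add_nonneg (luxNorm_nonneg _ _) (luxNorm_nonneg _ _)
  norm_smul c u := by
    rw [norm_def, norm_def, luxNorm_congr p (coeFn_smul c u), luxNorm_congr p (grad_smul c u),
      luxNorm_smul u.memLpVar, luxNorm_smul u.memLpVar_grad, Real.norm_eq_abs, mul_add]
  norm_triangle u v := by
    rw [norm_def, norm_def, norm_def, luxNorm_congr p (coeFn_add u v),
      luxNorm_congr p (grad_add u v)]
    have h1 := luxNorm_add_le u.memLpVar v.memLpVar
    have h2 := luxNorm_add_le u.memLpVar_grad v.memLpVar_grad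
    linarith
  norm_eq_zero_iff u := by
    constructor
    · intro h
      have h1 := luxNorm_nonneg p (u : Eu N → ℝ)
      have h2 := luxNorm_nonneg p u.grad
      rw [norm_def] at h
      have h3 := ae_eq_zero_of_luxNorm_eq_zero u.memLpVar (by linarith)
      exact Subtype.ext (AEEqFun.ext (h3.trans (AEEqFun.coeFn_zero (β := ℝ)).symm))
    · rintro rfl
      have h : ((0 : ℝ) • (0 : W1p p)) = 0 := smul_zero _
      rw [norm_def, ← h, luxNorm_congr p (coeFn_smul 0 0), luxNorm_congr p (grad_smul 0 0),
        luxNorm_smul (0 : W1p p).memLpVar, luxNorm_smul (0 : W1p p).memLpVar_grad]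
      simp

instance : NormedAddCommGroup (W1p p) := NormedAddCommGroup.ofCore (normedSpaceCore p)

instance : NormedSpace ℝ (W1p p) := NormedSpace.ofCore (normedSpaceCore p)

end W1p

/-- The class `𝓜` of exponents `r ∈ C⁺(ℝᴺ)` with
`p(x) ≤ r(x) q⁻ ≤ r(x) q⁺ ≤ p*(x) = N p(x) / (N - p(x))` for all `x`. -/
def classM (p q : CPlus N) : Set (CPlus N) :=
  {r | ∀ x, p x ≤ r x * q.lo ∧ r x * q.lo ≤ r x * q.hi ∧ r x * q.hi ≤ N * p x / (N - p x)}

/-- `F(x,t) = ∫₀ᵗ f(x,s) ds`. -/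
def primitiveF (f : Eu N → ℝ → ℝ) (x : Eu N) (t : ℝ) : ℝ := ∫ s in (0 : ℝ)..t, f x s

/-- `F(x,u(x)) F(y,u(y)) / |x - y|^{λ(x,y)}`. -/
def psiIntegrand (f : Eu N → ℝ → ℝ) (lam : Eu N → Eu N → ℝ) (u : Eu N → ℝ) (x y : Eu N) : ℝ :=
  primitiveF f x (u x) * primitiveF f y (u y) / ‖x - y‖ ^ lam x y

/-- `F(x,u(x)) f(y,u(y)) v(y) / |x - y|^{λ(x,y)}`. -/
def dpsiIntegrand (f : Eu N → ℝ → ℝ) (lam : Eu N → Eu N → ℝ) (u v : Eu N → ℝ) (x y : Eu N) : ℝ :=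
  primitiveF f x (u x) * f y (u y) * v y / ‖x - y‖ ^ lam x y

/-- `Ψ(u) = ½ ∫∫ F(x,u(x)) F(y,u(y)) / |x - y|^{λ(x,y)} dx dy`. -/
def Psi (p : CPlus N) (f : Eu N → ℝ → ℝ) (lam : Eu N → Eu N → ℝ) (u : W1p p) : ℝ :=
  1 / 2 * ∫ y, ∫ x, psiIntegrand f lam u x y

end Sobolev

end

/-! The functional is a quadratic form evaluated on the superposition operator $T(u)=F(\cdot,u)$, so
bounds for the kernel separate from smoothness of $T$.

Kernel. The relation between $q$ and $\lambda$ gives $l_1\le\lambda\le l_2<N$ with $l_1=N(2-2/q^-)$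
and $l_2=N(2-2/q^+)$. Hence the kernel is at most $|x-y|^{-l_1}$ where $|x-y|\ge 1$ and at most
$|x-y|^{-l_2}$ where $|x-y|<1$. The diagonal Hardy–Littlewood–Sobolev inequality with constant
exponents (`hls`) makes the two pieces bounded symmetric bilinear forms on $L^{q^-}$ and $L^{q^+}$
(`exists_kernel_form`).

Superposition. For $r\in\mathcal M$ the exponents $rq^-$ and $rq^+$ lie between $p$ and $p^\star$,
so the Sobolev embedding bounds their modulars on the unit ball. For a nonlinearity of growth $R-1$,
Young's inequality with exponents $R/(R-1)$ and $R$ turns a product of a multiplier and $v$ into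
modulars, and dominated convergence makes the multipliers coming from remainders and increments
small, uniformly for $v$ in the unit ball. So $T$ is $C^1$ into $L^Q$ for $Q=q^-,q^+$, with
derivative $v\mapsto f(\cdot,u)v$ (`hasNemytskii`). The chain rule gives $\Psi'$; symmetry of the
forms produces a factor 2 that cancels the $\frac12$.

Embedding (`modularBounded_criticalExp`). The $L^1$ Gagliardo–Nirenberg–Sobolev inequality is
applied to $|w|^\gamma$ with $\gamma=p^\star(N-1)/N$ and $w$ a bounded truncation of a compactly
supported $u$. Besides $|w|^{\gamma-1}|\nabla u|$, the Lipschitz exponent contributes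
$|w|^\gamma|\log|w||$. Since $\gamma$ lies strictly between $p$ and $p^\star$, with uniform gaps,
both are at most $\delta|w|^{p^\star}+C(|u|^p+|\nabla u|^p)$. The first term can be absorbed when
the $p^\star$-modular is at most 1; a comparison along the dyadic scales $2^{-j}w$ removes this
restriction, and Fatou's lemma removes truncation and cut-off. -/

noncomputable section

/-! ### The Hardy–Littlewood–Sobolev inequality in the diagonal case -/

section HLS

variable {N : ℕ}

/-- Polar coordinates reduce the integral to $\int_0^\rho t^{N-1-l}\,dt$, which converges at the
origin because $l<N$. -/
theorem lintegral_norm_rpow_neg_near (hN : 0 < N) {l : ℝ} (hl : l < N) :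
    ∃ C : ℝ, 0 ≤ C ∧ ∀ ρ : ℝ, 0 < ρ →
      ∫⁻ z : Eu N, (Iio ρ).indicator (fun t : ℝ => ENNReal.ofReal (t ^ (-l))) ‖z‖
        ≤ ENNReal.ofReal (C * ρ ^ (N - l)) := by
  have : Nontrivial (Eu N) := by
    have : Nonempty (Fin N) := ⟨⟨0, hN⟩⟩
    infer_instance
  refine ⟨N * (volume : Measure (Eu N)).real (Metric.ball 0 1) * (N - l)⁻¹,
    by have : 0 < N - l := by linarith
       positivity, fun ρ hρ => ?_⟩
  have e : ∀ z : Eu N, (Iio ρ).indicator (fun t : ℝ => ENNReal.ofReal (t ^ (-l))) ‖z‖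
      = ENNReal.ofReal ((Iio ρ).indicator (fun t : ℝ => t ^ (-l)) ‖z‖) := by
    intro z; by_cases h : ‖z‖ < ρ <;> simp [h]
  have hI : IntervalIntegrable (fun y : ℝ => y ^ ((N : ℝ) - 1 - l)) volume 0 ρ :=
    intervalIntegral.intervalIntegrable_rpow' (by linarith)
  have hcongr : ∀ y ∈ Ioi (0 : ℝ), y ^ (N - 1) • (Iio ρ).indicator (fun t : ℝ => t ^ (-l)) y
      = (Ioo 0 ρ).indicator (fun y : ℝ => y ^ ((N : ℝ) - 1 - l)) y := by
    intro y hy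
    have hy : 0 < y := hy
    by_cases h : y < ρ
    · rw [indicator_of_mem (show y ∈ Iio ρ from h), indicator_of_mem (show y ∈ Ioo 0 ρ from ⟨hy, h⟩)]
      rw [smul_eq_mul, ← Real.rpow_natCast, ← Real.rpow_add hy, Nat.cast_pred hN]
      congr 1
    · rw [indicator_of_notMem (show y ∉ Iio ρ from h), indicator_of_notMem (fun h' => h h'.2)]
      simp
  have hint : IntegrableOn (fun y : ℝ => y ^ (N - 1) • (Iio ρ).indicator (fun t : ℝ => t ^ (-l)) y)
      (Ioi 0) := by
    rw [integrableOn_congr_fun hcongr measurableSet_Ioi]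
    refine Integrable.integrableOn ?_
    rw [integrable_indicator_iff measurableSet_Ioo]
    exact ((intervalIntegrable_iff_integrableOn_Ioc_of_le hρ.le).1 hI).mono_set Ioo_subset_Ioc_self
  have hint' := (integrable_fun_norm_addHaar (volume : Measure (Eu N))
    (f := (Iio ρ).indicator (fun t : ℝ => t ^ (-l)))).2 (by simpa using hint)
  simp_rw [e]
  rw [← ofReal_integral_eq_lintegral_ofReal hint' (ae_of_all _ fun z => by
    exact indicator_apply_nonneg fun _ => Real.rpow_nonneg (norm_nonneg _) _)]
  refine ENNReal.ofReal_le_ofReal (le_of_eq ?_)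
  rw [integral_fun_norm_addHaar]
  have e2 : ∫ y in Ioi (0 : ℝ), y ^ (N - 1) • (Iio ρ).indicator (fun t : ℝ => t ^ (-l)) y
      = ρ ^ (N - l) * (N - l)⁻¹ := by
    rw [setIntegral_congr_fun measurableSet_Ioi hcongr,
      setIntegral_indicator measurableSet_Ioo,
      inter_eq_right.2 Ioo_subset_Ioi_self, ← integral_Ioc_eq_integral_Ioo,
      ← intervalIntegral.integral_of_le hρ.le, integral_rpow (Or.inl (by linarith))]
    rw [Real.zero_rpow (by linarith), sub_zero, div_eq_mul_inv]
    ring_nf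
  simp only [finrank_euclideanSpace, Fintype.card_fin]
  rw [e2]
  simp only [nsmul_eq_mul, smul_eq_mul]
  ring

/-- The exponent $2N$ is $lQ'$, with $Q'$ conjugate to $Q$ in the diagonal case. In polar
coordinates the integrand becomes $t^{-N-1}$. -/
theorem lintegral_norm_rpow_neg_far (hN : 0 < N) :
    ∃ C : ℝ, 0 ≤ C ∧ ∀ ρ : ℝ, 0 < ρ →
      ∫⁻ z : Eu N, (Ici ρ).indicator (fun t : ℝ => ENNReal.ofReal (t ^ (-(2 * N : ℝ)))) ‖z‖
        ≤ ENNReal.ofReal (C * ρ ^ (-(N : ℝ))) := by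
  have : Nontrivial (Eu N) := by
    have : Nonempty (Fin N) := ⟨⟨0, hN⟩⟩
    infer_instance
  have hN' : (0 : ℝ) < N := by exact_mod_cast hN
  refine ⟨N * (volume : Measure (Eu N)).real (Metric.ball 0 1) * (N : ℝ)⁻¹,
    by positivity, fun ρ hρ => ?_⟩
  have e : ∀ z : Eu N, (Ici ρ).indicator (fun t : ℝ => ENNReal.ofReal (t ^ (-(2 * N : ℝ)))) ‖z‖
      = ENNReal.ofReal ((Ici ρ).indicator (fun t : ℝ => t ^ (-(2 * N : ℝ))) ‖z‖) := by
    intro z; by_cases h : ρ ≤ ‖z‖ <;> simp [h]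
  have hcongr : ∀ y ∈ Ioi (0 : ℝ),
      y ^ (N - 1) • (Ici ρ).indicator (fun t : ℝ => t ^ (-(2 * N : ℝ))) y
      = (Ici ρ).indicator (fun y : ℝ => y ^ (-(N : ℝ) - 1)) y := by
    intro y hy
    have hy : 0 < y := hy
    by_cases h : ρ ≤ y
    · rw [indicator_of_mem (show y ∈ Ici ρ from h), indicator_of_mem (show y ∈ Ici ρ from h)]
      rw [smul_eq_mul, ← Real.rpow_natCast, ← Real.rpow_add hy, Nat.cast_pred hN]
      congr 1; ring
    · rw [indicator_of_notMem (show y ∉ Ici ρ from h), indicator_of_notMem (show y ∉ Ici ρ from h)]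
      simp
  have hint : IntegrableOn
      (fun y : ℝ => y ^ (N - 1) • (Ici ρ).indicator (fun t : ℝ => t ^ (-(2 * N : ℝ))) y)
      (Ioi 0) := by
    rw [integrableOn_congr_fun hcongr measurableSet_Ioi]
    refine Integrable.integrableOn ?_
    rw [integrable_indicator_iff measurableSet_Ici, integrableOn_Ici_iff_integrableOn_Ioi]
    exact integrableOn_Ioi_rpow_of_lt (by linarith) hρ
  have hint' := (integrable_fun_norm_addHaar (volume : Measure (Eu N))
    (f := (Ici ρ).indicator (fun t : ℝ => t ^ (-(2 * N : ℝ))))).2 (by simpa using hint)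
  simp_rw [e]
  rw [← ofReal_integral_eq_lintegral_ofReal hint' (ae_of_all _ fun z => by
    exact indicator_apply_nonneg fun _ => Real.rpow_nonneg (norm_nonneg _) _)]
  refine ENNReal.ofReal_le_ofReal (le_of_eq ?_)
  rw [integral_fun_norm_addHaar]
  have e2 : ∫ y in Ioi (0 : ℝ), y ^ (N - 1) • (Ici ρ).indicator (fun t : ℝ => t ^ (-(2 * N : ℝ))) y
      = ρ ^ (-(N : ℝ)) * (N : ℝ)⁻¹ := by
    rw [setIntegral_congr_fun measurableSet_Ioi hcongr,
      setIntegral_indicator measurableSet_Ici,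
      inter_eq_right.2 (Ici_subset_Ioi.2 hρ), integral_Ici_eq_integral_Ioi,
      integral_Ioi_rpow_of_lt (by linarith) hρ]
    rw [show -(N : ℝ) - 1 + 1 = -N by ring]
    field_simp
  simp only [finrank_euclideanSpace, Fintype.card_fin]
  rw [e2]
  simp only [nsmul_eq_mul, smul_eq_mul]
  ring

/-- The potential of a function truncated at height `α`. -/
theorem lintegral_min_mul_norm_rpow_le (hN : 0 < N) {l Q : ℝ} (hl : 0 < l) (hl' : l < N)
    (hQ : 2 / Q + l / N = 2) :
    ∃ C : ℝ, 0 ≤ C ∧ ∀ b : Eu N → ℝ≥0∞, AEMeasurable b volume → ∫⁻ y, b y ^ Q ≤ 1 →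
      ∀ (x : Eu N) (α : ℝ), 0 < α →
        ∫⁻ y, min (b y) (ENNReal.ofReal α) * ENNReal.ofReal (‖x - y‖ ^ (-l))
          ≤ ENNReal.ofReal (C * α ^ (Q - 1)) := by
  obtain ⟨C₁, hC₁, h₁⟩ := lintegral_norm_rpow_neg_near hN hl'
  obtain ⟨C₂, hC₂, h₂⟩ := lintegral_norm_rpow_neg_far hN
  have hN' : (0 : ℝ) < N := by exact_mod_cast hN
  have hQ0 : 0 < Q := by
    by_contra h
    have h3 : 2 / Q ≤ 0 := div_nonpos_of_nonneg_of_nonpos (by norm_num) (by linarith)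
    have h4 : l / N < 1 := (div_lt_one hN').2 hl'
    linarith
  have hlQ : l = N * (2 - 2 / Q) := by field_simp at hQ ⊢; linarith
  have hQ1 : 1 < Q := by
    by_contra h
    have h3 : 2 ≤ 2 / Q := by rw [le_div_iff₀ hQ0]; linarith
    nlinarith
  set Q' : ℝ := Q / (Q - 1) with hQ'
  have hconj : Q.HolderConjugate Q' := Real.HolderConjugate.conjExponent hQ1
  -- The diagonal relation makes the Hölder-dual power of the kernel $|x-y|^{-2N}$ for every $l$.
  have hlQ' : l * Q' = 2 * N := by
    have : Q - 1 ≠ 0 := by linarith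
    rw [hlQ, hQ']; field_simp
  refine ⟨C₁ + C₂ ^ (1 / Q'), by positivity, fun b hb hb1 x α hα => ?_⟩
  -- This radius balances the near and far parts: $\alpha\rho^{N-l}$ and $(\rho^{-N})^{1/Q'}$ both
  -- equal $\alpha^{Q-1}$.
  set ρ : ℝ := α ^ (-(Q / N)) with hρdef
  have hρ : 0 < ρ := Real.rpow_pos_of_pos hα _
  set near : ℝ → ℝ≥0∞ := (Iio ρ).indicator (fun t : ℝ => ENNReal.ofReal (t ^ (-l))) with hnear
  set far : ℝ → ℝ≥0∞ := (Ici ρ).indicator (fun t : ℝ => ENNReal.ofReal (t ^ (-l))) with hfar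
  have hnm : Measurable near := by
    refine Measurable.indicator ?_ measurableSet_Iio; fun_prop
  have hfm : Measurable far := by
    refine Measurable.indicator ?_ measurableSet_Ici; fun_prop
  -- Near $x$ the height $\alpha$ bounds the truncated function; far from $x$ the function $b$
  -- itself is kept for Hölder's inequality.
  have hpt : ∀ y, min (b y) (ENNReal.ofReal α) * ENNReal.ofReal (‖x - y‖ ^ (-l))
      ≤ ENNReal.ofReal α * near ‖x - y‖ + b y * far ‖x - y‖ := by
    intro y
    by_cases h : ‖x - y‖ < ρ
    · simp only [hnear, indicator_of_mem (show ‖x - y‖ ∈ Iio ρ from h)]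
      refine le_trans ?_ le_self_add
      gcongr
      exact min_le_right _ _
    · simp only [hfar, indicator_of_mem (show ‖x - y‖ ∈ Ici ρ from not_lt.1 h)]
      refine le_trans ?_ le_add_self
      gcongr
      exact min_le_left _ _
  refine (lintegral_mono hpt).trans ?_
  rw [lintegral_add_left (by fun_prop), lintegral_const_mul _ (by fun_prop)]
  have e1 : ∫⁻ y, near ‖x - y‖ ≤ ENNReal.ofReal (C₁ * ρ ^ (N - l)) := by
    rw [lintegral_sub_left_eq_self (fun z : Eu N => near ‖z‖) x]
    exact h₁ ρ hρ
  have e2 : ∫⁻ y, b y * far ‖x - y‖ ≤ ENNReal.ofReal ((C₂ * ρ ^ (-(N : ℝ))) ^ (1 / Q')) := by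
    refine (ENNReal.lintegral_mul_le_Lp_mul_Lq volume hconj hb
      (g := fun y => far ‖x - y‖) (by fun_prop)).trans ?_
    have e3 : ∫⁻ y, far ‖x - y‖ ^ Q' ≤ ENNReal.ofReal (C₂ * ρ ^ (-(N : ℝ))) := by
      rw [lintegral_sub_left_eq_self (fun z : Eu N => far ‖z‖ ^ Q') x]
      refine le_trans (lintegral_mono fun z => ?_) (h₂ ρ hρ)
      by_cases h : ρ ≤ ‖z‖
      · simp only [hfar, indicator_of_mem (show ‖z‖ ∈ Ici ρ from h)]
        rw [ENNReal.ofReal_rpow_of_nonneg (by positivity) hconj.symm.pos.le,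
          ← Real.rpow_mul (norm_nonneg _), neg_mul, hlQ']
      · simp only [hfar, indicator_of_notMem (show ‖z‖ ∉ Ici ρ from h)]
        rw [ENNReal.zero_rpow_of_pos hconj.symm.pos]
    calc _ ≤ (1 : ℝ≥0∞) ^ (1 / Q) * (ENNReal.ofReal (C₂ * ρ ^ (-(N : ℝ)))) ^ (1 / Q') := by
          gcongr
      _ = _ := by
          rw [ENNReal.one_rpow, one_mul, ENNReal.ofReal_rpow_of_nonneg (by positivity)
            (one_div_pos.2 hconj.symm.pos).le]
  calc _ ≤ ENNReal.ofReal α * ENNReal.ofReal (C₁ * ρ ^ (N - l))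
          + ENNReal.ofReal ((C₂ * ρ ^ (-(N : ℝ))) ^ (1 / Q')) := by gcongr
    _ = _ := by
      rw [← ENNReal.ofReal_mul hα.le, ← ENNReal.ofReal_add (by positivity) (by positivity)]
      congr 1
      have i1 : ρ ^ (N - l) * α = α ^ (Q - 1) := by
        rw [hρdef, ← Real.rpow_mul hα.le, ← Real.rpow_add_one hα.ne']
        congr 1
        rw [hlQ]; field_simp; ring
      have i2 : (ρ ^ (-(N : ℝ))) ^ (1 / Q') = α ^ (Q - 1) := by
        rw [hρdef, ← Real.rpow_mul hα.le, ← Real.rpow_mul hα.le]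
        congr 1
        have : Q - 1 ≠ 0 := by linarith
        rw [hQ']; field_simp
      rw [Real.mul_rpow hC₂ (by positivity), i2, ← i1]
      ring

/-- Diagonal Hardy–Littlewood–Sobolev inequality for functions in the unit ball. -/
theorem hls_unit (hN : 0 < N) {l Q : ℝ} (hl : 0 < l) (hl' : l < N)
    (hQ : 2 / Q + l / N = 2) :
    ∃ C : ℝ≥0, ∀ a b : Eu N → ℝ≥0∞, AEMeasurable a volume → AEMeasurable b volume →
      ∫⁻ y, a y ^ Q ≤ 1 → ∫⁻ y, b y ^ Q ≤ 1 →
        ∫⁻ z : Eu N × Eu N, a z.1 * b z.2 * ENNReal.ofReal (‖z.1 - z.2‖ ^ (-l)) ≤ C := by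
  obtain ⟨C, hC, h⟩ := lintegral_min_mul_norm_rpow_le hN hl hl' hQ
  have hQ0 : 0 < Q := by
    by_contra h
    have h3 : 2 / Q ≤ 0 := div_nonpos_of_nonneg_of_nonpos (by norm_num) (by linarith)
    have h4 : l / N < 1 := (div_lt_one (by exact_mod_cast hN)).2 hl'
    linarith
  -- Truncating $b$ at height $a(x)$ bounds the potential by $C\,a(x)^{Q-1}$, so the outer integrand
  -- becomes $C\,a^Q$.
  have key : ∀ a b : Eu N → ℝ≥0∞, AEMeasurable a volume → AEMeasurable b volume →
      ∫⁻ y, a y ^ Q ≤ 1 → ∫⁻ y, b y ^ Q ≤ 1 →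
        ∫⁻ x, ∫⁻ y, a x * (min (b y) (a x) * ENNReal.ofReal (‖x - y‖ ^ (-l)))
          ≤ ENNReal.ofReal C := by
    intro a b ha hb ha1 hb1
    have hfin : ∀ᵐ x, a x ^ Q < ⊤ := ae_lt_top' (ha.pow_const Q) (ha1.trans_lt (by simp)).ne
    calc _ ≤ ∫⁻ x, ENNReal.ofReal C * a x ^ Q := by
          refine lintegral_mono_ae ?_
          filter_upwards [hfin] with x hx
          have hx' : a x ≠ ⊤ := by
            rintro h0; rw [h0, ENNReal.top_rpow_of_pos hQ0] at hx; exact lt_irrefl _ hx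
          rw [lintegral_const_mul' _ _ hx']
          rcases eq_or_ne (a x) 0 with h0 | h0
          · rw [h0]; simp
          have hpos := ENNReal.toReal_pos h0 hx'
          have h2 := h b hb hb1 x _ hpos
          rw [ENNReal.ofReal_toReal hx'] at h2
          calc _ ≤ a x * ENNReal.ofReal (C * (a x).toReal ^ (Q - 1)) := by gcongr
            _ = _ := by
              rw [ENNReal.ofReal_mul hC, ← ENNReal.ofReal_rpow_of_pos hpos,
                ENNReal.ofReal_toReal hx', mul_left_comm]
              congr 1
              nth_rewrite 1 [← ENNReal.rpow_one (a x)]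
              rw [← ENNReal.rpow_add _ _ h0 hx']
              congr 1; ring
      _ ≤ ENNReal.ofReal C := by
          rw [lintegral_const_mul' _ _ ENNReal.ofReal_ne_top]
          exact (mul_le_mul_right ha1 _).trans (by simp)
  refine ⟨(2 * C).toNNReal, fun a b ha hb ha1 hb1 => ?_⟩
  have ha' : AEMeasurable (fun z : Eu N × Eu N => a z.1) volume := ha.comp_fst
  have hb' : AEMeasurable (fun z : Eu N × Eu N => b z.2) volume := hb.comp_snd
  have hk : Measurable (fun z : Eu N × Eu N => ENNReal.ofReal (‖z.1 - z.2‖ ^ (-l))) := by fun_prop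
  have m1 : AEMeasurable (fun z : Eu N × Eu N =>
      a z.1 * (min (b z.2) (a z.1) * ENNReal.ofReal (‖z.1 - z.2‖ ^ (-l)))) volume :=
    ha'.mul ((hb'.min ha').mul hk.aemeasurable)
  have m2 : AEMeasurable (fun z : Eu N × Eu N =>
      b z.2 * (min (a z.1) (b z.2) * ENNReal.ofReal (‖z.1 - z.2‖ ^ (-l)))) volume :=
    hb'.mul ((ha'.min hb').mul hk.aemeasurable)
  -- A product is its larger factor times its smaller one, so one of the two truncated terms already
  -- equals it.
  have hpt : ∀ z : Eu N × Eu N, a z.1 * b z.2 * ENNReal.ofReal (‖z.1 - z.2‖ ^ (-l))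
      ≤ a z.1 * (min (b z.2) (a z.1) * ENNReal.ofReal (‖z.1 - z.2‖ ^ (-l)))
        + b z.2 * (min (a z.1) (b z.2) * ENNReal.ofReal (‖z.1 - z.2‖ ^ (-l))) := by
    intro z
    rcases le_total (a z.1) (b z.2) with hab | hab
    · refine le_trans (le_of_eq ?_) le_add_self
      rw [min_eq_left hab]; ring
    · refine le_trans (le_of_eq ?_) le_self_add
      rw [min_eq_left hab]; ring
  refine (lintegral_mono hpt).trans ?_
  rw [lintegral_add_left' m1]
  have k1 : ∫⁻ z : Eu N × Eu N,
      a z.1 * (min (b z.2) (a z.1) * ENNReal.ofReal (‖z.1 - z.2‖ ^ (-l)))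
      ≤ ENNReal.ofReal C := by
    rw [Measure.volume_eq_prod, lintegral_prod _ m1]
    exact key a b ha hb ha1 hb1
  have k2 : ∫⁻ z : Eu N × Eu N,
      b z.2 * (min (a z.1) (b z.2) * ENNReal.ofReal (‖z.1 - z.2‖ ^ (-l)))
      ≤ ENNReal.ofReal C := by
    rw [Measure.volume_eq_prod, lintegral_prod_symm _ m2]
    simp_rw [norm_sub_rev]
    exact key b a hb ha hb1 ha1
  refine (add_le_add k1 k2).trans (le_of_eq ?_)
  rw [← ENNReal.ofReal_add hC hC, ← two_mul]; rfl

/-- Diagonal Hardy–Littlewood–Sobolev inequality. -/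
theorem hls (hN : 0 < N) {l Q : ℝ} (hl : 0 < l) (hl' : l < N) (hQ : 2 / Q + l / N = 2) :
    ∃ C : ℝ≥0, ∀ a b : Eu N → ℝ≥0∞, AEMeasurable a volume → AEMeasurable b volume →
      ∫⁻ y, a y ^ Q ≠ ⊤ → ∫⁻ y, b y ^ Q ≠ ⊤ →
        ∫⁻ z : Eu N × Eu N, a z.1 * b z.2 * ENNReal.ofReal (‖z.1 - z.2‖ ^ (-l))
          ≤ C * (∫⁻ y, a y ^ Q) ^ (1 / Q) * (∫⁻ y, b y ^ Q) ^ (1 / Q) := by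
  obtain ⟨C, h⟩ := hls_unit hN hl hl' hQ
  have hQ0 : 0 < Q := by
    by_contra h
    have h3 : 2 / Q ≤ 0 := div_nonpos_of_nonneg_of_nonpos (by norm_num) (by linarith)
    have h4 : l / N < 1 := (div_lt_one (by exact_mod_cast hN)).2 hl'
    linarith
  have hscale : ∀ a : Eu N → ℝ≥0∞, ∫⁻ y, a y ^ Q ≠ ⊤ → ∫⁻ y, a y ^ Q ≠ 0 →
      ∫⁻ y, (((∫⁻ y, a y ^ Q) ^ (1 / Q))⁻¹ * a y) ^ Q ≤ 1 := by
    intro a h1 h2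
    have e : ∀ y, (((∫⁻ y, a y ^ Q) ^ (1 / Q))⁻¹ * a y) ^ Q = (∫⁻ y, a y ^ Q)⁻¹ * a y ^ Q := by
      intro y
      rw [ENNReal.mul_rpow_of_nonneg _ _ hQ0.le, ENNReal.inv_rpow, ← ENNReal.rpow_mul,
        one_div_mul_cancel hQ0.ne', ENNReal.rpow_one]
    simp_rw [e]
    rw [lintegral_const_mul' _ _ (ENNReal.inv_ne_top.2 h2), ENNReal.inv_mul_cancel h2 h1]
  have hz : ∀ a : Eu N → ℝ≥0∞, AEMeasurable a volume → ∫⁻ y, a y ^ Q = 0 → ∀ᵐ y, a y = 0 := by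
    intro a ha h0
    rw [lintegral_eq_zero_iff' (ha.pow_const Q)] at h0
    filter_upwards [h0] with y hy
    exact (ENNReal.rpow_eq_zero_iff_of_pos hQ0).1 hy
  refine ⟨C, fun a b ha hb ha1 hb1 => ?_⟩
  -- A function of zero norm cannot be normalized, but then the left side vanishes.
  rcases eq_or_ne (∫⁻ y, a y ^ Q) 0 with ha0 | ha0
  · refine le_trans (le_of_eq ?_) zero_le
    have h1 : ∀ᵐ z : Eu N × Eu N, a z.1 = 0 :=
      Measure.quasiMeasurePreserving_fst.ae (hz a ha ha0)
    rw [lintegral_congr_ae (g := fun _ => 0) (h1.mono fun z hz => by simp only [hz, zero_mul])]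
    simp
  rcases eq_or_ne (∫⁻ y, b y ^ Q) 0 with hb0 | hb0
  · refine le_trans (le_of_eq ?_) zero_le
    have h1 : ∀ᵐ z : Eu N × Eu N, b z.2 = 0 :=
      Measure.quasiMeasurePreserving_snd.ae (hz b hb hb0)
    rw [lintegral_congr_ae (g := fun _ => 0)
      (h1.mono fun z hz => by simp only [hz, zero_mul, mul_zero])]
    simp
  have h1 := h _ _ (ha.const_mul ((∫⁻ y, a y ^ Q) ^ (1 / Q))⁻¹)
    (hb.const_mul ((∫⁻ y, b y ^ Q) ^ (1 / Q))⁻¹) (hscale a ha1 ha0) (hscale b hb1 hb0)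
  set A := (∫⁻ y, a y ^ Q) ^ (1 / Q) with hA
  set B := (∫⁻ y, b y ^ Q) ^ (1 / Q) with hB
  have hA0 : A ≠ 0 := by simp [hA, ENNReal.rpow_eq_zero_iff, ha0, ha1]
  have hB0 : B ≠ 0 := by simp [hB, ENNReal.rpow_eq_zero_iff, hb0, hb1]
  have hAt : A ≠ ⊤ := ENNReal.rpow_ne_top_of_nonneg (by positivity) ha1
  have hBt : B ≠ ⊤ := ENNReal.rpow_ne_top_of_nonneg (by positivity) hb1
  calc ∫⁻ z : Eu N × Eu N, a z.1 * b z.2 * ENNReal.ofReal (‖z.1 - z.2‖ ^ (-l))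
      = ∫⁻ z : Eu N × Eu N, (A * B) *
          (A⁻¹ * a z.1 * (B⁻¹ * b z.2) * ENNReal.ofReal (‖z.1 - z.2‖ ^ (-l))) := by
        refine lintegral_congr fun z => ?_
        rw [show (A * B) * (A⁻¹ * a z.1 * (B⁻¹ * b z.2) * ENNReal.ofReal (‖z.1 - z.2‖ ^ (-l)))
          = (A * A⁻¹) * (B * B⁻¹) * (a z.1 * b z.2 * ENNReal.ofReal (‖z.1 - z.2‖ ^ (-l))) by ring,
          ENNReal.mul_inv_cancel hA0 hAt, ENNReal.mul_inv_cancel hB0 hBt]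
        simp
    _ = (A * B) * ∫⁻ z : Eu N × Eu N,
          (A⁻¹ * a z.1 * (B⁻¹ * b z.2) * ENNReal.ofReal (‖z.1 - z.2‖ ^ (-l))) :=
        lintegral_const_mul' _ _ (ENNReal.mul_ne_top hAt hBt)
    _ ≤ (A * B) * C := by gcongr
    _ = _ := by ring

end HLS

/-! ### Modulars on the Sobolev space and superposition operators as multipliers -/

section Modular

variable {N : ℕ} {p : CPlus N}

/-- The modular with exponent `e` is bounded on the unit ball of `W^{1,p(x)}`. -/
def ModularBounded (p : CPlus N) (e : Eu N → ℝ) : Prop :=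
  ∃ K : ℝ≥0, ∀ u : W1p p, ‖u‖ < 1 → ∫⁻ x, ‖u x‖ₑ ^ e x ≤ K

theorem aemeasurable_enorm (u : W1p p) : AEMeasurable (fun x => ‖u x‖ₑ) volume :=
  u.memLpVar.1.enorm

/-- Since $1\le e\le M$, the factor $|c|^{e(x)}$ is at most $|c|$ when $|c|\le 1$ and at most
$|c|^M$ otherwise. -/
theorem lintegral_enorm_smul_rpow_le {e : Eu N → ℝ} (he : ∀ x, 1 ≤ e x) {M : ℝ}
    (heM : ∀ x, e x ≤ M) (c : ℝ) (u : W1p p) :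
    ∫⁻ x, ‖(c • u) x‖ₑ ^ e x ≤ (max ‖c‖ₑ (‖c‖ₑ ^ M)) * ∫⁻ x, ‖u x‖ₑ ^ e x := by
  have hM : 0 ≤ M := zero_le_one.trans ((he 0).trans (heM 0))
  rw [← lintegral_const_mul' _ _ (by
    rw [ne_eq, max_eq_top, not_or]
    exact ⟨enorm_ne_top, ENNReal.rpow_ne_top_of_nonneg hM enorm_ne_top⟩)]
  refine lintegral_mono_ae ?_
  filter_upwards [W1p.coeFn_smul c u] with x hx
  rw [hx, enorm_smul, ENNReal.mul_rpow_of_nonneg _ _ (zero_le_one.trans (he x))]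
  gcongr
  rcases le_total ‖c‖ₑ 1 with h | h
  · refine le_trans ?_ (le_max_left _ _)
    simpa using ENNReal.rpow_le_rpow_of_exponent_ge h (he x)
  · exact (ENNReal.rpow_le_rpow_of_exponent_le h (heM x)).trans (le_max_right _ _)

/-- Transfers bounds on the open unit ball to arbitrary elements; choosing $c$ strictly above the
norm keeps $w$ inside the ball. -/
theorem W1p.exists_eq_smul (u : W1p p) {c : ℝ} (hc : ‖u‖ < c) :
    ∃ w : W1p p, ‖w‖ < 1 ∧ u = c • w := by
  have hc0 : 0 < c := (norm_nonneg u).trans_lt hc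
  refine ⟨c⁻¹ • u, ?_, by rw [smul_smul, mul_inv_cancel₀ hc0.ne', one_smul]⟩
  rw [norm_smul, norm_inv, Real.norm_of_nonneg hc0.le, inv_mul_lt_one₀ hc0]
  exact hc

theorem ModularBounded.lt_top {e : Eu N → ℝ} (h : ModularBounded p e) (he : ∀ x, 1 ≤ e x) {M : ℝ}
    (heM : ∀ x, e x ≤ M) (u : W1p p) : ∫⁻ x, ‖u x‖ₑ ^ e x < ⊤ := by
  obtain ⟨K, hK⟩ := h
  obtain ⟨w, hw, huw⟩ := u.exists_eq_smul (lt_add_one ‖u‖)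
  have hM : 0 ≤ M := zero_le_one.trans ((he 0).trans (heM 0))
  rw [huw]
  refine (lintegral_enorm_smul_rpow_le he heM _ w).trans_lt (ENNReal.mul_lt_top ?_
    ((hK w hw).trans_lt ENNReal.coe_lt_top))
  rw [max_lt_iff]
  exact ⟨enorm_lt_top, ENNReal.rpow_lt_top_of_nonneg hM enorm_ne_top⟩

/-- With $u=2\|u\|w$ and $\|w\|<1$, the factor $(2\|u\|)^{e(x)}$ is at most $2\|u\|$ as soon as
$\|u\|<1/2$, because $e\ge 1$. -/
theorem ModularBounded.tendsto_zero {e : Eu N → ℝ} (h : ModularBounded p e) (he : ∀ x, 1 ≤ e x)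
    {M : ℝ} (heM : ∀ x, e x ≤ M) :
    Tendsto (fun u : W1p p => ∫⁻ x, ‖u x‖ₑ ^ e x) (nhds 0) (nhds 0) := by
  obtain ⟨K, hK⟩ := h
  have hM : 1 ≤ M := (he 0).trans (heM 0)
  have hlim : Tendsto (fun u : W1p p => ENNReal.ofReal (2 * ‖u‖) * K) (nhds 0) (nhds 0) := by
    have h1 : Tendsto (fun u : W1p p => ENNReal.ofReal (2 * ‖u‖)) (nhds 0) (nhds 0) := by
      have : Continuous fun u : W1p p => ENNReal.ofReal (2 * ‖u‖) :=
        ENNReal.continuous_ofReal.comp (by fun_prop)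
      simpa using this.tendsto 0
    simpa using ENNReal.Tendsto.mul_const h1 (Or.inr (ENNReal.coe_ne_top (r := K)))
  refine tendsto_of_tendsto_of_tendsto_of_le_of_le' tendsto_const_nhds hlim
    (Eventually.of_forall fun _ => zero_le) ?_
  have hball : ∀ᶠ u : W1p p in nhds 0, ‖u‖ < 1 / 2 := by
    have := (continuous_norm (E := W1p p)).tendsto 0
    rw [norm_zero] at this
    exact this.eventually (gt_mem_nhds (by norm_num))
  filter_upwards [hball] with u hu
  rcases eq_or_ne u 0 with rfl | h0
  · have h2 : ((0 : W1p p) : Eu N → ℝ) =ᵐ[volume] fun _ => 0 := AEEqFun.coeFn_zero (β := ℝ)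
    have h3 : ∫⁻ x, ‖(0 : W1p p) x‖ₑ ^ e x = ∫⁻ x : Eu N, 0 :=
      lintegral_congr_ae (h2.mono fun x hx => by
        simp only [hx, enorm_zero]
        exact ENNReal.zero_rpow_of_pos (zero_lt_one.trans_le (he x)))
    rw [h3]; simp
  have hpos : 0 < ‖u‖ := norm_pos_iff.2 h0
  obtain ⟨w, hw, huw⟩ := u.exists_eq_smul (show ‖u‖ < 2 * ‖u‖ by linarith)
  calc ∫⁻ x, ‖u x‖ₑ ^ e x = ∫⁻ x, ‖((2 * ‖u‖) • w) x‖ₑ ^ e x := by rw [← huw]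
    _ ≤ _ := lintegral_enorm_smul_rpow_le he heM _ w
    _ ≤ ENNReal.ofReal (2 * ‖u‖) * K := by
      gcongr
      · rw [Real.enorm_eq_ofReal (by positivity)]
        refine max_le le_rfl ?_
        have h1 : ENNReal.ofReal (2 * ‖u‖) ≤ 1 := by
          simpa using ENNReal.ofReal_le_ofReal (show 2 * ‖u‖ ≤ 1 by linarith)
        simpa using ENNReal.rpow_le_rpow_of_exponent_ge h1 hM
      · exact hK w hw

theorem enn_add_rpow_le (a b : ℝ≥0∞) {s M : ℝ} (hs : 0 ≤ s) (hM : s ≤ M) :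
    (a + b) ^ s ≤ 2 ^ M * (a ^ s + b ^ s) := by
  have h1 : a + b ≤ 2 * max a b := by
    rw [two_mul]; exact add_le_add (le_max_left _ _) (le_max_right _ _)
  calc (a + b) ^ s ≤ (2 * max a b) ^ s := ENNReal.rpow_le_rpow h1 hs
    _ = 2 ^ s * (max a b) ^ s := ENNReal.mul_rpow_of_nonneg _ _ hs
    _ ≤ 2 ^ M * (a ^ s + b ^ s) := by
      gcongr
      · norm_num
      · rcases le_total a b with h | h
        · rw [max_eq_right h]; exact le_add_self
        · rw [max_eq_left h]; exact le_self_add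

/-- Young's inequality without constants. -/
theorem enn_mul_rpow_le (h b : ℝ≥0∞) {Q R : ℝ} (hQ : 0 < Q) (hR : 1 < R) :
    (h * b) ^ Q ≤ h ^ (Q * (R / (R - 1))) + b ^ (R * Q) := by
  have hR1 : 0 < R - 1 := by linarith
  -- At $b=h^{1/(R-1)}$ the two terms on the right coincide; on either side one factor is eliminated
  -- in favour of the other.
  rcases le_total b (h ^ (1 / (R - 1))) with hb | hb
  · refine le_trans ?_ le_self_add
    calc (h * b) ^ Q ≤ (h * h ^ (1 / (R - 1))) ^ Q := by gcongr
      _ = h ^ (Q * (R / (R - 1))) := by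
        have h1 : h * h ^ (1 / (R - 1)) = h ^ (R / (R - 1)) := by
          nth_rewrite 1 [← ENNReal.rpow_one h]
          rw [← ENNReal.rpow_add_of_nonneg _ _ zero_le_one (by positivity)]
          congr 1; field_simp; ring
        rw [h1, ← ENNReal.rpow_mul, mul_comm]
  · refine le_trans ?_ le_add_self
    have h1 : h ≤ b ^ (R - 1) := by
      have := ENNReal.rpow_le_rpow hb hR1.le
      rwa [← ENNReal.rpow_mul, one_div_mul_cancel hR1.ne', ENNReal.rpow_one] at this
    calc (h * b) ^ Q ≤ (b ^ (R - 1) * b) ^ Q := by gcongr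
      _ = b ^ (R * Q) := by
        have h1 : b ^ (R - 1) * b = b ^ R := by
          nth_rewrite 2 [← ENNReal.rpow_one b]
          rw [← ENNReal.rpow_add_of_nonneg _ _ hR1.le zero_le_one]
          congr 1; ring
        rw [h1, ← ENNReal.rpow_mul]

/-- Along a subsequence the integrals are at most $2^{-k}$, so the sum of the functions has finite
integral; it is finite almost everywhere and its terms tend to zero. -/
theorem exists_subseq_ae_tendsto_zero {α : Type*} [MeasurableSpace α] {μ : Measure α}
    {d : ℕ → α → ℝ≥0∞} (hd : ∀ n, AEMeasurable (d n) μ)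
    (h : Tendsto (fun n => ∫⁻ x, d n x ∂μ) atTop (nhds 0)) :
    ∃ ms : ℕ → ℕ, StrictMono ms ∧ ∀ᵐ x ∂μ, Tendsto (fun n => d (ms n) x) atTop (nhds 0) := by
  have hev : ∀ k : ℕ, ∀ᶠ n in atTop, ∫⁻ x, d n x ∂μ ≤ (2⁻¹ : ℝ≥0∞) ^ k := fun k =>
    h.eventually (ge_mem_nhds (by
      refine ENNReal.pow_pos (by simp) k))
  obtain ⟨ms, hms, hle⟩ := extraction_forall_of_eventually hev
  refine ⟨ms, hms, ?_⟩
  have hsum : ∫⁻ x, ∑' k, d (ms k) x ∂μ ≠ ⊤ := by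
    rw [lintegral_tsum fun k => hd _]
    refine ne_top_of_le_ne_top ?_ (ENNReal.tsum_le_tsum hle)
    rw [ENNReal.tsum_geometric]
    simp
  filter_upwards [ae_lt_top' (AEMeasurable.tsum fun k => hd _) hsum] with x hx
  exact ENNReal.tendsto_atTop_zero_of_tsum_ne_top hx.ne

/-- The integral of a superposition operator with growth `R - 1` vanishing at `0`. -/
theorem tendsto_lintegral_superposition {Q R₀ R₁ : ℝ} (hQ : 1 ≤ Q) (hR₀ : 1 < R₀)
    {R : Eu N → ℝ} (hRm : Measurable R) (hR : ∀ x, R₀ ≤ R x) (hR' : ∀ x, R x ≤ R₁)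
    (hmod : ModularBounded p fun x => R x * Q) (u : W1p p) (C : ℝ≥0)
    (φ : Eu N → ℝ → ℝ≥0∞) (hφ0 : ∀ x, Tendsto (φ x) (nhds 0) (nhds 0))
    (hφm : ∀ w : W1p p, AEMeasurable (fun x => φ x (w x)) volume)
    (hφ : ∀ x t, φ x t ≤ C * (‖u x‖ₑ + ‖t‖ₑ) ^ (R x - 1)) :
    Tendsto (fun w : W1p p => ∫⁻ x, φ x (w x) ^ (Q * (R x / (R x - 1)))) (nhds 0) (nhds 0) := by
  have hR1 : ∀ x, 0 < R x - 1 := fun x => by linarith [hR x]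
  have hRR : ∀ x, 0 < R x := fun x => by linarith [hR x]
  have hQ0 : 0 < Q := by linarith
  have he1 : ∀ x, 1 ≤ R x * Q := fun x => by nlinarith [hR x]
  have heM : ∀ x, R x * Q ≤ R₁ * Q := fun x => by nlinarith [hR' x]
  have hE : ∀ x, 0 < Q * (R x / (R x - 1)) := fun x => mul_pos hQ0 (div_pos (hRR x) (hR1 x))
  have hEM : ∀ x, Q * (R x / (R x - 1)) ≤ Q * (R₀ / (R₀ - 1)) := fun x => by
    gcongr ?_ * ?_
    rw [div_le_div_iff₀ (hR1 x) (by linarith)]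
    nlinarith [hR x]
  -- Since $R/(R-1)$ decreases in $R$, the exponent on $C$ is largest at $R_0$; the maximum with 1
  -- makes powers increasing in the exponent.
  set M : ℝ≥0∞ := (max 1 (C : ℝ≥0∞)) ^ (Q * (R₀ / (R₀ - 1))) * 2 ^ (R₁ * Q) with hMdef
  have hE0 : 0 ≤ Q * (R₀ / (R₀ - 1)) := (hE 0).le.trans (hEM 0)
  have hR₁Q : 0 ≤ R₁ * Q := zero_le_one.trans ((he1 0).trans (heM 0))
  have hMtop : M ≠ ⊤ := by
    refine ENNReal.mul_ne_top (ENNReal.rpow_ne_top_of_nonneg hE0 (by simp))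
      (ENNReal.rpow_ne_top_of_nonneg hR₁Q (by simp))
  have hdom : ∀ x t, φ x t ^ (Q * (R x / (R x - 1)))
      ≤ M * ‖u x‖ₑ ^ (R x * Q) + M * ‖t‖ₑ ^ (R x * Q) := by
    intro x t
    calc φ x t ^ (Q * (R x / (R x - 1)))
        ≤ (C * (‖u x‖ₑ + ‖t‖ₑ) ^ (R x - 1)) ^ (Q * (R x / (R x - 1))) :=
          ENNReal.rpow_le_rpow (hφ x t) (hE x).le
      _ = C ^ (Q * (R x / (R x - 1))) * (‖u x‖ₑ + ‖t‖ₑ) ^ (R x * Q) := by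
          rw [ENNReal.mul_rpow_of_nonneg _ _ (hE x).le, ← ENNReal.rpow_mul]
          congr 2
          have := (hR1 x).ne'
          field_simp
      _ ≤ (max 1 (C : ℝ≥0∞)) ^ (Q * (R₀ / (R₀ - 1))) *
          (2 ^ (R₁ * Q) * (‖u x‖ₑ ^ (R x * Q) + ‖t‖ₑ ^ (R x * Q))) := by
          gcongr
          · exact (ENNReal.rpow_le_rpow (le_max_right _ _) (hE x).le).trans
              (ENNReal.rpow_le_rpow_of_exponent_le (le_max_left _ _) (hEM x))
          · exact enn_add_rpow_le _ _ (zero_le_one.trans (he1 x)) (heM x)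
      _ = _ := by rw [hMdef]; ring
  -- Convergence of the modulars yields pointwise convergence only along subsequences, which is
  -- enough here.
  refine tendsto_of_subseq_tendsto fun ws hws => ?_
  have hd0 := (hmod.tendsto_zero he1 heM).comp hws
  have hmeas : ∀ w : W1p p, AEMeasurable (fun x => ‖w x‖ₑ ^ (R x * Q)) volume := fun w =>
    (aemeasurable_enorm w).pow (hRm.mul_const Q).aemeasurable
  obtain ⟨ms, hms, hae⟩ := exists_subseq_ae_tendsto_zero (fun n => hmeas (ws n)) hd0
  refine ⟨ms, ?_⟩
  have hXm : ∀ n, AEMeasurable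
      (fun x => φ x (ws (ms n) x) ^ (Q * (R x / (R x - 1)))) volume := fun n =>
    (hφm _).pow (by fun_prop)
  have hX0 : ∀ᵐ x, Tendsto (fun n => φ x (ws (ms n) x) ^ (Q * (R x / (R x - 1)))) atTop
      (nhds 0) := by
    filter_upwards [hae] with x hx
    have h1 : Tendsto (fun n => ‖ws (ms n) x‖ₑ) atTop (nhds 0) := by
      have h2 := (ENNReal.continuous_rpow_const (y := (R x * Q)⁻¹)).tendsto 0 |>.comp hx
      have h3 : R x * Q ≠ 0 := by linarith [he1 x]
      rw [ENNReal.zero_rpow_of_pos (by have := he1 x; positivity)] at h2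
      refine h2.congr fun n => ?_
      simp only [Function.comp]
      rw [← ENNReal.rpow_mul, mul_inv_cancel₀ h3, ENNReal.rpow_one]
    have h2 : Tendsto (fun n => ws (ms n) x) atTop (nhds 0) := by
      rw [tendsto_zero_iff_norm_tendsto_zero]
      have := (ENNReal.tendsto_toReal ENNReal.zero_ne_top).comp h1
      simpa [Function.comp_def] using this
    have h3 := (ENNReal.continuous_rpow_const (y := Q * (R x / (R x - 1)))).tendsto 0 |>.comp
      ((hφ0 x).comp h2)
    rwa [ENNReal.zero_rpow_of_pos (hE x)] at h3
  -- The majorant has a part $M|w_n|^{RQ}$ that moves with $n$. Subtracting it leaves the fixed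
  -- integrable majorant $M|u|^{RQ}$; the integral of the moving part tends to zero and is added
  -- back below.
  have hT : Tendsto (fun n => ∫⁻ x, (φ x (ws (ms n) x) ^ (Q * (R x / (R x - 1)))
      - M * ‖ws (ms n) x‖ₑ ^ (R x * Q))) atTop (nhds (∫⁻ _ : Eu N, 0)) := by
    refine tendsto_lintegral_of_dominated_convergence' (fun x => M * ‖u x‖ₑ ^ (R x * Q))
      (fun n => (hXm n).sub ((hmeas _).const_mul M)) (fun n => ae_of_all _ fun x => ?_) ?_ ?_
    · exact tsub_le_iff_right.2 (hdom x _)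
    · rw [lintegral_const_mul' _ _ hMtop]
      exact ENNReal.mul_ne_top hMtop (hmod.lt_top he1 heM u).ne
    · filter_upwards [hX0] with x hx
      exact tendsto_of_tendsto_of_tendsto_of_le_of_le tendsto_const_nhds hx
        (fun _ => zero_le) fun _ => tsub_le_self
  rw [lintegral_zero] at hT
  have hD : Tendsto (fun n => M * ∫⁻ x, ‖ws (ms n) x‖ₑ ^ (R x * Q)) atTop (nhds 0) := by
    simpa using ENNReal.Tendsto.const_mul (hd0.comp hms.tendsto_atTop) (Or.inr hMtop)
  have hsum := hT.add hD
  rw [add_zero] at hsum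
  refine tendsto_of_tendsto_of_tendsto_of_le_of_le tendsto_const_nhds hsum
    (fun _ => zero_le) fun n => ?_
  simp only
  rw [← lintegral_const_mul' _ _ hMtop, ← lintegral_add_right' _ ((hmeas _).const_mul M)]
  exact lintegral_mono fun x => le_tsub_add

/-- Uniform smallness of a superposition operator as a multiplier into `L^Q`. -/
theorem eventually_lintegral_superposition_mul_le {Q R₀ R₁ : ℝ} (hQ : 1 ≤ Q) (hR₀ : 1 < R₀)
    {R : Eu N → ℝ} (hRm : Measurable R) (hR : ∀ x, R₀ ≤ R x) (hR' : ∀ x, R x ≤ R₁)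
    (hmod : ModularBounded p fun x => R x * Q) (u : W1p p) (C : ℝ≥0)
    (φ : Eu N → ℝ → ℝ≥0∞) (hφ0 : ∀ x, Tendsto (φ x) (nhds 0) (nhds 0))
    (hφm : ∀ w : W1p p, AEMeasurable (fun x => φ x (w x)) volume)
    (hφ : ∀ x t, φ x t ≤ C * (‖u x‖ₑ + ‖t‖ₑ) ^ (R x - 1)) {ε : ℝ≥0∞} (hε : 0 < ε) :
    ∀ᶠ w : W1p p in nhds 0, ∀ v : W1p p, ‖v‖ < 1 →
      ∫⁻ x, (φ x (w x) * ‖v x‖ₑ) ^ Q ≤ ε := by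
  have hR1 : ∀ x, 0 < R x - 1 := fun x => by linarith [hR x]
  have hRR : ∀ x, 0 < R x := fun x => by linarith [hR x]
  have hQ0 : 0 < Q := by linarith
  have he1 : ∀ x, 1 ≤ R x * Q := fun x => by nlinarith [hR x]
  have hE : ∀ x, 0 < Q * (R x / (R x - 1)) := fun x => mul_pos hQ0 (div_pos (hRR x) (hR1 x))
  have hEM : ∀ x, Q * (R x / (R x - 1)) ≤ Q * (R₀ / (R₀ - 1)) := fun x => by
    gcongr ?_ * ?_
    rw [div_le_div_iff₀ (hR1 x) (by linarith)]
    nlinarith [hR x]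
  have hE0 : 0 ≤ Q * (R₀ / (R₀ - 1)) := (hE 0).le.trans (hEM 0)
  have hJ := tendsto_lintegral_superposition hQ hR₀ hRm hR hR' hmod u C φ hφ0 hφm hφ
  obtain ⟨K, hK⟩ := hmod
  have hε2 : 0 < ε / 2 := ENNReal.half_pos hε.ne'
  -- The weight $\delta$ goes on $v$ and $\delta^{-1}$ on $\varphi$. As $\delta^{RQ}\le\delta$, the
  -- $v$ part is at most $\delta K\le\varepsilon/2$; the cost $D$ multiplies an integral that tends
  -- to zero.
  obtain ⟨δ, hδ0, hδ1, hδK⟩ : ∃ δ : ℝ≥0∞, δ ≠ 0 ∧ δ ≤ 1 ∧ δ * K ≤ ε / 2 := by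
    have h1 : Tendsto (fun δ : ℝ≥0∞ => δ * K) (nhds 0) (nhds 0) := by
      simpa using ENNReal.Tendsto.mul_const (tendsto_id (x := nhds (0 : ℝ≥0∞)))
        (Or.inr (ENNReal.coe_ne_top (r := K)))
    have h2 := ((h1.eventually (ge_mem_nhds hε2)).and (ge_mem_nhds (zero_lt_one' ℝ≥0∞)))
    obtain ⟨δ, hδ, hδ'⟩ := ((h2.filter_mono nhdsWithin_le_nhds).and
      (self_mem_nhdsWithin (a := (0 : ℝ≥0∞)) (s := Ioi 0))).exists
    exact ⟨δ, (ne_of_gt hδ'), hδ.2, hδ.1⟩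
  have hδt : δ ≠ ⊤ := ne_top_of_le_ne_top (by simp) hδ1
  set D : ℝ≥0∞ := δ⁻¹ ^ (Q * (R₀ / (R₀ - 1))) with hD
  have hDt : D ≠ ⊤ := ENNReal.rpow_ne_top_of_nonneg hE0 (ENNReal.inv_ne_top.2 hδ0)
  have hDJ : Tendsto (fun w : W1p p => D * ∫⁻ x, φ x (w x) ^ (Q * (R x / (R x - 1))))
      (nhds 0) (nhds 0) := by
    simpa using ENNReal.Tendsto.const_mul hJ (Or.inr hDt)
  filter_upwards [hDJ.eventually (ge_mem_nhds hε2)] with w hw v hv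
  have hpt : ∀ x, (φ x (w x) * ‖v x‖ₑ) ^ Q
      ≤ D * φ x (w x) ^ (Q * (R x / (R x - 1))) + δ * ‖v x‖ₑ ^ (R x * Q) := by
    intro x
    have e : φ x (w x) * ‖v x‖ₑ = (δ⁻¹ * φ x (w x)) * (δ * ‖v x‖ₑ) := by
      rw [show (δ⁻¹ * φ x (w x)) * (δ * ‖v x‖ₑ) = (δ * δ⁻¹) * (φ x (w x) * ‖v x‖ₑ) by ring,
        ENNReal.mul_inv_cancel hδ0 hδt, one_mul]
    rw [e]
    refine (enn_mul_rpow_le _ _ hQ0 (show 1 < R x by linarith [hR x])).trans ?_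
    rw [ENNReal.mul_rpow_of_nonneg _ _ (hE x).le,
      ENNReal.mul_rpow_of_nonneg _ _ (zero_le_one.trans (he1 x))]
    gcongr
    · exact ENNReal.rpow_le_rpow_of_exponent_le (ENNReal.one_le_inv.2 hδ1) (hEM x)
    · simpa using ENNReal.rpow_le_rpow_of_exponent_ge hδ1 (he1 x)
  refine (lintegral_mono hpt).trans ?_
  rw [lintegral_add_right' _ (((aemeasurable_enorm v).pow
      (hRm.mul_const Q).aemeasurable).const_mul δ), lintegral_const_mul' _ _ hDt,
      lintegral_const_mul' _ _ hδt]
  calc _ ≤ ε / 2 + δ * K := by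
        gcongr
        exact hK v hv
    _ ≤ ε / 2 + ε / 2 := by gcongr
    _ = ε := ENNReal.add_halves ε

end Modular

/-! ### Differentiability of superposition operators into $L^Q$ -/

section Nemytskii

variable {N : ℕ} {p : CPlus N}

theorem memLp_ofReal_iff {Q : ℝ} (hQ : 0 < Q) {F : Eu N → ℝ} (hF : AEStronglyMeasurable F volume) :
    MemLp F (ENNReal.ofReal Q) volume ↔ ∫⁻ x, ‖F x‖ₑ ^ Q < ⊤ := by
  rw [MemLp, and_iff_right hF, eLpNorm_lt_top_iff_lintegral_rpow_enorm_lt_top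
    (by simpa using hQ) ENNReal.ofReal_ne_top, ENNReal.toReal_ofReal hQ.le]

theorem Lp.norm_le_of_lintegral_le {Q : ℝ} (hQ : 0 < Q) (f : Lp ℝ (ENNReal.ofReal Q) (volume : Measure (Eu N)))
    {F : Eu N → ℝ} (hF : f =ᵐ[volume] F) {c : ℝ} (hc : 0 ≤ c)
    (h : ∫⁻ x, ‖F x‖ₑ ^ Q ≤ ENNReal.ofReal c ^ Q) : ‖f‖ ≤ c := by
  rw [Lp.norm_def, eLpNorm_congr_ae hF, eLpNorm_eq_lintegral_rpow_enorm_toReal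
    (by simpa using hQ) ENNReal.ofReal_ne_top, ENNReal.toReal_ofReal hQ.le]
  refine ENNReal.toReal_le_of_le_ofReal hc ?_
  have := ENNReal.rpow_le_rpow h (one_div_pos.2 hQ).le
  rwa [← ENNReal.rpow_mul, mul_one_div_cancel hQ.ne', ENNReal.rpow_one] at this

/-- Writing $v=2\|v\|w$ places $w$ inside the open ball and costs the factor 2. -/
theorem W1p.norm_map_le_of_unitBall {L : Type*} [NormedAddCommGroup L] [NormedSpace ℝ L]
    (T : W1p p →ₗ[ℝ] L) {c : ℝ} (hT : ∀ v, ‖v‖ < 1 → ‖T v‖ ≤ c) (v : W1p p) :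
    ‖T v‖ ≤ 2 * c * ‖v‖ := by
  rcases eq_or_ne v 0 with rfl | h0
  · simp
  have hpos : 0 < ‖v‖ := norm_pos_iff.2 h0
  obtain ⟨w, hw, hvw⟩ := v.exists_eq_smul (show ‖v‖ < 2 * ‖v‖ by linarith)
  calc ‖T v‖ = 2 * ‖v‖ * ‖T w‖ := by
        conv_lhs => rw [hvw]
        rw [map_smul, norm_smul, Real.norm_of_nonneg (by positivity)]
    _ ≤ 2 * ‖v‖ * c := by gcongr; exact hT w hw
    _ = 2 * c * ‖v‖ := by ring

theorem continuous_primitiveF {g : Eu N → ℝ → ℝ} (hg : Continuous fun z : Eu N × ℝ => g z.1 z.2) :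
    Continuous fun z : Eu N × ℝ => primitiveF g z.1 z.2 := by
  unfold primitiveF
  refine intervalIntegral.continuous_parametric_intervalIntegral_of_continuous
    (f := fun (z : Eu N × ℝ) s => g z.1 s) (s := fun z => z.2) ?_ continuous_snd
  exact hg.comp ((continuous_fst.comp continuous_fst).prodMk continuous_snd)

theorem continuous_section {g : Eu N → ℝ → ℝ} (hg : Continuous fun z : Eu N × ℝ => g z.1 z.2)
    (x : Eu N) : Continuous (g x) :=
  hg.comp (continuous_const.prodMk continuous_id)

theorem aestronglyMeasurable_comp {g : Eu N → ℝ → ℝ}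
    (hg : Continuous fun z : Eu N × ℝ => g z.1 z.2) {u : Eu N → ℝ}
    (hu : AEStronglyMeasurable u volume) : AEStronglyMeasurable (fun x => g x (u x)) volume :=
  hg.comp_aestronglyMeasurable (aestronglyMeasurable_id.prodMk hu)

theorem hasDerivAt_primitiveF {g : Eu N → ℝ → ℝ}
    (hg : Continuous fun z : Eu N × ℝ => g z.1 z.2) (x : Eu N) (t : ℝ) :
    HasDerivAt (primitiveF g x) (g x t) t :=
  (continuous_section hg x).integral_hasStrictDerivAt 0 t |>.hasDerivAt

theorem enorm_le_mul_rpow {y a t C s : ℝ} (hC : 0 ≤ C) (hs : 0 ≤ s)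
    (h : |y| ≤ C * (|a| + |t|) ^ s) :
    ‖y‖ₑ ≤ (C.toNNReal : ℝ≥0∞) * (‖a‖ₑ + ‖t‖ₑ) ^ s := by
  rw [Real.enorm_eq_ofReal_abs, Real.enorm_eq_ofReal_abs, Real.enorm_eq_ofReal_abs,
    ← ENNReal.ofReal_add (abs_nonneg _) (abs_nonneg _),
    ENNReal.ofReal_rpow_of_nonneg (by positivity) hs]
  change _ ≤ ENNReal.ofReal C * _
  rw [← ENNReal.ofReal_mul hC]
  exact ENNReal.ofReal_le_ofReal h

theorem abs_sub_le_growth {g : Eu N → ℝ → ℝ} {C : ℝ} {R : Eu N → ℝ} (hC : 0 ≤ C)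
    (hR : ∀ x, 1 < R x) (hgb : ∀ x t, |g x t| ≤ C * |t| ^ (R x - 1)) (x : Eu N) {a t s : ℝ}
    (hs : |s| ≤ |a| + |t|) : |g x s - g x a| ≤ 2 * C * (|a| + |t|) ^ (R x - 1) := by
  have h0 : 0 ≤ R x - 1 := by linarith [hR x]
  have h1 : |g x s| ≤ C * (|a| + |t|) ^ (R x - 1) := (hgb x s).trans (by gcongr)
  have h2 : |g x a| ≤ C * (|a| + |t|) ^ (R x - 1) :=
    (hgb x a).trans (by gcongr; linarith [abs_nonneg t])
  have := abs_sub (g x s) (g x a)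
  linarith

/-- The remainder is $\int_a^{a+t}(g(x,s)-g(x,a))\,ds$, and every $s$ on the segment satisfies
$|s|\le|a|+|t|$. -/
theorem abs_primitiveF_remainder_le {g : Eu N → ℝ → ℝ}
    (hg : Continuous fun z : Eu N × ℝ => g z.1 z.2) {C : ℝ} {R : Eu N → ℝ} (hC : 0 ≤ C)
    (hR : ∀ x, 1 < R x) (hgb : ∀ x t, |g x t| ≤ C * |t| ^ (R x - 1)) (x : Eu N) (a t : ℝ) :
    |primitiveF g x (a + t) - primitiveF g x a - g x a * t|
      ≤ 2 * C * (|a| + |t|) ^ (R x - 1) * |t| := by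
  have hI : ∀ c d : ℝ, IntervalIntegrable (g x) volume c d := fun c d =>
    (continuous_section hg x).intervalIntegrable c d
  have e : primitiveF g x (a + t) - primitiveF g x a - g x a * t
      = ∫ s in a..(a + t), (g x s - g x a) := by
    unfold primitiveF
    rw [intervalIntegral.integral_sub (hI _ _) intervalIntegrable_const,
      intervalIntegral.integral_interval_sub_left (hI _ _) (hI _ _),
      intervalIntegral.integral_const, smul_eq_mul]
    ring
  rw [e]
  have := intervalIntegral.norm_integral_le_of_norm_le_const (a := a) (b := a + t)
    (f := fun s => g x s - g x a) (C := 2 * C * (|a| + |t|) ^ (R x - 1)) (fun s hs => by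
      refine abs_sub_le_growth hC hR hgb x ?_
      have h1 := uIoc_subset_uIcc hs
      have h2 := abs_sub_left_of_mem_uIcc h1
      have h3 : |s| ≤ |a| + |s - a| := by
        have := abs_add_le a (s - a)
        rwa [add_sub_cancel] at this
      rw [add_sub_cancel_left] at h2
      linarith)
  simpa using this

theorem abs_primitiveF_le {g : Eu N → ℝ → ℝ} {C : ℝ} {R : Eu N → ℝ} (hC : 0 ≤ C)
    (hR : ∀ x, 1 < R x) (hgb : ∀ x t, |g x t| ≤ C * |t| ^ (R x - 1)) (x : Eu N) (t : ℝ) :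
    |primitiveF g x t| ≤ C * |t| ^ R x := by
  have := intervalIntegral.norm_integral_le_of_norm_le_const (a := 0) (b := t)
    (f := fun s => g x s) (C := C * |t| ^ (R x - 1)) (fun s hs => by
      refine (hgb x s).trans ?_
      have h1 := abs_sub_left_of_mem_uIcc (uIoc_subset_uIcc hs)
      rw [sub_zero, sub_zero] at h1
      have h0 : 0 ≤ R x - 1 := by linarith [hR x]
      gcongr)
  unfold primitiveF
  refine (this.trans (le_of_eq ?_))
  rw [sub_zero, mul_assoc]
  rcases eq_or_ne t 0 with rfl | h0
  · rw [abs_zero, Real.zero_rpow (by linarith [hR x] : R x ≠ 0)]; simp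
  · rw [← Real.rpow_add_one (abs_pos.2 h0).ne', sub_add_cancel]

/-- The superposition operators `u ↦ F(x, u(x))` and `v ↦ f(x, u(x)) v(x)` from `W^{1,p(x)}` to
`L^Q`, the second being the continuous derivative of the first. -/
def HasNemytskii (p : CPlus N) (g : Eu N → ℝ → ℝ) (Q : ℝ) [Fact (1 ≤ ENNReal.ofReal Q)] : Prop :=
  ∃ (T : W1p p → Lp ℝ (ENNReal.ofReal Q) (volume : Measure (Eu N)))
    (D : W1p p → W1p p →L[ℝ] Lp ℝ (ENNReal.ofReal Q) (volume : Measure (Eu N))),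
    (∀ u, T u =ᵐ[volume] fun x => primitiveF g x (u x)) ∧
    (∀ u v, D u v =ᵐ[volume] fun x => g x (u x) * v x) ∧
    (∀ u, HasFDerivAt T (D u) u) ∧ Continuous D

set_option maxHeartbeats 1000000 in
-- The remainder of $T$ at $u$ is $\varphi(x,w)\,w$ and the increment of the derivative is
-- $v\mapsto\varphi(x,w)\,v$, up to sign of $\varphi$, with multipliers that vanish as $w\to 0$ and
-- grow like the power $R-1$. `eventually_lintegral_superposition_mul_le` makes both small in $L^Q$
-- uniformly over the unit ball.
theorem hasNemytskii_of_growth {Q R₀ R₁ : ℝ} [Fact (1 ≤ ENNReal.ofReal Q)] (hQ : 1 ≤ Q)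
    (hR₀ : 1 < R₀) {R : Eu N → ℝ} (hRm : Measurable R) (hR : ∀ x, R₀ ≤ R x)
    (hR' : ∀ x, R x ≤ R₁) (hmod : ModularBounded p fun x => R x * Q) {g : Eu N → ℝ → ℝ}
    (hg : Continuous fun z : Eu N × ℝ => g z.1 z.2) {C : ℝ} (hC : 0 ≤ C)
    (hgb : ∀ x t, |g x t| ≤ C * |t| ^ (R x - 1)) : HasNemytskii p g Q := by
  have hQ0 : 0 < Q := by linarith
  have hR1 : ∀ x, 1 < R x := fun x => by linarith [hR x]
  have hR1' : ∀ x, 0 ≤ R x - 1 := fun x => by linarith [hR x]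
  have he1 : ∀ x, 1 ≤ R x * Q := fun x => by nlinarith [hR x]
  have heM : ∀ x, R x * Q ≤ R₁ * Q := fun x => by nlinarith [hR' x]
  have hum : ∀ u : W1p p, AEStronglyMeasurable (u : Eu N → ℝ) volume := fun u => u.memLpVar.1
  have hGm : ∀ u : W1p p, AEStronglyMeasurable (fun x => primitiveF g x (u x)) volume := fun u =>
    aestronglyMeasurable_comp (continuous_primitiveF hg) (hum u)
  have hgm : ∀ u : W1p p, AEStronglyMeasurable (fun x => g x (u x)) volume := fun u =>
    aestronglyMeasurable_comp hg (hum u)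
  have hgvm : ∀ u v : W1p p, AEStronglyMeasurable (fun x => g x (u x) * v x) volume := fun u v =>
    (hgm u).mul (hum v)
  have hT : ∀ u : W1p p, MemLp (fun x => primitiveF g x (u x)) (ENNReal.ofReal Q) volume := by
    intro u
    rw [memLp_ofReal_iff hQ0 (hGm u)]
    have hCt : (ENNReal.ofReal C) ^ Q ≠ ⊤ := ENNReal.rpow_ne_top_of_nonneg hQ0.le (by simp)
    refine lt_of_le_of_lt (lintegral_mono fun x => ?_)
      (b := ∫⁻ x, (ENNReal.ofReal C) ^ Q * ‖u x‖ₑ ^ (R x * Q)) ?_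
    · simp only
      have h1 : ‖primitiveF g x (u x)‖ₑ ≤ ENNReal.ofReal C * ‖u x‖ₑ ^ R x := by
        rw [Real.enorm_eq_ofReal_abs, Real.enorm_eq_ofReal_abs,
          ENNReal.ofReal_rpow_of_nonneg (abs_nonneg _) (by linarith [hR1 x]),
          ← ENNReal.ofReal_mul hC]
        exact ENNReal.ofReal_le_ofReal (abs_primitiveF_le hC hR1 hgb x _)
      refine (ENNReal.rpow_le_rpow h1 hQ0.le).trans (le_of_eq ?_)
      rw [ENNReal.mul_rpow_of_nonneg _ _ hQ0.le, ← ENNReal.rpow_mul]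
    · rw [lintegral_const_mul' _ _ hCt]
      exact ENNReal.mul_lt_top hCt.lt_top (hmod.lt_top he1 heM u)
  -- Young's inequality separates $|u|^{R-1}$ from $|v|$, and both resulting terms are modulars at
  -- the exponent $RQ$.
  have hDbound : ∀ u : W1p p, ∃ B : ℝ≥0∞, B ≠ ⊤ ∧ ∀ v : W1p p, ‖v‖ < 1 →
      ∫⁻ x, ‖g x (u x) * v x‖ₑ ^ Q ≤ B := by
    intro u
    have hK := hmod
    obtain ⟨K, hK⟩ := hK
    have hbC : (max 1 (ENNReal.ofReal C)) ^ Q ≠ ⊤ :=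
      ENNReal.rpow_ne_top_of_nonneg hQ0.le (by simp)
    refine ⟨(max 1 (ENNReal.ofReal C)) ^ Q * ((∫⁻ x, ‖u x‖ₑ ^ (R x * Q)) + K),
      ENNReal.mul_ne_top hbC (ENNReal.add_ne_top.2 ⟨(hmod.lt_top he1 heM u).ne, ENNReal.coe_ne_top⟩),
      fun v hv => ?_⟩
    have hpt : ∀ x, ‖g x (u x) * v x‖ₑ ^ Q
        ≤ (max 1 (ENNReal.ofReal C)) ^ Q * (‖u x‖ₑ ^ (R x * Q) + ‖v x‖ₑ ^ (R x * Q)) := by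
      intro x
      have h1 : ‖g x (u x) * v x‖ₑ
          ≤ max 1 (ENNReal.ofReal C) * (‖u x‖ₑ ^ (R x - 1) * ‖v x‖ₑ) := by
        rw [enorm_mul, ← mul_assoc]
        gcongr
        refine le_trans ?_ (mul_le_mul_left (le_max_right 1 (ENNReal.ofReal C)) _)
        rw [Real.enorm_eq_ofReal_abs, Real.enorm_eq_ofReal_abs,
          ENNReal.ofReal_rpow_of_nonneg (abs_nonneg _) (hR1' x),
          ← ENNReal.ofReal_mul hC]
        exact ENNReal.ofReal_le_ofReal (hgb x _)
      refine (ENNReal.rpow_le_rpow h1 hQ0.le).trans ?_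
      rw [ENNReal.mul_rpow_of_nonneg _ _ hQ0.le]
      gcongr
      refine (enn_mul_rpow_le _ _ hQ0 (hR1 x)).trans (le_of_eq ?_)
      congr 1
      rw [← ENNReal.rpow_mul]
      congr 1
      have : R x - 1 ≠ 0 := by linarith [hR1 x]
      field_simp
    refine (lintegral_mono hpt).trans ?_
    rw [lintegral_const_mul' _ _ hbC, lintegral_add_right' _
      ((aemeasurable_enorm v).pow (hRm.mul_const Q).aemeasurable)]
    gcongr
    exact hK v hv
  have hDm : ∀ u v : W1p p, MemLp (fun x => g x (u x) * v x) (ENNReal.ofReal Q) volume := by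
    intro u v
    obtain ⟨w, hw, hvw⟩ := v.exists_eq_smul (lt_add_one ‖v‖)
    obtain ⟨B, hB, hBv⟩ := hDbound u
    have hw' : MemLp (fun x => g x (u x) * w x) (ENNReal.ofReal Q) volume :=
      (memLp_ofReal_iff hQ0 (hgvm u w)).2 ((hBv w hw).trans_lt hB.lt_top)
    refine (hw'.const_mul (‖v‖ + 1)).ae_eq ?_
    have hvw' : (v : Eu N → ℝ) =ᵐ[volume] fun x => (‖v‖ + 1) • w x := by
      conv_lhs => rw [hvw]
      exact W1p.coeFn_smul _ w
    filter_upwards [hvw'] with x hx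
    rw [hx, smul_eq_mul]; ring
  have hlin : ∀ u : W1p p, ∃ L : W1p p →ₗ[ℝ] Lp ℝ (ENNReal.ofReal Q) (volume : Measure (Eu N)),
      ∀ v, L v = (hDm u v).toLp := by
    intro u
    refine ⟨{ toFun := fun v => (hDm u v).toLp, map_add' := fun v w => ?_,
              map_smul' := fun c v => ?_ }, fun v => rfl⟩
    · refine Lp.ext ?_
      filter_upwards [(hDm u (v + w)).coeFn_toLp, (hDm u v).coeFn_toLp, (hDm u w).coeFn_toLp,
        Lp.coeFn_add (hDm u v).toLp (hDm u w).toLp, W1p.coeFn_add v w] with x h1 h2 h3 h4 h5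
      rw [h1, h4, Pi.add_apply, h2, h3, h5]; ring
    · refine Lp.ext ?_
      filter_upwards [(hDm u (c • v)).coeFn_toLp, (hDm u v).coeFn_toLp,
        Lp.coeFn_smul c (hDm u v).toLp, W1p.coeFn_smul c v] with x h1 h2 h3 h4
      rw [h1, RingHom.id_apply, h3, Pi.smul_apply, h2, h4, smul_eq_mul, smul_eq_mul]; ring
  choose L hL using hlin
  have hLb : ∀ u, ∃ M : ℝ, ∀ v, ‖L u v‖ ≤ M * ‖v‖ := by
    intro u
    obtain ⟨B, hB, hBv⟩ := hDbound u
    refine ⟨_, W1p.norm_map_le_of_unitBall (L u) (c := (B ^ (1 / Q)).toReal) fun v hv => ?_⟩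
    rw [hL]
    refine Lp.norm_le_of_lintegral_le hQ0 _ (hDm u v).coeFn_toLp ENNReal.toReal_nonneg ?_
    rw [ENNReal.ofReal_toReal (ENNReal.rpow_ne_top_of_nonneg (by positivity) hB),
      ← ENNReal.rpow_mul, one_div_mul_cancel hQ0.ne', ENNReal.rpow_one]
    exact hBv v hv
  choose M hM using hLb
  set D : W1p p → W1p p →L[ℝ] Lp ℝ (ENNReal.ofReal Q) (volume : Measure (Eu N)) :=
    fun u => (L u).mkContinuous (M u) (hM u) with hDdef
  have hD : ∀ u v, D u v =ᵐ[volume] fun x => g x (u x) * v x := by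
    intro u v
    have : D u v = (hDm u v).toLp := hL u v
    rw [this]
    exact (hDm u v).coeFn_toLp
  refine ⟨fun u => (hT u).toLp, D, fun u => (hT u).coeFn_toLp, hD, fun u => ?_, ?_⟩
  · rw [hasFDerivAt_iff_isLittleO_nhds_zero, Asymptotics.isLittleO_iff]
    intro c hc
    -- Division by zero gives $\varphi(x,0)=0$, which is also the limit of the quotient, so
    -- $\varphi(x,\cdot)$ is continuous at 0.
    set φ : Eu N → ℝ → ℝ≥0∞ := fun x t =>
      ‖(primitiveF g x (u x + t) - primitiveF g x (u x) - g x (u x) * t) / t‖ₑ with hφ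
    have hev := eventually_lintegral_superposition_mul_le hQ hR₀ hRm hR hR' hmod u
      (2 * C).toNNReal φ (fun x => ?_) (fun w => ?_) (fun x t => ?_)
      -- Half of $c$ compensates for the factor in $w=2\|w\|w'$.
      (ε := ENNReal.ofReal (c / 2) ^ Q)
      (ENNReal.rpow_pos (by simpa using hc) ENNReal.ofReal_ne_top)
    · filter_upwards [hev] with w hw
      rcases eq_or_ne w 0 with rfl | hw0
      · simp
      have hpos : 0 < ‖w‖ := norm_pos_iff.2 hw0
      obtain ⟨w', hw', hww⟩ := w.exists_eq_smul (show ‖w‖ < 2 * ‖w‖ by linarith)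
      have hww' : (w : Eu N → ℝ) =ᵐ[volume] fun x => (2 * ‖w‖) • w' x := by
        conv_lhs => rw [hww]
        exact W1p.coeFn_smul _ w'
      refine Lp.norm_le_of_lintegral_le hQ0 _
        (F := fun x => primitiveF g x (u x + w x) - primitiveF g x (u x) - g x (u x) * w x)
        ?_ (by positivity) ?_
      · filter_upwards [Lp.coeFn_sub ((hT (u + w)).toLp - (hT u).toLp) (D u w),
          Lp.coeFn_sub (hT (u + w)).toLp (hT u).toLp, (hT (u + w)).coeFn_toLp,
          (hT u).coeFn_toLp, hD u w, W1p.coeFn_add u w] with x h1 h2 h3 h4 h5 h6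
        rw [h1, Pi.sub_apply, h2, Pi.sub_apply, h3, h4, h5, h6]
      -- Only the linear factor $w$ is rescaled to $w'$; the argument of $\varphi$ stays $w$.
      · calc _ = ∫⁻ x, ENNReal.ofReal (2 * ‖w‖) ^ Q * (φ x (w x) * ‖w' x‖ₑ) ^ Q := by
              refine lintegral_congr_ae ?_
              filter_upwards [hww'] with x hx
              rw [← ENNReal.mul_rpow_of_nonneg _ _ hQ0.le]
              congr 1
              have e1 : ENNReal.ofReal (2 * ‖w‖) * (φ x (w x) * ‖w' x‖ₑ)
                  = φ x (w x) * ‖w x‖ₑ := by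
                rw [hx, enorm_smul, Real.enorm_eq_ofReal (show 0 ≤ 2 * ‖w‖ by positivity)]; ring
              rw [e1, hφ]
              simp only
              rw [← enorm_mul]
              rcases eq_or_ne (w x) 0 with h0 | h0
              · simp [h0]
              · rw [div_mul_cancel₀ _ h0]
          _ ≤ ENNReal.ofReal (2 * ‖w‖) ^ Q * ENNReal.ofReal (c / 2) ^ Q := by
              rw [lintegral_const_mul' _ _
                (ENNReal.rpow_ne_top_of_nonneg hQ0.le ENNReal.ofReal_ne_top)]
              gcongr
              exact hw w' hw'
          _ = ENNReal.ofReal (c * ‖w‖) ^ Q := by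
              rw [← ENNReal.mul_rpow_of_nonneg _ _ hQ0.le, ← ENNReal.ofReal_mul (by positivity)]
              congr 2; ring
    · have h1 := (hasDerivAt_primitiveF hg x (u x)).tendsto_slope_zero
      have h2 : Tendsto (fun t => (primitiveF g x (u x + t) - primitiveF g x (u x)
          - g x (u x) * t) / t) (nhdsWithin 0 {0}ᶜ) (nhds 0) := by
        have h3 := h1.sub_const (g x (u x))
        rw [sub_self] at h3
        refine h3.congr' ?_
        filter_upwards [self_mem_nhdsWithin] with t ht
        have ht : t ≠ 0 := ht
        rw [smul_eq_mul]; field_simp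
      have h4 : ContinuousAt (fun t => (primitiveF g x (u x + t) - primitiveF g x (u x)
          - g x (u x) * t) / t) 0 := by
        rw [continuousAt_iff_punctured_nhds]; simpa using h2
      have h5 := h4.enorm.tendsto
      simpa [hφ] using h5
    · refine AEMeasurable.enorm ?_
      refine AEMeasurable.div ?_ (hum w).aemeasurable
      exact (((aestronglyMeasurable_comp (continuous_primitiveF hg)
        ((hum u).add (hum w))).sub (hGm u)).sub (hgvm u w)).aemeasurable
    · refine enorm_le_mul_rpow (by positivity) (hR1' x) ?_
      rcases eq_or_ne t 0 with rfl | h0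
      · simp only [div_zero, abs_zero]
        positivity
      · rw [abs_div, div_le_iff₀ (abs_pos.2 h0)]
        exact abs_primitiveF_remainder_le hg hC hR1 hgb x _ _
  · rw [continuous_iff_continuousAt]
    intro u
    have hcont : Tendsto (fun w => D (u + w) - D u) (nhds 0) (nhds 0) := by
      rw [Metric.tendsto_nhds]
      intro ε hε
      set φ : Eu N → ℝ → ℝ≥0∞ := fun x t => ‖g x (u x + t) - g x (u x)‖ₑ with hφ
      have hev := eventually_lintegral_superposition_mul_le hQ hR₀ hRm hR hR' hmod u
        (2 * C).toNNReal φ (fun x => ?_) (fun w => ?_) (fun x t => ?_)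
        -- Passing from the unit ball to the operator norm doubles $\varepsilon/4$, and
        -- $\varepsilon/2$ leaves a strict inequality.
        (ε := ENNReal.ofReal (ε / 4) ^ Q)
        (ENNReal.rpow_pos (by simpa using hε) ENNReal.ofReal_ne_top)
      · filter_upwards [hev] with w hw
        rw [dist_zero_right]
        have hle : ‖D (u + w) - D u‖ ≤ 2 * (ε / 4) := by
          refine ContinuousLinearMap.opNorm_le_bound _ (by positivity) ?_
          refine W1p.norm_map_le_of_unitBall (D (u + w) - D u).toLinearMap fun v hv => ?_
          refine Lp.norm_le_of_lintegral_le hQ0 _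
            (F := fun x => (g x (u x + w x) - g x (u x)) * v x) ?_ (by positivity) ?_
          · filter_upwards [Lp.coeFn_sub (D (u + w) v) (D u v), hD (u + w) v, hD u v,
              W1p.coeFn_add u w] with x h1 h2 h3 h4
            simp only [ContinuousLinearMap.coe_coe, _root_.sub_apply]
            rw [h1, Pi.sub_apply, h2, h3, h4]; ring
          · refine le_trans (le_of_eq ?_) (hw v hv)
            refine lintegral_congr fun x => ?_
            rw [enorm_mul]
        linarith
      · have h1 : Continuous fun t => ‖g x (u x + t) - g x (u x)‖ₑ :=
          (((continuous_section hg x).comp (continuous_const.add continuous_id)).sub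
            continuous_const).enorm
        simpa [hφ] using h1.tendsto 0
      · exact ((aestronglyMeasurable_comp hg ((hum u).add (hum w))).sub (hgm u)).enorm
      · exact enorm_le_mul_rpow (by positivity) (hR1' x)
          (abs_sub_le_growth hC hR1 hgb x (abs_add_le _ _))
    have h2 : Tendsto (fun u' : W1p p => u' - u) (nhds u) (nhds 0) := by
      have : Continuous fun u' : W1p p => u' - u := by fun_prop
      simpa using this.tendsto u
    have h3 := tendsto_norm_zero.comp (hcont.comp h2)
    rw [ContinuousAt, tendsto_iff_norm_sub_tendsto_zero]
    refine h3.congr fun u' => ?_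
    simp only [Function.comp, add_sub_cancel]

theorem primitiveF_add {g₁ g₂ : Eu N → ℝ → ℝ} (h₁ : Continuous fun z : Eu N × ℝ => g₁ z.1 z.2)
    (h₂ : Continuous fun z : Eu N × ℝ => g₂ z.1 z.2) (x : Eu N) (t : ℝ) :
    primitiveF (fun x t => g₁ x t + g₂ x t) x t = primitiveF g₁ x t + primitiveF g₂ x t :=
  intervalIntegral.integral_add ((continuous_section h₁ x).intervalIntegrable _ _)
    ((continuous_section h₂ x).intervalIntegrable _ _)

theorem HasNemytskii.add {Q : ℝ} [Fact (1 ≤ ENNReal.ofReal Q)] {g₁ g₂ : Eu N → ℝ → ℝ}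
    (h₁ : Continuous fun z : Eu N × ℝ => g₁ z.1 z.2)
    (h₂ : Continuous fun z : Eu N × ℝ => g₂ z.1 z.2)
    (H₁ : HasNemytskii p g₁ Q) (H₂ : HasNemytskii p g₂ Q) :
    HasNemytskii p (fun x t => g₁ x t + g₂ x t) Q := by
  obtain ⟨T₁, D₁, a₁, b₁, c₁, d₁⟩ := H₁
  obtain ⟨T₂, D₂, a₂, b₂, c₂, d₂⟩ := H₂
  refine ⟨fun u => T₁ u + T₂ u, fun u => D₁ u + D₂ u, fun u => ?_, fun u v => ?_,
    fun u => (c₁ u).add (c₂ u), d₁.add d₂⟩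
  · filter_upwards [Lp.coeFn_add (T₁ u) (T₂ u), a₁ u, a₂ u] with x h1 h2 h3
    rw [h1, Pi.add_apply, h2, h3, primitiveF_add h₁ h₂]
  · filter_upwards [Lp.coeFn_add (D₁ u v) (D₂ u v), b₁ u v, b₂ u v] with x h1 h2 h3
    rw [_root_.add_apply, h1, Pi.add_apply, h2, h3]; ring

/-- Continuity of the part of `f` that grows like `|t|^{r(x)-1}`. -/
theorem continuous_growth_part {f : Eu N → ℝ → ℝ} (hf : Continuous fun z : Eu N × ℝ => f z.1 z.2)
    (r s : CPlus N) {C : ℝ}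
    (hfb : ∀ x t, |f x t| ≤ C * (|t| ^ (r x - 1) + |t| ^ (s x - 1))) :
    (∀ x t, |f x t * (|t| ^ (r x - 1) / (|t| ^ (r x - 1) + |t| ^ (s x - 1)))|
      ≤ C * |t| ^ (r x - 1)) ∧
    Continuous fun z : Eu N × ℝ =>
      f z.1 z.2 * (|z.2| ^ (r z.1 - 1) / (|z.2| ^ (r z.1 - 1) + |z.2| ^ (s z.1 - 1))) := by
  have hb : ∀ x t, |f x t * (|t| ^ (r x - 1) / (|t| ^ (r x - 1) + |t| ^ (s x - 1)))|
      ≤ C * |t| ^ (r x - 1) := by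
    intro x t
    have h1 : 0 ≤ |t| ^ (r x - 1) := by positivity
    have h2 : 0 ≤ |t| ^ (s x - 1) := by positivity
    rcases (add_nonneg h1 h2).eq_or_lt with h0 | h0
    · have : |t| ^ (r x - 1) = 0 := by linarith
      simp [this]
    · rw [abs_mul, abs_of_nonneg (div_nonneg h1 h0.le), mul_div_assoc', div_le_iff₀ h0]
      calc _ ≤ C * (|t| ^ (r x - 1) + |t| ^ (s x - 1)) * |t| ^ (r x - 1) := by
            gcongr; exact hfb x t
        _ = _ := by ring
  refine ⟨hb, ?_⟩
  have hr : Continuous fun z : Eu N × ℝ => |z.2| ^ (r z.1 - 1) :=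
    continuous_snd.abs.rpow ((r.continuous_toFun.comp continuous_fst).sub continuous_const)
      fun z => Or.inr (by linarith [r.one_lt z.1])
  have hs : Continuous fun z : Eu N × ℝ => |z.2| ^ (s z.1 - 1) :=
    continuous_snd.abs.rpow ((s.continuous_toFun.comp continuous_fst).sub continuous_const)
      fun z => Or.inr (by linarith [s.one_lt z.1])
  rw [continuous_iff_continuousAt]
  rintro ⟨x, t⟩
  rcases eq_or_ne t 0 with rfl | h0
  -- At $t=0$ the weight is $0/0=0$ and need not be continuous by itself; the bound $C|t|^{r(x)-1}$
  -- forces the product to tend to zero.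
  · have h1 : Tendsto (fun z : Eu N × ℝ => C * |z.2| ^ (r z.1 - 1)) (nhds (x, 0)) (nhds 0) := by
      have := (hr.const_mul C).tendsto (x, 0)
      simpa [Real.zero_rpow (show r x - 1 ≠ 0 by linarith [r.one_lt x])] using this
    have h2 := squeeze_zero_norm (f := fun z : Eu N × ℝ =>
      f z.1 z.2 * (|z.2| ^ (r z.1 - 1) / (|z.2| ^ (r z.1 - 1) + |z.2| ^ (s z.1 - 1))))
      (fun z => hb z.1 z.2) h1
    simpa [ContinuousAt, Real.zero_rpow (show r x - 1 ≠ 0 by linarith [r.one_lt x])] using h2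
  · refine hf.continuousAt.mul (hr.continuousAt.div (hr.add hs).continuousAt ?_)
    have : 0 < |t| := abs_pos.2 h0
    positivity

/-- Young's inequality uses one conjugate exponent at each point, so $f$ is split by the weights of
$|t|^{r-1}$ and $|t|^{s-1}$ into two parts of pure power growth. -/
theorem hasNemytskii {f : Eu N → ℝ → ℝ} (hf : Continuous fun z : Eu N × ℝ => f z.1 z.2)
    (r s : CPlus N) {C : ℝ} (hC : 0 ≤ C)
    (hfb : ∀ x t, |f x t| ≤ C * (|t| ^ (r x - 1) + |t| ^ (s x - 1))) {Q : ℝ}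
    [Fact (1 ≤ ENNReal.ofReal Q)] (hQ : 1 ≤ Q) (hr : ModularBounded p fun x => r x * Q)
    (hs : ModularBounded p fun x => s x * Q) : HasNemytskii p f Q := by
  obtain ⟨b₁, c₁⟩ := continuous_growth_part hf r s hfb
  obtain ⟨b₂, c₂⟩ := continuous_growth_part hf s r (C := C) (fun x t => by
    rw [add_comm]; exact hfb x t)
  have h₁ := hasNemytskii_of_growth hQ r.one_lt_iInf r.continuous_toFun.measurable r.lo_le r.le_hi
    hr c₁ hC b₁
  have h₂ := hasNemytskii_of_growth hQ s.one_lt_iInf s.continuous_toFun.measurable s.lo_le s.le_hi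
    hs c₂ hC b₂
  convert HasNemytskii.add c₁ c₂ h₁ h₂ using 1
  funext x t
  rw [add_comm (|t| ^ (s x - 1)), ← mul_add, ← add_div]
  have h1 : 0 ≤ |t| ^ (r x - 1) := by positivity
  have h2 : 0 ≤ |t| ^ (s x - 1) := by positivity
  -- Where both powers vanish the weights do not sum to 1, but there the growth condition forces
  -- $f=0$.
  rcases (add_nonneg h1 h2).eq_or_lt with h0 | h0
  · have := hfb x t
    rw [← h0, mul_zero] at this
    simp [abs_nonpos_iff.1 this]
  · rw [div_self h0.ne', mul_one]

end Nemytskii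

/-! ### Symmetric bilinear forms defined by the kernel -/

section KernelForm

variable {N : ℕ} {p : CPlus N}

theorem ae_eq_prod_mul {a a' b b' : Eu N → ℝ} (ha : a =ᵐ[volume] a') (hb : b =ᵐ[volume] b')
    (k : Eu N → Eu N → ℝ) :
    (fun z : Eu N × Eu N => a z.1 * b z.2 * k z.1 z.2)
      =ᵐ[volume] fun z => a' z.1 * b' z.2 * k z.1 z.2 := by
  have h1 : ∀ᵐ z : Eu N × Eu N, a z.1 = a' z.1 := Measure.quasiMeasurePreserving_fst.ae ha
  have h2 : ∀ᵐ z : Eu N × Eu N, b z.2 = b' z.2 := Measure.quasiMeasurePreserving_snd.ae hb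
  filter_upwards [h1, h2] with z h1 h2
  rw [h1, h2]

/-- A kernel dominated by `|x - y|^{-l}` defines a bounded symmetric bilinear form on `L^Q`. -/
theorem exists_kernel_form (hN : 0 < N) {l Q : ℝ} (hl : 0 < l) (hl' : l < N)
    (hQ : 2 / Q + l / N = 2) (hQ1 : 1 ≤ Q) [Fact (1 ≤ ENNReal.ofReal Q)] {k : Eu N → Eu N → ℝ}
    (hkm : Measurable fun z : Eu N × Eu N => k z.1 z.2)
    (hk : ∀ x y, |k x y| ≤ ‖x - y‖ ^ (-l)) (hsymm : ∀ x y, k x y = k y x) :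
    ∃ B : Lp ℝ (ENNReal.ofReal Q) (volume : Measure (Eu N)) →L[ℝ]
        Lp ℝ (ENNReal.ofReal Q) (volume : Measure (Eu N)) →L[ℝ] ℝ,
      (∀ a b, Integrable (fun z : Eu N × Eu N => a z.1 * b z.2 * k z.1 z.2) volume ∧
        B a b = ∫ z : Eu N × Eu N, a z.1 * b z.2 * k z.1 z.2) ∧ ∀ a b, B a b = B b a := by
  have hQ0 : 0 < Q := by linarith
  obtain ⟨C, hC⟩ := hls hN hl hl' hQ
  -- One estimate supplies both absolute convergence of the double integral and boundedness of the
  -- form.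
  have hbound : ∀ a b : Lp ℝ (ENNReal.ofReal Q) (volume : Measure (Eu N)),
      ∫⁻ z : Eu N × Eu N, ‖a z.1 * b z.2 * k z.1 z.2‖ₑ
        ≤ ENNReal.ofReal (C * ‖a‖ * ‖b‖) := by
    intro a b
    have hn : ∀ c : Lp ℝ (ENNReal.ofReal Q) (volume : Measure (Eu N)),
        (∫⁻ y, ‖c y‖ₑ ^ Q) ^ (1 / Q) = ENNReal.ofReal ‖c‖ := by
      intro c
      rw [Lp.norm_def, ENNReal.ofReal_toReal (Lp.eLpNorm_ne_top c),
        eLpNorm_eq_lintegral_rpow_enorm_toReal (by simpa using hQ0) ENNReal.ofReal_ne_top,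
        ENNReal.toReal_ofReal hQ0.le]
    have hfin : ∀ c : Lp ℝ (ENNReal.ofReal Q) (volume : Measure (Eu N)),
        ∫⁻ y, ‖c y‖ₑ ^ Q ≠ ⊤ := fun c =>
      ((memLp_ofReal_iff hQ0 (Lp.aestronglyMeasurable c)).1 (Lp.memLp c)).ne
    calc ∫⁻ z : Eu N × Eu N, ‖a z.1 * b z.2 * k z.1 z.2‖ₑ
        ≤ ∫⁻ z : Eu N × Eu N, ‖a z.1‖ₑ * ‖b z.2‖ₑ * ENNReal.ofReal (‖z.1 - z.2‖ ^ (-l)) := by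
          refine lintegral_mono fun z => ?_
          simp only [enorm_mul]
          gcongr
          rw [Real.enorm_eq_ofReal_abs]
          exact ENNReal.ofReal_le_ofReal (hk _ _)
      _ ≤ C * ENNReal.ofReal ‖a‖ * ENNReal.ofReal ‖b‖ := by
          rw [← hn a, ← hn b]
          exact hC _ _ (Lp.aestronglyMeasurable a).enorm (Lp.aestronglyMeasurable b).enorm
            (hfin a) (hfin b)
      _ = _ := by
          rw [ENNReal.ofReal_mul (by positivity), ENNReal.ofReal_mul (by positivity),
            ENNReal.ofReal_coe_nnreal]
  have hm : ∀ a b : Lp ℝ (ENNReal.ofReal Q) (volume : Measure (Eu N)),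
      AEStronglyMeasurable (fun z : Eu N × Eu N => a z.1 * b z.2 * k z.1 z.2) volume := fun a b =>
    ((Lp.aestronglyMeasurable a).comp_fst.mul (Lp.aestronglyMeasurable b).comp_snd).mul
      hkm.aestronglyMeasurable
  have hint : ∀ a b : Lp ℝ (ENNReal.ofReal Q) (volume : Measure (Eu N)),
      Integrable (fun z : Eu N × Eu N => a z.1 * b z.2 * k z.1 z.2) volume := fun a b =>
    ⟨hm a b, (hbound a b).trans_lt ENNReal.ofReal_lt_top⟩
  set I : Lp ℝ (ENNReal.ofReal Q) (volume : Measure (Eu N)) →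
      Lp ℝ (ENNReal.ofReal Q) (volume : Measure (Eu N)) → ℝ :=
    fun a b => ∫ z : Eu N × Eu N, a z.1 * b z.2 * k z.1 z.2 with hI
  have hIs : ∀ a b, I a b = I b a := by
    intro a b
    simp only [hI]
    rw [Measure.volume_eq_prod, ← integral_prod_swap]
    refine integral_congr_ae (ae_of_all _ fun z => ?_)
    simp only [Prod.fst_swap, Prod.snd_swap]
    rw [hsymm z.2 z.1]; ring
  have hadd : ∀ a a' b, I (a + a') b = I a b + I a' b := by
    intro a a' b
    simp only [hI]
    rw [← integral_add (hint a b) (hint a' b),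
      integral_congr_ae (ae_eq_prod_mul (Lp.coeFn_add a a') (EventuallyEq.refl _ b) k)]
    refine integral_congr_ae (ae_of_all _ fun z => ?_)
    simp only [Pi.add_apply]; ring
  have hsmul : ∀ (c : ℝ) a b, I (c • a) b = c * I a b := by
    intro c a b
    simp only [hI]
    rw [← integral_const_mul,
      integral_congr_ae (ae_eq_prod_mul (Lp.coeFn_smul c a) (EventuallyEq.refl _ b) k)]
    refine integral_congr_ae (ae_of_all _ fun z => ?_)
    simp only [Pi.smul_apply, smul_eq_mul]; ring
  refine ⟨LinearMap.mkContinuous₂ (LinearMap.mk₂ ℝ I hadd hsmul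
    (fun a b b' => by rw [hIs, hadd, hIs b, hIs b'])
    (fun c a b => by rw [hIs, hsmul, hIs b, smul_eq_mul])) C ?_, fun a b => ⟨hint a b, rfl⟩, hIs⟩
  intro a b
  refine (norm_integral_le_lintegral_norm _).trans ?_
  refine ENNReal.toReal_le_of_le_ofReal (by positivity) ?_
  simp_rw [ofReal_norm]
  exact hbound a b

/-- The double integral is $B(Tu,Tu)$ with $T$ of class $C^1$. Its derivative is
$B(Tu,D_uv)+B(D_uv,Tu)$, and symmetry merges the two terms. -/
theorem HasNemytskii.contDiff_form {f : Eu N → ℝ → ℝ} {Q : ℝ} [Fact (1 ≤ ENNReal.ofReal Q)]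
    (h : HasNemytskii p f Q) {k : Eu N → Eu N → ℝ}
    (B : Lp ℝ (ENNReal.ofReal Q) (volume : Measure (Eu N)) →L[ℝ]
        Lp ℝ (ENNReal.ofReal Q) (volume : Measure (Eu N)) →L[ℝ] ℝ)
    (hB : ∀ a b, Integrable (fun z : Eu N × Eu N => a z.1 * b z.2 * k z.1 z.2) volume ∧
        B a b = ∫ z : Eu N × Eu N, a z.1 * b z.2 * k z.1 z.2) (hs : ∀ a b, B a b = B b a) :
    (∀ u : W1p p, Integrable (fun z : Eu N × Eu N =>
        primitiveF f z.1 (u z.1) * primitiveF f z.2 (u z.2) * k z.1 z.2) volume) ∧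
    (∀ u v : W1p p, Integrable (fun z : Eu N × Eu N =>
        primitiveF f z.1 (u z.1) * (f z.2 (u z.2) * v z.2) * k z.1 z.2) volume) ∧
    ContDiff ℝ 1 (fun u : W1p p => ∫ z : Eu N × Eu N,
        primitiveF f z.1 (u z.1) * primitiveF f z.2 (u z.2) * k z.1 z.2) ∧
    ∀ u : W1p p, ∃ D : W1p p →L[ℝ] ℝ, HasFDerivAt (fun u : W1p p => ∫ z : Eu N × Eu N,
        primitiveF f z.1 (u z.1) * primitiveF f z.2 (u z.2) * k z.1 z.2) D u ∧
      ∀ v : W1p p, D v = 2 * ∫ z : Eu N × Eu N,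
        primitiveF f z.1 (u z.1) * (f z.2 (u z.2) * v z.2) * k z.1 z.2 := by
  obtain ⟨T, D, hT, hD, hTD, hDc⟩ := h
  have e1 : ∀ u : W1p p, B (T u) (T u) = ∫ z : Eu N × Eu N,
        primitiveF f z.1 (u z.1) * primitiveF f z.2 (u z.2) * k z.1 z.2 := fun u => by
    rw [(hB _ _).2]; exact integral_congr_ae (ae_eq_prod_mul (hT u) (hT u) k)
  have e2 : ∀ u v : W1p p, B (T u) (D u v) = ∫ z : Eu N × Eu N,
        primitiveF f z.1 (u z.1) * (f z.2 (u z.2) * v z.2) * k z.1 z.2 := fun u v => by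
    rw [(hB _ _).2]; exact integral_congr_ae (ae_eq_prod_mul (hT u) (hD u v) k)
  have hTc : ContDiff ℝ 1 T := by
    rw [contDiff_one_iff_fderiv]
    refine ⟨fun u => (hTD u).differentiableAt, ?_⟩
    have : fderiv ℝ T = D := funext fun u => (hTD u).fderiv
    rwa [this]
  refine ⟨fun u => (hB _ _).1.congr (ae_eq_prod_mul (hT u) (hT u) k),
    fun u v => (hB _ _).1.congr (ae_eq_prod_mul (hT u) (hD u v) k), ?_, fun u => ?_⟩
  · simp_rw [← e1]
    exact (B.contDiff.comp hTc).clm_apply hTc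
  · rw [show (fun u : W1p p => ∫ z : Eu N × Eu N, primitiveF f z.1 (u z.1) *
      primitiveF f z.2 (u z.2) * k z.1 z.2) = fun u => B (T u) (T u) from funext fun u => (e1 u).symm]
    refine ⟨_, B.hasFDerivAt_of_bilinear (hTD u) (hTD u), fun v => ?_⟩
    have h1 : (B.precompR (W1p p) (T u) (D u) + B.precompL (W1p p) (D u) (T u)) v
        = B (T u) (D u v) + B (D u v) (T u) := rfl
    rw [← e2, h1, hs (D u v), two_mul]

end KernelForm

/-- The conclusion of the theorem, from the Sobolev embedding at the critical exponent. -/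
theorem psi_contDiff_of_modularBounded (N : ℕ) (hN : 0 < N) (p : CPlus N)
    (q : CPlus N) (lam : Eu N → Eu N → ℝ)
    (hlam : ∀ x y, 1 / q x + lam x y / N + 1 / q y = 2)
    (Λ : ℝ) (hΛN : Λ < N) (hlamN : ∀ x y, lam x y ≤ Λ)
    (f : Eu N → ℝ → ℝ) (hf : Continuous fun z : Eu N × ℝ => f z.1 z.2)
    (r s : CPlus N)
    (hr : ModularBounded p fun x => r x * q.lo) (hr' : ModularBounded p fun x => r x * q.hi)
    (hs : ModularBounded p fun x => s x * q.lo) (hs' : ModularBounded p fun x => s x * q.hi)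
    (C₁ : ℝ) (hC₁ : 0 < C₁)
    (hf₁ : ∀ x t, |f x t| ≤ C₁ * (|t| ^ (r x - 1) + |t| ^ (s x - 1))) :
    (∀ u : W1p p, Integrable (fun z : Eu N × Eu N => psiIntegrand f lam u z.1 z.2) volume) ∧
    ContDiff ℝ 1 (Psi p f lam) ∧
    ∀ u v : W1p p,
      Integrable (fun z : Eu N × Eu N => dpsiIntegrand f lam u v z.1 z.2) volume ∧
      fderiv ℝ (Psi p f lam) u v = ∫ y, ∫ x, dpsiIntegrand f lam u v x y := by
  have hN' : (0 : ℝ) < N := by exact_mod_cast hN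
  have hlo : 1 < q.lo := q.one_lt_iInf
  have hlohi : q.lo ≤ q.hi := (q.lo_le 0).trans (q.le_hi 0)
  have hhi : 1 < q.hi := hlo.trans_le hlohi
  have hlam' : ∀ x y, lam x y = N * (2 - 1 / q x - 1 / q y) := fun x y => by
    have h1 := hlam x y
    have h2 : lam x y / N = 2 - 1 / q x - 1 / q y := by linarith
    rw [← h2]; field_simp
  have hlamc : Continuous fun z : Eu N × Eu N => lam z.1 z.2 := by
    simp_rw [hlam']
    have h1 : Continuous fun x => 1 / q x :=
      continuous_const.div q.continuous_toFun fun x => (q.pos x).ne'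
    exact continuous_const.mul ((continuous_const.sub (h1.comp continuous_fst)).sub
      (h1.comp continuous_snd))
  -- The values of $\lambda$ obtained when both occurrences of $q$ are replaced by $q^-$,
  -- respectively $q^+$; they are the exponents that HLS pairs diagonally with $L^{q^-}$ and
  -- $L^{q^+}$.
  set l₁ : ℝ := N * (2 - 2 / q.lo) with hl₁
  set l₂ : ℝ := N * (2 - 2 / q.hi) with hl₂
  have hinv : ∀ x, 1 / q.hi ≤ 1 / q x ∧ 1 / q x ≤ 1 / q.lo := fun x =>
    ⟨one_div_le_one_div_of_le (q.pos x) (q.le_hi x),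
      one_div_le_one_div_of_le (by linarith) (q.lo_le x)⟩
  have h2div : ∀ t : ℝ, 2 / t = 2 * (1 / t) := fun t => by ring
  have hlow : ∀ x y, l₁ ≤ lam x y := fun x y => by
    rw [hlam', hl₁, h2div]
    have := (hinv x).2; have := (hinv y).2
    gcongr ?_ * ?_
    linarith
  have hupp : ∀ x y, lam x y ≤ l₂ := fun x y => by
    rw [hlam', hl₂, h2div]
    have := (hinv x).1; have := (hinv y).1
    gcongr ?_ * ?_
    linarith
  have hpos : ∀ t : ℝ, 1 < t → 0 < (N : ℝ) * (2 - 2 / t) := fun t ht => by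
    refine mul_pos hN' ?_
    have : 2 / t < 2 := by rw [div_lt_iff₀ (by linarith)]; linarith
    linarith
  have hl₁0 : 0 < l₁ := hpos _ hlo
  have hl₂0 : 0 < l₂ := hpos _ hhi
  have hlam0 : ∀ x y, 0 < lam x y := fun x y => hl₁0.trans_le (hlow x y)
  -- For $y=x$ the bound $\lambda\le\Lambda$ reads $q(x)\le 2N/(2N-\Lambda)$. Passing to the
  -- supremum gives $l_2\le\Lambda$, whether or not $q^+$ is attained.
  have hl₂N : l₂ < N := by
    have h0 : 0 < 2 * N - Λ := by linarith
    have h1 : ∀ x, q x ≤ 2 * N / (2 * N - Λ) := fun x => by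
      have h2 := hlamN x x
      rw [hlam'] at h2
      have h3 := q.pos x
      rw [le_div_iff₀ h0]
      have h4 : (N : ℝ) * (2 - 1 / q x - 1 / q x) * q x = 2 * N * q x - 2 * N := by
        field_simp; ring
      nlinarith
    have h2 : q.hi ≤ 2 * N / (2 * N - Λ) := ciSup_le h1
    rw [le_div_iff₀ h0] at h2
    have h3 : l₂ * q.hi = 2 * N * q.hi - 2 * N := by
      rw [hl₂]; field_simp
    have h4 : l₂ * q.hi ≤ Λ * q.hi := by linarith
    exact (le_of_mul_le_mul_right h4 (by linarith)).trans_lt hΛN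
  have hl₁N : l₁ < N := ((hlow 0 0).trans (hupp 0 0)).trans_lt hl₂N
  have hQ₁ : 2 / q.lo + l₁ / N = 2 := by rw [hl₁]; field_simp; ring
  have hQ₂ : 2 / q.hi + l₂ / N = 2 := by rw [hl₂]; field_simp; ring
  have fact₁ : Fact (1 ≤ ENNReal.ofReal q.lo) := ⟨by simpa using hlo.le⟩
  have fact₂ : Fact (1 ≤ ENNReal.ofReal q.hi) := ⟨by simpa using hhi.le⟩
  -- For $|x-y|\ge 1$ the smallest exponent gives the largest kernel, for $|x-y|<1$ the largest
  -- exponent does.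
  set S : Set (Eu N × Eu N) := {z | 1 ≤ ‖z.1 - z.2‖} with hS
  have hSm : MeasurableSet S := by
    refine measurableSet_le measurable_const ?_
    fun_prop
  set k : Eu N × Eu N → ℝ := fun z => 1 / ‖z.1 - z.2‖ ^ lam z.1 z.2 with hk
  have hkm : Measurable k := by
    refine measurable_const.div ?_
    exact (by fun_prop : Measurable fun z : Eu N × Eu N => ‖z.1 - z.2‖).pow hlamc.measurable
  have hk0 : ∀ z, 0 ≤ k z := fun z => by positivity
  have hksymm : ∀ x y, k (x, y) = k (y, x) := fun x y => by
    simp only [hk]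
    rw [norm_sub_rev, hlam' x y, hlam' y x]
    congr 3; ring
  have hSsymm : ∀ x y, ((x, y) : Eu N × Eu N) ∈ S ↔ (y, x) ∈ S := fun x y => by
    simp only [hS, mem_ofPred_eq, norm_sub_rev]
  have hk₁ : ∀ x y, |S.indicator k (x, y)| ≤ ‖x - y‖ ^ (-l₁) := fun x y => by
    by_cases h : (x, y) ∈ S
    · rw [indicator_of_mem h, abs_of_nonneg (hk0 _)]
      have h1 : 1 ≤ ‖x - y‖ := h
      simp only [hk]
      rw [one_div, ← Real.rpow_neg (norm_nonneg _)]
      exact Real.rpow_le_rpow_of_exponent_le h1 (by linarith [hlow x y])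
    · rw [indicator_of_notMem h, abs_zero]; positivity
  have hk₂ : ∀ x y, |Sᶜ.indicator k (x, y)| ≤ ‖x - y‖ ^ (-l₂) := fun x y => by
    by_cases h : (x, y) ∈ S
    · rw [indicator_of_notMem (by simpa using h), abs_zero]; positivity
    · rw [indicator_of_mem (by simpa using h), abs_of_nonneg (hk0 _)]
      have h1 : ‖x - y‖ < 1 := not_le.1 h
      simp only [hk]
      -- On the diagonal $0^{\lambda}=0$ since $\lambda>0$, and the kernel takes the value $1/0=0$.
      rcases (norm_nonneg (x - y)).eq_or_lt with h0 | h0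
      · rw [← h0, Real.zero_rpow (hlam0 x y).ne', div_zero]; positivity
      · rw [one_div, ← Real.rpow_neg (norm_nonneg _)]
        exact Real.rpow_le_rpow_of_exponent_ge h0 h1.le (by linarith [hupp x y])
  obtain ⟨B₁, hB₁, hs₁⟩ := exists_kernel_form hN hl₁0 hl₁N hQ₁ hlo.le
    (k := fun x y => S.indicator k (x, y)) (hkm.indicator hSm) hk₁ (fun x y => by
      by_cases h : (x, y) ∈ S
      · rw [indicator_of_mem h, indicator_of_mem ((hSsymm x y).1 h), hksymm]
      · rw [indicator_of_notMem h, indicator_of_notMem fun h' => h ((hSsymm x y).2 h')])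
  obtain ⟨B₂, hB₂, hs₂⟩ := exists_kernel_form hN hl₂0 hl₂N hQ₂ hhi.le
    (k := fun x y => Sᶜ.indicator k (x, y)) (hkm.indicator hSm.compl) hk₂ (fun x y => by
      by_cases h : (x, y) ∈ S
      · rw [indicator_of_notMem (by simpa using h),
          indicator_of_notMem (by simpa using (hSsymm x y).1 h)]
      · rw [indicator_of_mem (by simpa using h),
          indicator_of_mem (by simpa using fun h' => h ((hSsymm x y).2 h')), hksymm])
  obtain ⟨a₁, b₁, c₁, d₁⟩ := 
    (hasNemytskii hf r s hC₁.le hf₁ hlo.le hr hs).contDiff_form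
      (k := fun x y => S.indicator k (x, y)) B₁ hB₁ hs₁
  obtain ⟨a₂, b₂, c₂, d₂⟩ :=
    (hasNemytskii hf r s hC₁.le hf₁ hhi.le hr' hs').contDiff_form
      (k := fun x y => Sᶜ.indicator k (x, y)) B₂ hB₂ hs₂
  have hsplit : ∀ z : Eu N × Eu N, S.indicator k (z.1, z.2) + Sᶜ.indicator k (z.1, z.2) = k z :=
    fun z => congrFun (indicator_self_add_compl S k) z
  have epsi : ∀ u : W1p p, (fun z : Eu N × Eu N => psiIntegrand f lam u z.1 z.2)
      = fun z => primitiveF f z.1 (u z.1) * primitiveF f z.2 (u z.2) * S.indicator k (z.1, z.2)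
        + primitiveF f z.1 (u z.1) * primitiveF f z.2 (u z.2) * Sᶜ.indicator k (z.1, z.2) := by
    intro u; funext z
    rw [← mul_add, hsplit, psiIntegrand, hk]; ring
  have edpsi : ∀ u v : W1p p, (fun z : Eu N × Eu N => dpsiIntegrand f lam u v z.1 z.2)
      = fun z => primitiveF f z.1 (u z.1) * (f z.2 (u z.2) * v z.2) * S.indicator k (z.1, z.2)
        + primitiveF f z.1 (u z.1) * (f z.2 (u z.2) * v z.2) * Sᶜ.indicator k (z.1, z.2) := by
    intro u v; funext z
    rw [← mul_add, hsplit, dpsiIntegrand, hk]; ring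
  have hpsi : ∀ u : W1p p,
      Integrable (fun z : Eu N × Eu N => psiIntegrand f lam u z.1 z.2) volume := fun u => by
    rw [epsi]; exact (a₁ u).add (a₂ u)
  have hdpsi : ∀ u v : W1p p,
      Integrable (fun z : Eu N × Eu N => dpsiIntegrand f lam u v z.1 z.2) volume := fun u v => by
    rw [edpsi]; exact (b₁ u v).add (b₂ u v)
  have hPsi : Psi p f lam = fun u : W1p p => 1 / 2 * ((∫ z : Eu N × Eu N,
        primitiveF f z.1 (u z.1) * primitiveF f z.2 (u z.2) * S.indicator k (z.1, z.2))
      + ∫ z : Eu N × Eu N,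
        primitiveF f z.1 (u z.1) * primitiveF f z.2 (u z.2) * Sᶜ.indicator k (z.1, z.2)) := by
    funext u
    rw [Psi, ← integral_add (a₁ u) (a₂ u), ← epsi]
    congr 1
    exact (integral_prod_symm _ (hpsi u)).symm
  refine ⟨hpsi, ?_, fun u v => ⟨hdpsi u v, ?_⟩⟩
  · rw [hPsi]
    exact contDiff_const.mul (c₁.add c₂)
  · obtain ⟨D₁, e₁, g₁⟩ := d₁ u
    obtain ⟨D₂, e₂, g₂⟩ := d₂ u
    have hfd : HasFDerivAt (Psi p f lam) ((1 / 2 : ℝ) • (D₁ + D₂)) u := by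
      rw [hPsi]; exact (e₁.add e₂).const_mul (1 / 2 : ℝ)
    rw [hfd.fderiv]
    have h1 : ∫ y, ∫ x, dpsiIntegrand f lam u v x y
        = ∫ z : Eu N × Eu N, dpsiIntegrand f lam u v z.1 z.2 :=
      (integral_prod_symm _ (hdpsi u v)).symm
    rw [h1, edpsi, integral_add (b₁ u v) (b₂ u v), _root_.smul_apply, _root_.add_apply, g₁, g₂,
      smul_eq_mul]
    ring

/-! ### Mollification and passage to the limit -/

section Mollify

variable {N : ℕ} {F : Type*} [NormedAddCommGroup F] [NormedSpace ℝ F]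

/-- A sequence of bump functions shrinking to the origin. -/
def shrinkingBump (N n : ℕ) : ContDiffBump (0 : Eu N) where
  rIn := 1 / (n + 1) / 2
  rOut := 1 / (n + 1)
  rIn_pos := by positivity
  rIn_lt_rOut := half_lt_self (by positivity)

/-- The `n`-th mollifier. -/
def mollifier (N n : ℕ) : Eu N → ℝ := (shrinkingBump N n).normed volume

/-- The mollification of `g`. -/
def mollify (n : ℕ) (g : Eu N → F) : Eu N → F :=
  convolution (mollifier N n) g (ContinuousLinearMap.lsmul ℝ ℝ) volume

theorem mollifier_nonneg (n : ℕ) (x : Eu N) : 0 ≤ mollifier N n x :=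
  (shrinkingBump N n).nonneg_normed x

theorem hasCompactSupport_mollifier (n : ℕ) : HasCompactSupport (mollifier N n) :=
  (shrinkingBump N n).hasCompactSupport_normed

theorem contDiff_mollifier (n : ℕ) : ContDiff ℝ ∞ (mollifier N n) :=
  (shrinkingBump N n).contDiff_normed (n := ⊤)

theorem integral_mollifier (n : ℕ) : ∫ x, mollifier N n x = 1 :=
  (shrinkingBump N n).integral_normed

theorem integrable_mollifier (n : ℕ) : Integrable (mollifier N n) volume :=
  (shrinkingBump N n).integrable_normed

theorem mollify_apply (n : ℕ) (g : Eu N → F) (x : Eu N) :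
    mollify n g x = ∫ t, mollifier N n t • g (x - t) := by
  simp [mollify, convolution_def]

theorem mollify_apply_swap (n : ℕ) (g : Eu N → F) (x : Eu N) :
    mollify n g x = ∫ t, mollifier N n (x - t) • g t := by
  simp [mollify, convolution_eq_swap]

theorem integrable_mollifier_smul (n : ℕ) {g : Eu N → F} (hg : LocallyIntegrable g volume)
    (x : Eu N) : Integrable (fun t => mollifier N n t • g (x - t)) volume := by
  simpa using ((hasCompactSupport_mollifier n).convolutionExists_left
    (ContinuousLinearMap.lsmul ℝ ℝ) (contDiff_mollifier n).continuous hg x).integrable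

theorem contDiff_mollify (n : ℕ) {g : Eu N → F} (hg : LocallyIntegrable g volume) :
    ContDiff ℝ 1 (mollify n g) :=
  (hasCompactSupport_mollifier n).contDiff_convolution_left _
    ((contDiff_mollifier n).of_le (by simp)) hg

theorem tendsto_shrinkingBump : Tendsto (fun n => (shrinkingBump N n).rOut) atTop (nhds 0) :=
  tendsto_one_div_add_atTop_nhds_zero_nat

theorem ae_tendsto_mollify [CompleteSpace F] {g : Eu N → F} (hg : LocallyIntegrable g volume) :
    ∀ᵐ x, Tendsto (fun n => mollify n g x) atTop (nhds (g x)) :=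
  -- The constant $K=2$ is the ratio of outer to inner radius, the same for all the bumps.
  ContDiffBump.ae_convolution_tendsto_right_of_locallyIntegrable (K := 2) tendsto_shrinkingBump
    (Eventually.of_forall fun n => by simp [shrinkingBump]; linarith) hg

theorem tendsto_mollify_of_continuous [CompleteSpace F] {g : Eu N → F} (hg : Continuous g)
    (x : Eu N) : Tendsto (fun n => mollify n g x) atTop (nhds (g x)) :=
  ContDiffBump.convolution_tendsto_right_of_continuous tendsto_shrinkingBump hg x

theorem mollifier_eq_zero {n : ℕ} {x : Eu N} (hx : 1 ≤ ‖x‖) : mollifier N n x = 0 := by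
  have h : x ∉ Function.support (mollifier N n) := by
    rw [mollifier, ContDiffBump.support_normed_eq, mem_ball_zero_iff, not_lt]
    refine le_trans ?_ hx
    simp only [shrinkingBump]
    rw [div_le_one (by positivity)]
    linarith [(Nat.cast_nonneg n : (0 : ℝ) ≤ n)]
  simpa using h

theorem mollify_eq_zero {g : Eu N → F} {R : ℝ} (hg : ∀ x, R < ‖x‖ → g x = 0) (n : ℕ) {x : Eu N}
    (hx : R + 1 < ‖x‖) : mollify n g x = 0 := by
  rw [mollify_apply]
  refine integral_eq_zero_of_ae (ae_of_all _ fun t => ?_)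
  simp only [Pi.zero_apply]
  rcases le_or_gt 1 ‖t‖ with h | h
  · rw [mollifier_eq_zero h, zero_smul]
  · rw [hg _ (by have := norm_sub_norm_le x t; linarith), smul_zero]

theorem norm_mollify_le (n : ℕ) (g : Eu N → F) (x : Eu N) :
    ‖mollify n g x‖ ≤ mollify n (fun y => ‖g y‖) x := by
  rw [mollify_apply, mollify_apply]
  refine (norm_integral_le_integral_norm _).trans (le_of_eq ?_)
  simp_rw [norm_smul, Real.norm_of_nonneg (mollifier_nonneg n _), smul_eq_mul]

theorem mollify_nonneg (n : ℕ) {g : Eu N → ℝ} (hg : ∀ x, 0 ≤ g x) (x : Eu N) :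
    0 ≤ mollify n g x := by
  rw [mollify_apply]
  exact integral_nonneg fun t => mul_nonneg (mollifier_nonneg n t) (hg _)

theorem mollify_mono (n : ℕ) {g h : Eu N → ℝ} (hg : LocallyIntegrable g volume)
    (hh : LocallyIntegrable h volume) (hgh : ∀ x, g x ≤ h x) (x : Eu N) :
    mollify n g x ≤ mollify n h x := by
  rw [mollify_apply, mollify_apply]
  refine integral_mono (integrable_mollifier_smul n hg x) (integrable_mollifier_smul n hh x)
    fun t => ?_
  exact mul_le_mul_of_nonneg_left (hgh _) (mollifier_nonneg n t)

theorem mollify_const [CompleteSpace F] (n : ℕ) (c : F) (x : Eu N) :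
    mollify n (fun _ => c) x = c := by
  rw [mollify_apply, integral_smul_const, integral_mollifier, one_smul]

/-- A kernel of mass one preserves the integral. This keeps the integrals of the dominating
functions constant, as `exists_lintegral_le_tendsto` requires. -/
theorem lintegral_mollify_norm {E : Type*} [NormedAddCommGroup E] {G : Eu N → E} (hG : Integrable G volume) (n : ℕ) :
    ∫⁻ x, ENNReal.ofReal (mollify n (fun y => ‖G y‖) x) = ∫⁻ x, ‖G x‖ₑ := by
  have hi : Integrable (mollify n (fun y => ‖G y‖)) volume :=
    (integrable_mollifier (N := N) n).integrable_convolution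
      (ContinuousLinearMap.lsmul ℝ ℝ) hG.norm
  rw [← ofReal_integral_eq_lintegral_ofReal hi
    (ae_of_all _ fun x => mollify_nonneg n (fun _ => norm_nonneg _) x), mollify,
    integral_convolution _ (integrable_mollifier n) hG.norm, integral_mollifier,
    ← ofReal_integral_norm_eq_lintegral_enorm hG]
  simp

theorem lipschitzWith_mollify (n : ℕ) {g : Eu N → ℝ} {L : ℝ≥0} (hg : LipschitzWith L g) :
    LipschitzWith L (mollify n g) := by
  refine LipschitzWith.of_dist_le_mul fun x y => ?_
  have hl : LocallyIntegrable g volume := hg.continuous.locallyIntegrable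
  rw [Real.dist_eq, mollify_apply, mollify_apply,
    ← integral_sub (integrable_mollifier_smul n hl x) (integrable_mollifier_smul n hl y)]
  have hc : ∫ t, mollifier N n t * (L * dist x y) = L * dist x y := by
    rw [integral_mul_const, integral_mollifier, one_mul]
  rw [← hc]
  rw [← Real.norm_eq_abs]
  refine norm_integral_le_of_norm_le ((integrable_mollifier n).mul_const _)
    (ae_of_all _ fun t => ?_)
  simp only [smul_eq_mul]
  rw [← mul_sub, norm_mul, Real.norm_of_nonneg (mollifier_nonneg n t), ← dist_eq_norm]
  refine mul_le_mul_of_nonneg_left ?_ (mollifier_nonneg n t)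
  simpa using hg.dist_le_mul (x - t) (y - t)

/-- The derivative falls on the mollifier $\eta$, and $t\mapsto\eta(x-t)$ is a test function for the
weak gradient. The sign from the reflection cancels the sign from integration by parts. -/
theorem fderiv_mollify {u : Eu N → ℝ} {G : Eu N → Eu N} (h : HasWeakGrad u G) (n : ℕ) (x : Eu N) :
    fderiv ℝ (mollify n u) x = innerSL ℝ (mollify n G x) := by
  have hη : ContDiff ℝ 1 (mollifier N n) := (contDiff_mollifier n).of_le (by simp)
  have hd := (hasCompactSupport_mollifier n).hasFDerivAt_convolution_left
    (ContinuousLinearMap.lsmul ℝ ℝ) hη h.1 x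
  have hcoord : ∀ i : Fin N, fderiv ℝ (mollify n u) x (EuclideanSpace.single i 1)
      = (mollify n G x) i := by
    intro i
    have hd' : fderiv ℝ (mollify n u) x = _ := hd.fderiv
    rw [hd', convolution_eq_swap, ContinuousLinearMap.integral_apply]
    · have e1 : ∀ t, (((ContinuousLinearMap.lsmul ℝ ℝ).precompL (Eu N))
          (fderiv ℝ (mollifier N n) (x - t))) (u t) (EuclideanSpace.single i 1)
          = - (u t * fderiv ℝ (fun t => mollifier N n (x - t)) t (EuclideanSpace.single i 1)) := by
        intro t
        have h1 : HasFDerivAt (fun t => mollifier N n (x - t))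
            ((fderiv ℝ (mollifier N n) (x - t)).comp (-ContinuousLinearMap.id ℝ (Eu N))) t :=
          ((hη.differentiable (by simp)) (x - t)).hasFDerivAt.comp t
            ((hasFDerivAt_id t).const_sub x)
        rw [h1.fderiv]
        simp [mul_comm]
      simp_rw [e1]
      rw [integral_neg, h.2.2 (fun t => mollifier N n (x - t))
        ((contDiff_mollifier n).comp (contDiff_const.sub contDiff_id))
        ((hasCompactSupport_mollifier n).comp_homeomorph (Homeomorph.subLeft x)) i, neg_neg,
        mollify_apply_swap]
      have hI : Integrable (fun t => mollifier N n (x - t) • G t) volume := by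
        refine h.2.1.integrable_smul_left_of_hasCompactSupport
          ((contDiff_mollifier n).continuous.comp (continuous_const.sub continuous_id)) ?_
        exact (hasCompactSupport_mollifier n).comp_homeomorph (Homeomorph.subLeft x)
      have := (EuclideanSpace.proj i : Eu N →L[ℝ] ℝ).integral_comp_comm hI
      refine (Eq.trans ?_ this)
      refine integral_congr_ae (ae_of_all _ fun t => ?_)
      simp [mul_comm]
    · have := ((hasCompactSupport_mollifier n).fderiv ℝ).convolutionExists_left
        ((ContinuousLinearMap.lsmul ℝ ℝ).precompL (Eu N)) (hη.continuous_fderiv (by simp)) h.1 x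
      exact this.integrable_swap
  refine ContinuousLinearMap.coe_injective
    ((EuclideanSpace.basisFun (Fin N) ℝ).toBasis.ext fun i => ?_)
  have h1 : innerSL ℝ (mollify n G x) (EuclideanSpace.single i 1) = (mollify n G x) i := by
    simp [EuclideanSpace.inner_single_right]
  simpa using (hcoord i).trans h1.symm

theorem norm_fderiv_mollify {u : Eu N → ℝ} {G : Eu N → Eu N} (h : HasWeakGrad u G) (n : ℕ)
    (x : Eu N) : ‖fderiv ℝ (mollify n u) x‖ = ‖mollify n G x‖ := by
  rw [fderiv_mollify h, innerSL_apply_norm]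

/-- Upper bound in a dominated convergence theorem with convergent dominating functions. -/
theorem exists_lintegral_le_tendsto {α : Type*} [MeasurableSpace α] {μ : Measure α}
    {f m : ℕ → α → ℝ≥0∞} {f₀ m₀ : α → ℝ≥0∞} (hf : ∀ n, AEMeasurable (f n) μ)
    (hm : ∀ n, AEMeasurable (m n) μ) (hm₀ : AEMeasurable m₀ μ) (hle : ∀ n x, f n x ≤ m n x)
    (hfl : ∀ᵐ x ∂μ, Tendsto (fun n => f n x) atTop (nhds (f₀ x)))
    (hml : ∀ᵐ x ∂μ, Tendsto (fun n => m n x) atTop (nhds (m₀ x)))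
    (hint : ∀ n, ∫⁻ x, m n x ∂μ = ∫⁻ x, m₀ x ∂μ) (hfin : ∫⁻ x, m₀ x ∂μ ≠ ⊤) :
    ∃ c : ℕ → ℝ≥0∞, (∀ n, ∫⁻ x, f n x ∂μ ≤ c n) ∧
      Tendsto c atTop (nhds (∫⁻ x, f₀ x ∂μ)) := by
  have hminm : ∀ n, AEMeasurable (fun x => min (m n x) (m₀ x)) μ := fun n => (hm n).min hm₀
  have hmin_fin : ∀ n, ∫⁻ x, min (m n x) (m₀ x) ∂μ ≠ ⊤ := fun n =>
    ne_top_of_le_ne_top hfin (lintegral_mono fun x => min_le_right _ _)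
  -- $f_n$ is at most its truncation by $m_0$ plus the excess of $m_n$ over $m_0$. The truncations
  -- obey dominated convergence, and the integral of the excess tends to zero because $\int m_n=\int
  -- m_0$.
  refine ⟨fun n => ∫⁻ x, min (f n x) (m₀ x) ∂μ
    + (∫⁻ x, m₀ x ∂μ - ∫⁻ x, min (m n x) (m₀ x) ∂μ), fun n => ?_, ?_⟩
  · have h1 : ∀ x, f n x ≤ min (f n x) (m₀ x) + (m n x - min (m n x) (m₀ x)) := by
      intro x
      rcases le_total (f n x) (m₀ x) with h | h
      · rw [min_eq_left h]; exact le_self_add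
      · rw [min_eq_right h, min_eq_right (h.trans (hle n x))]
        exact (hle n x).trans le_add_tsub
    refine (lintegral_mono h1).trans ?_
    rw [lintegral_add_left' ((hf n).min hm₀), lintegral_sub' (hminm n) (hmin_fin n)
      (ae_of_all _ fun x => min_le_left _ _), hint n]
  · have t1 : Tendsto (fun n => ∫⁻ x, min (f n x) (m₀ x) ∂μ) atTop (nhds (∫⁻ x, f₀ x ∂μ)) := by
      refine tendsto_lintegral_of_dominated_convergence' m₀ (fun n => (hf n).min hm₀)
        (fun n => ae_of_all _ fun x => min_le_right _ _) hfin ?_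
      filter_upwards [hfl, hml] with x h1 h2
      have h3 : f₀ x ≤ m₀ x := le_of_tendsto_of_tendsto' h1 h2 fun n => hle n x
      simpa [min_eq_left h3] using h1.min (tendsto_const_nhds (x := m₀ x))
    have t2 : Tendsto (fun n => ∫⁻ x, min (m n x) (m₀ x) ∂μ) atTop (nhds (∫⁻ x, m₀ x ∂μ)) := by
      refine tendsto_lintegral_of_dominated_convergence' m₀ hminm
        (fun n => ae_of_all _ fun x => min_le_right _ _) hfin ?_
      filter_upwards [hml] with x h2
      simpa using h2.min (tendsto_const_nhds (x := m₀ x))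
    have t3 := ENNReal.Tendsto.sub (tendsto_const_nhds (x := ∫⁻ x, m₀ x ∂μ)) t2 (Or.inl hfin)
    rw [tsub_self] at t3
    simpa using t1.add t3

end Mollify

/-! ### Smooth bounded truncations -/

section Truncation

/-- A smooth truncation of the identity at height `k`. -/
def smoothTrunc (k t : ℝ) : ℝ := k * Real.arctan (t / k)

theorem hasDerivAt_smoothTrunc {k : ℝ} (hk : 0 < k) (t : ℝ) :
    HasDerivAt (smoothTrunc k) (1 / (1 + (t / k) ^ 2)) t := by
  have h := ((hasDerivAt_id t).div_const k).arctan.const_mul k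
  refine h.congr_deriv ?_
  simp only [id]; field_simp

theorem contDiff_smoothTrunc (k : ℝ) : ContDiff ℝ 1 (smoothTrunc k) :=
  contDiff_const.mul (contDiff_id.div_const k).arctan

theorem abs_smoothTrunc_le {k : ℝ} (hk : 0 < k) (t : ℝ) : |smoothTrunc k t| ≤ |t| := by
  have h := Convex.norm_image_sub_le_of_norm_hasDerivWithin_le (s := univ) (C := 1)
    (f := smoothTrunc k) (x := 0) (y := t)
    (fun x _ => (hasDerivAt_smoothTrunc hk x).hasDerivWithinAt) (fun x _ => by
      rw [Real.norm_of_nonneg (by positivity), div_le_one (by positivity)]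
      nlinarith [sq_nonneg (x / k)]) convex_univ (mem_univ _) (mem_univ _)
  simpa [smoothTrunc] using h

theorem abs_smoothTrunc_le_const {k : ℝ} (hk : 0 < k) (t : ℝ) : |smoothTrunc k t| ≤ 2 * k := by
  rw [smoothTrunc, abs_mul, abs_of_pos hk]
  have h1 := Real.arctan_lt_pi_div_two (t / k)
  have h2 := Real.neg_pi_div_two_lt_arctan (t / k)
  have h3 : |Real.arctan (t / k)| ≤ 2 := by
    rw [abs_le]; constructor <;> linarith [Real.pi_le_four]
  nlinarith

/-- Shrinking a truncated function is the same as truncating the shrunk function at the shrunk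
height; the dyadic rescaling relies on this. -/
theorem smoothTrunc_mul {c : ℝ} (hc : 0 < c) (k t : ℝ) :
    smoothTrunc (c * k) (c * t) = c * smoothTrunc k t := by
  rw [smoothTrunc, smoothTrunc, mul_div_mul_left _ _ hc.ne', mul_assoc]

theorem smoothTrunc_zero (k : ℝ) : smoothTrunc k 0 = 0 := by simp [smoothTrunc]

/-- With $h=1/(n+1)$ the sequence is the difference quotient at 0 of $h\mapsto\arctan(th)$, whose
derivative there is $t$. -/
theorem tendsto_smoothTrunc (t : ℝ) :
    Tendsto (fun n : ℕ => smoothTrunc (n + 1) t) atTop (nhds t) := by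
  have h1 : HasDerivAt (fun h : ℝ => Real.arctan (t * h)) t 0 := by
    have := ((hasDerivAt_id (0 : ℝ)).const_mul t).arctan
    simpa using this
  have h2 := h1.tendsto_slope_zero
  have h3 : Tendsto (fun n : ℕ => (1 : ℝ) / (n + 1)) atTop (nhdsWithin 0 {0}ᶜ) := by
    rw [tendsto_nhdsWithin_iff]
    refine ⟨tendsto_one_div_add_atTop_nhds_zero_nat, Eventually.of_forall fun n => ?_⟩
    simp only [mem_compl_iff, mem_singleton_iff]
    positivity
  refine (h2.comp h3).congr fun n => ?_
  simp [smoothTrunc, div_eq_mul_inv]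

theorem norm_fderiv_smoothTrunc_comp_le {E : Type*} [NormedAddCommGroup E] [NormedSpace ℝ E]
    {k : ℝ} (hk : 0 < k) {u : E → ℝ} {x : E} (hu : DifferentiableAt ℝ u x) :
    ‖fderiv ℝ (fun y => smoothTrunc k (u y)) x‖ ≤ ‖fderiv ℝ u x‖ := by
  have h := (hasDerivAt_smoothTrunc hk (u x)).comp_hasFDerivAt x hu.hasFDerivAt
  have h' : fderiv ℝ (fun y => smoothTrunc k (u y)) x = _ := h.fderiv
  rw [h', norm_smul, Real.norm_of_nonneg (by positivity)]
  refine mul_le_of_le_one_left (norm_nonneg _) ?_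
  rw [div_le_one (by positivity)]
  nlinarith [sq_nonneg (u x / k)]

end Truncation

/-! ### The Gagliardo–Nirenberg–Sobolev inequality for a variable power -/

section GNS

variable {N : ℕ}

theorem holderConjugate_natCast (hN : 2 ≤ N) :
    Real.HolderConjugate (Module.finrank ℝ (Eu N)) (N / (N - 1) : ℝ) := by
  rw [finrank_euclideanSpace, Fintype.card_fin]
  exact Real.HolderConjugate.conjExponent (by exact_mod_cast hN)

/-- The Gagliardo–Nirenberg–Sobolev inequality applied to a regularization of `|w|^γ`. -/
theorem gns_regularized_rpow (hN : 2 ≤ N) : ∃ C : ℝ≥0, ∀ {w γ : Eu N → ℝ} {b L δ R : ℝ},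
    ContDiff ℝ 1 w → ContDiff ℝ 1 γ → (∀ x, 0 ≤ γ x) → (∀ x, γ x ≤ b) →
    (∀ x, ‖fderiv ℝ γ x‖ ≤ L) → 0 < δ → (∀ x, R < ‖x‖ → w x = 0) →
    ∫⁻ x, ‖√(w x ^ 2 + δ ^ 2) ^ γ x - δ ^ γ x‖ₑ ^ (N / (N - 1) : ℝ)
      ≤ C * ((∫⁻ x, ENNReal.ofReal (b * √(w x ^ 2 + δ ^ 2) ^ (γ x - 1)) * ‖fderiv ℝ w x‖ₑ)
        + ∫⁻ x, (Metric.closedBall 0 R).indicator (fun x => ENNReal.ofReal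
          (L * (√(w x ^ 2 + δ ^ 2) ^ γ x * |Real.log √(w x ^ 2 + δ ^ 2)|
            + δ ^ γ x * |Real.log δ|))) x) ^ (N / (N - 1) : ℝ) := by
  refine ⟨lintegralPowLePowLIntegralFDerivConst (volume : Measure (Eu N)) (N / (N - 1) : ℝ),
    fun {w γ b L δ R} hw hγ hγ0 hb hL hδ hR => ?_⟩
  have hN1 : (1 : ℝ) < N := by exact_mod_cast hN
  have hσ : 0 ≤ (N / (N - 1) : ℝ) := div_nonneg (by linarith) (by linarith)
  have hpos : ∀ x, 0 < w x ^ 2 + δ ^ 2 := fun x => by positivity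
  have hspos : ∀ x, 0 < √(w x ^ 2 + δ ^ 2) := fun x => Real.sqrt_pos.2 (hpos x)
  have hs : ContDiff ℝ 1 fun x => √(w x ^ 2 + δ ^ 2) :=
    ((hw.pow 2).add contDiff_const).sqrt fun x => (hpos x).ne'
  -- The base $\sqrt{w^2+\delta^2}$ is positive, so the power is smooth in base and exponent;
  -- subtracting $\delta^\gamma$ restores compact support.
  have hv : ContDiff ℝ 1 fun x => √(w x ^ 2 + δ ^ 2) ^ γ x - δ ^ γ x :=
    (hs.rpow hγ fun x => (hspos x).ne').sub (contDiff_const.rpow hγ fun x => hδ.ne')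
  have hzero : ∀ x, R < ‖x‖ → √(w x ^ 2 + δ ^ 2) ^ γ x - δ ^ γ x = 0 := fun x hx => by
    rw [hR x hx]
    simp [Real.sqrt_sq hδ.le]
  have hcs : HasCompactSupport fun x => √(w x ^ 2 + δ ^ 2) ^ γ x - δ ^ γ x :=
    HasCompactSupport.intro (isCompact_closedBall 0 R) fun x hx => by
      rw [mem_closedBall_zero_iff, not_le] at hx
      exact hzero x hx
  refine (lintegral_pow_le_pow_lintegral_fderiv (volume : Measure (Eu N)) hv hcs
    (holderConjugate_natCast hN)).trans ?_
  gcongr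
  have hw_d : ∀ x, HasFDerivAt w (fderiv ℝ w x) x := fun x =>
    (hw.differentiable (by simp) x).hasFDerivAt
  have hγ_d : ∀ x, HasFDerivAt γ (fderiv ℝ γ x) x := fun x =>
    (hγ.differentiable (by simp) x).hasFDerivAt
  have hsn : ∀ x, ‖fderiv ℝ (fun x => √(w x ^ 2 + δ ^ 2)) x‖ ≤ ‖fderiv ℝ w x‖ := fun x => by
    have h1 := (((hw_d x).pow 2).add_const (δ ^ 2)).sqrt (hpos x).ne'
    have h2 : fderiv ℝ (fun x => √(w x ^ 2 + δ ^ 2)) x = _ := h1.fderiv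
    rw [h2, smul_smul, norm_smul]
    refine mul_le_of_le_one_left (norm_nonneg _) ?_
    have h3 : |w x| ≤ √(w x ^ 2 + δ ^ 2) := Real.abs_le_sqrt (by nlinarith [sq_nonneg δ])
    simp only [Nat.add_one_sub_one, pow_one, Nat.cast_ofNat, norm_mul, norm_div, norm_one,
      Real.norm_eq_abs, abs_of_pos (hspos x), abs_two, nsmul_eq_mul]
    have h4 := hspos x
    rw [div_mul_eq_mul_div, div_le_one (by positivity)]
    linarith
  have hpt : ∀ x, ‖fderiv ℝ (fun x => √(w x ^ 2 + δ ^ 2) ^ γ x - δ ^ γ x) x‖ₑ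
      ≤ ENNReal.ofReal (b * √(w x ^ 2 + δ ^ 2) ^ (γ x - 1)) * ‖fderiv ℝ w x‖ₑ
        + (Metric.closedBall 0 R).indicator (fun x => ENNReal.ofReal
          (L * (√(w x ^ 2 + δ ^ 2) ^ γ x * |Real.log √(w x ^ 2 + δ ^ 2)|
            + δ ^ γ x * |Real.log δ|))) x := by
    intro x
    by_cases hx : x ∈ Metric.closedBall (0 : Eu N) R
    · rw [indicator_of_mem hx]
      have hL0 : 0 ≤ L := (norm_nonneg _).trans (hL x)
      have hb0 : 0 ≤ b := (hγ0 x).trans (hb x)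
      have hsd : HasFDerivAt (fun x => √(w x ^ 2 + δ ^ 2))
          (fderiv ℝ (fun x => √(w x ^ 2 + δ ^ 2)) x) x :=
        (hs.differentiable (by simp) x).hasFDerivAt
      have h1 := (hsd.rpow (hγ_d x) (hspos x)).sub ((hγ_d x).const_rpow hδ)
      have h2 : fderiv ℝ (fun x => √(w x ^ 2 + δ ^ 2) ^ γ x - δ ^ γ x) x = _ := h1.fderiv
      rw [h2, ← ofReal_norm, ← ofReal_norm, ← ENNReal.ofReal_mul (by positivity),
        ← ENNReal.ofReal_add (by positivity) (by positivity)]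
      refine ENNReal.ofReal_le_ofReal ?_
      have t1 : ‖(γ x * √(w x ^ 2 + δ ^ 2) ^ (γ x - 1)) •
          fderiv ℝ (fun x => √(w x ^ 2 + δ ^ 2)) x‖
          ≤ b * √(w x ^ 2 + δ ^ 2) ^ (γ x - 1) * ‖fderiv ℝ w x‖ := by
        rw [norm_smul, Real.norm_of_nonneg (mul_nonneg (hγ0 x) (by positivity))]
        have := hb x
        have := hsn x
        gcongr
      have t2 : ‖(√(w x ^ 2 + δ ^ 2) ^ γ x * Real.log √(w x ^ 2 + δ ^ 2)) • fderiv ℝ γ x‖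
          ≤ √(w x ^ 2 + δ ^ 2) ^ γ x * |Real.log √(w x ^ 2 + δ ^ 2)| * L := by
        rw [norm_smul, norm_mul, Real.norm_eq_abs, Real.norm_eq_abs,
          abs_of_nonneg (Real.rpow_nonneg (hspos x).le _)]
        have := hL x
        gcongr
      have t3 : ‖(δ ^ γ x * Real.log δ) • fderiv ℝ γ x‖ ≤ δ ^ γ x * |Real.log δ| * L := by
        rw [norm_smul, norm_mul, Real.norm_eq_abs, Real.norm_eq_abs,
          abs_of_nonneg (Real.rpow_nonneg hδ.le _)]
        have := hL x
        gcongr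
      refine (norm_sub_le _ _).trans ((add_le_add (norm_add_le _ _) le_rfl).trans ?_)
      linarith
    -- Outside the ball the two logarithmic contributions cancel identically, which justifies the
    -- indicator.
    · have hx' : R < ‖x‖ := by simpa using hx
      have h1 : (fun x => √(w x ^ 2 + δ ^ 2) ^ γ x - δ ^ γ x) =ᶠ[nhds x] fun _ => 0 := by
        filter_upwards [(isOpen_lt continuous_const continuous_norm).mem_nhds hx'] with y hy
        exact hzero y hy
      have h2 : fderiv ℝ (fun x => √(w x ^ 2 + δ ^ 2) ^ γ x - δ ^ γ x) x = 0 := by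
        rw [h1.fderiv_eq]
        simp
      rw [h2, ← ofReal_norm, norm_zero, ENNReal.ofReal_zero]
      exact zero_le
  refine (lintegral_mono hpt).trans (le_of_eq ?_)
  refine lintegral_add_left ?_ _
  have m1 : Measurable fun x => √(w x ^ 2 + δ ^ 2) := hs.continuous.measurable
  have m2 : Measurable γ := hγ.continuous.measurable
  have m3 : Measurable fun x => ‖fderiv ℝ w x‖ₑ := (hw.continuous_fderiv (by simp)).enorm.measurable
  exact (ENNReal.measurable_ofReal.comp ((m1.pow (m2.sub_const 1)).const_mul b)).mul m3

/-- The Gagliardo–Nirenberg–Sobolev inequality for `|w|^{γ(x)}`, `w` a truncation of a compactly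
supported function with integrable weak gradient. -/
theorem gns_variable_rpow (hN : 2 ≤ N) : ∃ C : ℝ≥0, ∀ {u γ : Eu N → ℝ} {G : Eu N → Eu N}
    {a b k R : ℝ} {L : ℝ≥0},
    HasWeakGrad u G → Integrable G volume → (∀ x, R < ‖x‖ → u x = 0) → LipschitzWith L γ →
    1 < a → (∀ x, a ≤ γ x) → (∀ x, γ x ≤ b) → 0 < k →
    ∫⁻ x, ‖smoothTrunc k (u x)‖ₑ ^ (γ x * (N / (N - 1) : ℝ))
      ≤ C * ((∫⁻ x, ENNReal.ofReal (b * |smoothTrunc k (u x)| ^ (γ x - 1)) * ‖G x‖ₑ)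
        + ∫⁻ x, ENNReal.ofReal (L * (|smoothTrunc k (u x)| ^ γ x *
          |Real.log (|smoothTrunc k (u x)|)|))) ^ (N / (N - 1) : ℝ) := by
  obtain ⟨C, hC⟩ := gns_regularized_rpow (N := N) hN
  refine ⟨C, fun {u γ G a b k R L} huG hG hR hγL ha hγa hγb hk => ?_⟩
  have hN1 : (1 : ℝ) < N := by exact_mod_cast hN
  set σ : ℝ := N / (N - 1) with hσdef
  have hσ : 0 < σ := div_pos (by linarith) (by linarith)
  have hγl : LocallyIntegrable γ volume := hγL.continuous.locallyIntegrable
  -- The height $k$ stays fixed while $u$ is mollified, so $|w_n|\le 2k$ uniformly; the majorants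
  -- below depend on this.
  set wn : ℕ → Eu N → ℝ := fun n x => smoothTrunc k (mollify n u x) with hwn
  set γn : ℕ → Eu N → ℝ := fun n => mollify n γ with hγn
  set δ : ℕ → ℝ := fun n => 1 / (n + 1) with hδ
  have hδ0 : ∀ n, 0 < δ n := fun n => by positivity
  have hδ1 : ∀ n, δ n ≤ 1 := fun n => by
    rw [hδ]; simp only
    rw [div_le_one (by positivity)]; linarith [(Nat.cast_nonneg n : (0 : ℝ) ≤ n)]
  have hδt : Tendsto δ atTop (nhds 0) := tendsto_one_div_add_atTop_nhds_zero_nat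
  set s : ℕ → Eu N → ℝ := fun n x => √(wn n x ^ 2 + δ n ^ 2) with hs
  have hγna : ∀ n x, a ≤ γn n x := fun n x => by
    rw [← mollify_const n a x]
    exact mollify_mono n continuous_const.locallyIntegrable hγl hγa x
  have hγnb : ∀ n x, γn n x ≤ b := fun n x => by
    rw [← mollify_const n b x]
    exact mollify_mono n hγl continuous_const.locallyIntegrable hγb x
  have hun : ∀ n, ContDiff ℝ 1 (mollify n u) := fun n => contDiff_mollify n huG.1
  have hwc : ∀ n, ContDiff ℝ 1 (wn n) := fun n => (contDiff_smoothTrunc k).comp (hun n)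
  have hγc : ∀ n, ContDiff ℝ 1 (γn n) := fun n => contDiff_mollify n hγl
  have hspos : ∀ n x, 0 < s n x := fun n x => Real.sqrt_pos.2 (by have := hδ0 n; positivity)
  have hsc : ∀ n, Continuous (s n) := fun n =>
    (((hwc n).continuous.pow 2).add continuous_const).sqrt
  have hsk : ∀ n x, s n x ≤ 2 * k + 1 := fun n x => by
    refine Real.sqrt_le_iff.2 ⟨by positivity, ?_⟩
    have h1 : |wn n x| ≤ 2 * k := abs_smoothTrunc_le_const hk _
    have h2 : wn n x ^ 2 ≤ (2 * k) ^ 2 := by rw [← sq_abs]; gcongr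
    have h3 : δ n ^ 2 ≤ 1 := by have := hδ0 n; have := hδ1 n; nlinarith
    nlinarith
  have hineq : ∀ n, ∫⁻ x, ‖s n x ^ γn n x - δ n ^ γn n x‖ₑ ^ σ
      ≤ C * ((∫⁻ x, ENNReal.ofReal (b * s n x ^ (γn n x - 1)) * ‖mollify n G x‖ₑ)
        + ∫⁻ x, (Metric.closedBall 0 (R + 1)).indicator (fun x => ENNReal.ofReal
          (L * (s n x ^ γn n x * |Real.log (s n x)|
            + δ n ^ γn n x * |Real.log (δ n)|))) x) ^ σ := by
    intro n
    -- The mollifiers live in the unit ball, so supports grow by at most one.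
    refine (hC (R := R + 1) (hwc n) (hγc n) (fun x => by linarith [hγna n x]) (hγnb n)
      (fun x => norm_fderiv_le_of_lipschitz ℝ (lipschitzWith_mollify n hγL)) (hδ0 n)
      (fun x hx => by
        simp only [hwn]
        rw [mollify_eq_zero hR n hx, smoothTrunc_zero])).trans ?_
    gcongr with x
    have h1 := norm_fderiv_smoothTrunc_comp_le hk ((hun n).differentiable (by simp) x)
    rw [norm_fderiv_mollify huG] at h1
    exact enorm_le_iff_norm_le.2 h1
  have hlim_w : ∀ᵐ x, Tendsto (fun n => s n x) atTop (nhds |smoothTrunc k (u x)|) := by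
    filter_upwards [ae_tendsto_mollify huG.1] with x hx
    have h1 : Tendsto (fun n => wn n x) atTop (nhds (smoothTrunc k (u x))) :=
      ((contDiff_smoothTrunc k).continuous.tendsto _).comp hx
    have h2 := ((h1.pow 2).add (hδt.pow 2)).sqrt
    simpa [Real.sqrt_sq_eq_abs] using h2
  have hlim_γ : ∀ x, Tendsto (fun n => γn n x) atTop (nhds (γ x)) :=
    tendsto_mollify_of_continuous hγL.continuous
  have hrpow : ∀ {f g : ℕ → ℝ} {c d : ℝ}, 0 < d → Tendsto f atTop (nhds c) →
      Tendsto g atTop (nhds d) → Tendsto (fun n => f n ^ g n) atTop (nhds (c ^ d)) := by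
    intro f g c d hd hf hg
    exact (Real.continuousAt_rpow_of_pos (c, d) hd).tendsto.comp (hf.prodMk_nhds hg)
  have hKb : ∀ n x, s n x ^ (γn n x - 1) ≤ (2 * k + 1) ^ (b - 1) := fun n x =>
    (Real.rpow_le_rpow (hspos n x).le (hsk n x) (by linarith [hγna n x])).trans
      (Real.rpow_le_rpow_of_exponent_le (by linarith) (by linarith [hγnb n x]))
  have hb0 : 0 < b := by linarith [hγa 0, hγb 0]
  have hGl : LocallyIntegrable G volume := hG.locallyIntegrable
  have hGnl : LocallyIntegrable (fun x => ‖G x‖) volume := hG.norm.locallyIntegrable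
  have hGnc : ∀ n, Continuous (mollify n G) := fun n => (contDiff_mollify n hGl).continuous
  have hsγm : ∀ n, Measurable fun x => s n x ^ (γn n x - 1) := fun n =>
    (hsc n).measurable.pow ((hγc n).continuous.measurable.sub_const 1)
  -- the gradient term
  obtain ⟨c, hc, hct⟩ := exists_lintegral_le_tendsto (μ := (volume : Measure (Eu N)))
    (f := fun n x => ENNReal.ofReal (b * s n x ^ (γn n x - 1)) * ‖mollify n G x‖ₑ)
    (m := fun n x => ENNReal.ofReal (b * (2 * k + 1) ^ (b - 1)) *
      ENNReal.ofReal (mollify n (fun y => ‖G y‖) x))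
    (f₀ := fun x => ENNReal.ofReal (b * |smoothTrunc k (u x)| ^ (γ x - 1)) * ‖G x‖ₑ)
    (m₀ := fun x => ENNReal.ofReal (b * (2 * k + 1) ^ (b - 1)) * ‖G x‖ₑ)
    (fun n => ((ENNReal.measurable_ofReal.comp ((hsγm n).const_mul b)).mul
      (hGnc n).enorm.measurable).aemeasurable)
    (fun n => ((ENNReal.measurable_ofReal.comp
      (contDiff_mollify n hGnl).continuous.measurable).const_mul _).aemeasurable)
    (hG.aestronglyMeasurable.enorm.const_mul _)
    (fun n x => by
      gcongr
      · exact hKb n x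
      · rw [← ofReal_norm]
        exact ENNReal.ofReal_le_ofReal (norm_mollify_le n G x))
    (by
      filter_upwards [hlim_w, ae_tendsto_mollify hGl] with x h1 h2
      have h3 := hrpow (show 0 < γ x - 1 by linarith [hγa x]) h1 ((hlim_γ x).sub_const 1)
      exact ENNReal.Tendsto.mul (ENNReal.tendsto_ofReal (h3.const_mul b))
        (Or.inr enorm_ne_top) h2.enorm (Or.inr ENNReal.ofReal_ne_top))
    (by
      filter_upwards [ae_tendsto_mollify hGnl] with x h1
      have h2 := ENNReal.tendsto_ofReal h1
      rw [ofReal_norm] at h2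
      exact ENNReal.Tendsto.const_mul h2 (Or.inr ENNReal.ofReal_ne_top))
    (fun n => by
      rw [lintegral_const_mul' _ _ ENNReal.ofReal_ne_top,
        lintegral_const_mul' _ _ ENNReal.ofReal_ne_top, lintegral_mollify_norm hG])
    (by
      rw [lintegral_const_mul' _ _ ENNReal.ofReal_ne_top]
      exact ENNReal.mul_ne_top ENNReal.ofReal_ne_top hG.2.ne)
  -- the logarithmic term
  obtain ⟨K, hK⟩ := (isCompact_Icc (a := (0 : ℝ)) (b := 2 * k + 1)).exists_bound_of_continuousOn
    (f := fun t => t * Real.log t) Real.continuous_mul_log.continuousOn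
  have hK0 : 0 ≤ K := (norm_nonneg _).trans (hK 0 ⟨le_rfl, by positivity⟩)
  -- Since $t\log t$ extends continuously by 0 to $t=0$ and the exponents in use exceed 1, this
  -- factorization controls the logarithm where the function vanishes.
  have hlogform : ∀ {t g : ℝ}, 0 < t → t ^ g * |Real.log t| = t ^ (g - 1) * |t * Real.log t| := by
    intro t g ht
    rw [abs_mul, abs_of_pos ht, ← mul_assoc, ← Real.rpow_add_one ht.ne', sub_add_cancel]
  have hlogb : ∀ n x, ∀ t : ℝ, 0 < t → t ≤ 2 * k + 1 →
      t ^ γn n x * |Real.log t| ≤ (2 * k + 1) ^ (b - 1) * K := by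
    intro n x t ht htk
    rw [hlogform ht]
    gcongr ?_ * ?_
    · exact (Real.rpow_le_rpow ht.le htk (by linarith [hγna n x])).trans
        (Real.rpow_le_rpow_of_exponent_le (by linarith) (by linarith [hγnb n x]))
    · exact hK t ⟨ht.le, htk⟩
  have hlogt : ∀ {f g : ℕ → ℝ} {c d : ℝ}, 1 < d → (∀ n, 0 < f n) → Tendsto f atTop (nhds c) →
      Tendsto g atTop (nhds d) →
      Tendsto (fun n => f n ^ g n * |Real.log (f n)|) atTop (nhds (c ^ d * |Real.log c|)) := by
    intro f g c d hd hfp hf hg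
    have hc0 : 0 ≤ c := ge_of_tendsto' hf fun n => (hfp n).le
    have h1 := hrpow (show 0 < d - 1 by linarith) hf (hg.sub_const 1)
    have h2 := ((Real.continuous_mul_log.tendsto c).comp hf).abs
    have h3 := h1.mul h2
    have e : c ^ (d - 1) * |c * Real.log c| = c ^ d * |Real.log c| := by
      rcases hc0.eq_or_lt with h0 | h0
      · rw [← h0]; simp
      · rw [← hlogform h0]
    rw [e] at h3
    refine h3.congr fun n => ?_
    simp only [Function.comp]
    rw [hlogform (hfp n)]
  have hJt : Tendsto (fun n => ∫⁻ x, (Metric.closedBall (0 : Eu N) (R + 1)).indicator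
      (fun x => ENNReal.ofReal (L * (s n x ^ γn n x * |Real.log (s n x)|
            + δ n ^ γn n x * |Real.log (δ n)|))) x) atTop
      (nhds (∫⁻ x, (Metric.closedBall (0 : Eu N) (R + 1)).indicator
      (fun x => ENNReal.ofReal (L * (|smoothTrunc k (u x)| ^ γ x *
        |Real.log (|smoothTrunc k (u x)|)|))) x)) := by
    -- A constant majorant is integrable thanks to the indicator of the ball.
    refine tendsto_lintegral_of_dominated_convergence'
      ((Metric.closedBall (0 : Eu N) (R + 1)).indicator
        fun _ => ENNReal.ofReal (L * ((2 * k + 1) ^ (b - 1) * K + (2 * k + 1) ^ (b - 1) * K)))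
      (fun n => ?_) (fun n => ae_of_all _ fun x => ?_) ?_ ?_
    · refine (Measurable.indicator ?_ measurableSet_closedBall).aemeasurable
      have m1 := (hsc n).measurable
      have m2 := (hγc n).continuous.measurable
      have m3 : Measurable fun x => s n x ^ γn n x := m1.pow m2
      have m4 : Measurable fun x => δ n ^ γn n x := measurable_const.pow m2
      have m5 : Measurable fun x => |Real.log (s n x)| := (Real.measurable_log.comp m1).norm
      exact ENNReal.measurable_ofReal.comp
        (((m3.mul m5).add (m4.mul_const _)).const_mul _)
    · refine indicator_le_indicator (ENNReal.ofReal_le_ofReal ?_)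
      exact mul_le_mul_of_nonneg_left (add_le_add (hlogb n x _ (hspos n x) (hsk n x))
        (hlogb n x _ (hδ0 n) (by linarith [hδ1 n]))) L.coe_nonneg
    · rw [lintegral_indicator measurableSet_closedBall, setLIntegral_const]
      exact ENNReal.mul_ne_top ENNReal.ofReal_ne_top measure_closedBall_lt_top.ne
    · filter_upwards [hlim_w] with x hx
      by_cases hxB : x ∈ Metric.closedBall (0 : Eu N) (R + 1)
      · simp only [indicator_of_mem hxB]
        have hd : 1 < γ x := by linarith [hγa x]
        have h1 := hlogt hd (fun n => hspos n x) hx (hlim_γ x)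
        have h2 := hlogt hd hδ0 hδt (hlim_γ x)
        have h3 := ((h1.add h2).const_mul (L : ℝ))
        rw [Real.log_zero, abs_zero, mul_zero, add_zero] at h3
        exact ENNReal.tendsto_ofReal h3
      · simp only [indicator_of_notMem hxB]
        exact tendsto_const_nhds
  have hJle : ∫⁻ x, (Metric.closedBall (0 : Eu N) (R + 1)).indicator
      (fun x => ENNReal.ofReal (L * (|smoothTrunc k (u x)| ^ γ x *
        |Real.log (|smoothTrunc k (u x)|)|))) x
      ≤ ∫⁻ x, ENNReal.ofReal (L * (|smoothTrunc k (u x)| ^ γ x *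
        |Real.log (|smoothTrunc k (u x)|)|)) :=
    lintegral_mono fun x => indicator_le_self _ _ x
  have hI0 : ∀ x : ℝ≥0∞, Tendsto (fun y : ℝ≥0∞ => (C : ℝ≥0∞) * y ^ σ) (nhds x)
      (nhds ((C : ℝ≥0∞) * x ^ σ)) := fun x =>
    ENNReal.Tendsto.const_mul ((ENNReal.continuous_rpow_const (y := σ)).tendsto x)
      (Or.inr ENNReal.coe_ne_top)
  have hRHS := (hI0 _).comp (hct.add hJt)
  -- Fatou's lemma on the left; on the right, convergent upper bounds for the two integrals.
  calc ∫⁻ x, ‖smoothTrunc k (u x)‖ₑ ^ (γ x * σ)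
      ≤ ∫⁻ x, liminf (fun n => ‖s n x ^ γn n x - δ n ^ γn n x‖ₑ ^ σ) atTop := by
        refine lintegral_mono_ae ?_
        filter_upwards [hlim_w] with x hx
        have hd : 0 < γ x := by linarith [hγa x]
        have h1 := (hrpow hd hx (hlim_γ x)).sub (hrpow hd hδt (hlim_γ x))
        rw [Real.zero_rpow hd.ne', sub_zero] at h1
        have h2 := ((ENNReal.continuous_rpow_const (y := σ)).tendsto _).comp h1.enorm
        refine le_of_eq (Eq.trans ?_ h2.liminf_eq.symm)
        have e : ‖|smoothTrunc k (u x)| ^ γ x‖ₑ = ‖smoothTrunc k (u x)‖ₑ ^ γ x := by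
          rw [Real.enorm_eq_ofReal_abs, Real.enorm_eq_ofReal_abs,
            ENNReal.ofReal_rpow_of_nonneg (abs_nonneg _) hd.le,
            abs_of_nonneg (Real.rpow_nonneg (abs_nonneg _) _)]
        rw [e, ENNReal.rpow_mul]
    _ ≤ liminf (fun n => ∫⁻ x, ‖s n x ^ γn n x - δ n ^ γn n x‖ₑ ^ σ) atTop := by
        refine lintegral_liminf_le fun n => ?_
        have m1 := (hsc n).measurable
        have m2 := (hγc n).continuous.measurable
        exact ((m1.pow m2).sub (measurable_const.pow m2)).enorm.pow_const σ
    _ ≤ liminf (fun n => (C : ℝ≥0∞) * (c n + ∫⁻ x,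
          (Metric.closedBall (0 : Eu N) (R + 1)).indicator
          (fun x => ENNReal.ofReal (L * (s n x ^ γn n x * |Real.log (s n x)|
            + δ n ^ γn n x * |Real.log (δ n)|))) x) ^ σ) atTop := by
        refine liminf_le_liminf (Eventually.of_forall fun n => (hineq n).trans ?_)
        have := hc n
        gcongr
    _ = _ := hRHS.liminf_eq
    _ ≤ _ := by gcongr

end GNS

/-! ### Elementary inequalities for the absorption argument -/

section Young

/-- Either $g\le\delta a^m$, which yields the first term, or $a^m\le g/\delta$, which leaves only
powers of $g$. -/
theorem rpow_mul_le_add {a g δ m p M : ℝ} (ha : 0 ≤ a) (hg : 0 ≤ g) (hδ : 0 < δ) (hδ1 : δ ≤ 1)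
    (hp : 1 < p) (hpM : p ≤ M) :
    a ^ (m * (p - 1)) * g ≤ δ * a ^ (m * p) + (1 / δ) ^ M * g ^ p := by
  have ham : 0 ≤ a ^ m := Real.rpow_nonneg ha m
  rw [Real.rpow_mul ha, Real.rpow_mul ha]
  have e : ∀ t : ℝ, 0 ≤ t → t ^ (p - 1) * t = t ^ p := fun t ht => by
    rcases ht.eq_or_lt with rfl | h
    · rw [mul_zero, Real.zero_rpow (by linarith)]
    · rw [← Real.rpow_add_one h.ne', sub_add_cancel]
  have h1 : (1 : ℝ) ≤ 1 / δ := by rw [le_div_iff₀ hδ]; linarith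
  rcases le_total g (δ * a ^ m) with h | h
  · calc (a ^ m) ^ (p - 1) * g ≤ (a ^ m) ^ (p - 1) * (δ * a ^ m) := by gcongr
      _ = δ * (a ^ m) ^ p := by rw [← e _ ham]; ring
      _ ≤ _ := le_add_of_nonneg_right (by positivity)
  · have h2 : a ^ m ≤ 1 / δ * g := by
      rw [div_mul_eq_mul_div, one_mul, le_div_iff₀ hδ]; linarith
    calc (a ^ m) ^ (p - 1) * g ≤ (1 / δ * g) ^ (p - 1) * g := by
          gcongr
      _ = (1 / δ) ^ (p - 1) * g ^ p := by
          rw [Real.mul_rpow (by positivity) hg, mul_assoc, e _ hg]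
      _ ≤ (1 / δ) ^ M * g ^ p := by
          gcongr
          linarith
      _ ≤ _ := le_add_of_nonneg_left (by positivity)

/-- For $a\le 1$ the logarithm costs $a^{-\varepsilon}$, and $\gamma-\varepsilon\ge p$. For $a\ge 1$
it costs $a^{\varepsilon}$; when $a^\varepsilon\ge 1/(\varepsilon\delta)$ a second such factor
produces the small constant, and the remaining range of $a$ is bounded, so $a^p$ suffices. -/
theorem exists_rpow_mul_abs_log_le {ε M δ : ℝ} (hε : 0 < ε) (hδ : 0 < δ) :
    ∃ C : ℝ, 0 ≤ C ∧ ∀ {a p γ P : ℝ}, 0 ≤ a → 0 < p → p + ε ≤ γ → γ + 2 * ε ≤ P → P ≤ M →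
      a ^ γ * |Real.log a| ≤ δ * a ^ P + C * a ^ p := by
  set A : ℝ := max 1 ((1 / (ε * δ)) ^ (1 / ε)) with hA
  have hA1 : 1 ≤ A := le_max_left _ _
  refine ⟨1 / ε + A ^ M / ε, by positivity, fun {a p γ P} ha hp hγ hP hM => ?_⟩
  rcases ha.eq_or_lt with rfl | ha0
  · rw [Real.log_zero, abs_zero, mul_zero]
    positivity
  rcases le_total a 1 with h1 | h1
  · have h2 : |Real.log a| ≤ a ^ (-ε) / ε := by
      have h3 := (Real.abs_log_mul_self_rpow_lt a ε ha0 h1 hε).le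
      rw [abs_mul, abs_of_pos (Real.rpow_pos_of_pos ha0 ε)] at h3
      rw [Real.rpow_neg ha, le_div_iff₀ hε, ← one_div, le_div_iff₀ (by positivity)]
      rw [le_div_iff₀ hε] at h3
      linarith
    calc a ^ γ * |Real.log a| ≤ a ^ γ * (a ^ (-ε) / ε) := by gcongr
      _ = 1 / ε * a ^ (γ - ε) := by rw [sub_eq_add_neg, Real.rpow_add ha0]; ring
      _ ≤ 1 / ε * a ^ p := by
          gcongr 1 / ε * ?_
          exact Real.rpow_le_rpow_of_exponent_ge ha0 h1 (by linarith)
      _ ≤ _ := by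
          have : 0 ≤ A ^ M / ε * a ^ p := by positivity
          have : 0 ≤ δ * a ^ P := by positivity
          linarith
  · have h2 : |Real.log a| ≤ a ^ ε / ε := by
      rw [abs_of_nonneg (Real.log_nonneg h1)]
      exact Real.log_le_rpow_div ha hε
    have h3 : a ^ γ * |Real.log a| ≤ a ^ (γ + ε) / ε := by
      rw [Real.rpow_add ha0, mul_div_assoc]
      gcongr
    refine h3.trans ?_
    rcases le_total (1 / (ε * δ)) (a ^ ε) with h4 | h4
    · have h5 : 1 / ε ≤ δ * a ^ ε := by
        rw [div_le_iff₀ (by positivity)] at h4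
        rw [div_le_iff₀ hε]
        linarith
      calc a ^ (γ + ε) / ε = a ^ (γ + ε) * (1 / ε) := by ring
        _ ≤ a ^ (γ + ε) * (δ * a ^ ε) := by gcongr
        _ = δ * a ^ (γ + 2 * ε) := by
            rw [show γ + 2 * ε = γ + ε + ε by ring, Real.rpow_add ha0 (γ + ε)]; ring
        _ ≤ δ * a ^ P := by
            gcongr
        _ ≤ _ := le_add_of_nonneg_right (by positivity)
    · have h5 : a ≤ A := by
        refine le_trans ?_ (le_max_right _ _)
        calc a = (a ^ ε) ^ (1 / ε) := by
              rw [← Real.rpow_mul ha, mul_one_div_cancel hε.ne', Real.rpow_one]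
          _ ≤ _ := by gcongr
      calc a ^ (γ + ε) / ε = a ^ (γ + ε - p) * a ^ p / ε := by
            rw [← Real.rpow_add ha0]; congr 2; ring
        _ ≤ A ^ M * a ^ p / ε := by
            gcongr ?_ * _ / _
            exact (Real.rpow_le_rpow ha h5 (by linarith)).trans
              (Real.rpow_le_rpow_of_exponent_le hA1 (by linarith))
        _ = A ^ M / ε * a ^ p := by ring
        _ ≤ _ := by
            have : 0 ≤ 1 / ε * a ^ p := by positivity
            have : 0 ≤ δ * a ^ P := by positivity
            linarith

end Young

/-! ### The critical exponent and the exponent of the $L^1$ inequality -/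

section Exponents

variable {N : ℕ} {p : CPlus N}

/-- The critical exponent `p*(x) = N p(x) / (N - p(x))`. -/
def criticalExp (p : CPlus N) (x : Eu N) : ℝ := N * p x / (N - p x)

/-- The exponent `p*(x) (N - 1) / N`, at which the `L¹` inequality is applied. -/
def gnsExp (p : CPlus N) (x : Eu N) : ℝ := p x * (N - 1) / (N - p x)

theorem sub_hi_le (p : CPlus N) (x : Eu N) : (N : ℝ) - p.hi ≤ N - p x := by
  linarith [p.le_hi x]

/-- With $m=N/(N-p)$ the power in the gradient term is $\gamma-1=m(p-1)$ while $mp=p^\star$, the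
pattern of `rpow_mul_le_add`. -/
theorem gnsExp_eq (hpN : p.hi < N) (x : Eu N) :
    gnsExp p x = N / (N - p x) * (p x - 1) + 1 := by
  have := sub_hi_le p x
  have : (N : ℝ) - p x ≠ 0 := by linarith
  rw [gnsExp]
  field_simp
  ring

theorem criticalExp_eq (x : Eu N) : criticalExp p x = N / (N - p x) * p x := by
  rw [criticalExp]; ring

theorem criticalExp_sub_gnsExp (hpN : p.hi < N) (x : Eu N) :
    criticalExp p x - gnsExp p x = p x / (N - p x) := by
  have := sub_hi_le p x
  have : (N : ℝ) - p x ≠ 0 := by linarith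
  rw [gnsExp, criticalExp]
  field_simp
  ring

/-- Together with `criticalExp_sub_gnsExp` and `one_div_le_div_sub`, this keeps $\gamma$ uniformly
away from $p$ and $p^\star$, because $p^->1$; the logarithm needs that room. -/
theorem gnsExp_sub (hpN : p.hi < N) (x : Eu N) :
    gnsExp p x - p x = p x / (N - p x) * (p x - 1) := by
  have := sub_hi_le p x
  have : (N : ℝ) - p x ≠ 0 := by linarith
  rw [gnsExp]
  field_simp
  ring

theorem one_lt_natCast_of_hi_lt (hpN : p.hi < N) : (1 : ℝ) < N := by
  linarith [p.one_lt 0, p.le_hi 0]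

theorem one_div_le_div_sub (hpN : p.hi < N) (x : Eu N) : (1 / N : ℝ) ≤ p x / (N - p x) := by
  have h1 := sub_hi_le p x
  have h2 := p.one_lt x
  have h3 := one_lt_natCast_of_hi_lt hpN
  rw [div_le_div_iff₀ (by linarith) (by linarith)]
  nlinarith

theorem gnsExp_mul (hpN : p.hi < N) (x : Eu N) :
    gnsExp p x * (N / (N - 1) : ℝ) = criticalExp p x := by
  have h3 := one_lt_natCast_of_hi_lt hpN
  have : (N : ℝ) - 1 ≠ 0 := by linarith
  rw [gnsExp, criticalExp]
  field_simp

theorem le_gnsExp (hpN : p.hi < N) (x : Eu N) : p.lo ≤ gnsExp p x := by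
  have h1 := gnsExp_sub hpN x
  have h2 := p.one_lt x
  have h3 := sub_hi_le p x
  have : 0 ≤ p x / (N - p x) * (p x - 1) :=
    mul_nonneg (div_nonneg (p.pos x).le (by linarith)) (by linarith)
  linarith [p.lo_le x]

theorem gnsExp_le (hpN : p.hi < N) (x : Eu N) : gnsExp p x ≤ p.hi * (N - 1) / (N - p.hi) := by
  have h1 := sub_hi_le p x
  have h2 := p.pos x
  have h3 := one_lt_natCast_of_hi_lt hpN
  have h4 := p.le_hi x
  have : 0 < N - p.hi := by linarith
  have : (0 : ℝ) ≤ N - 1 := by linarith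
  have : (0 : ℝ) ≤ p.hi * (N - 1) := mul_nonneg (by linarith) this
  rw [gnsExp]
  gcongr

theorem criticalExp_le (hpN : p.hi < N) (x : Eu N) :
    criticalExp p x ≤ N * p.hi / (N - p.hi) := by
  have h1 := sub_hi_le p x
  have h2 := p.pos x
  have h4 := p.le_hi x
  have : 0 < N - p.hi := by linarith
  have : 0 ≤ N * p.hi := mul_nonneg (Nat.cast_nonneg N) (by linarith)
  rw [criticalExp]
  gcongr

theorem le_criticalExp (hpN : p.hi < N) (x : Eu N) : p x ≤ criticalExp p x := by
  have h1 := sub_hi_le p x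
  have h2 := p.pos x
  rw [criticalExp, le_div_iff₀ (by linarith)]
  nlinarith

theorem continuous_criticalExp (hpN : p.hi < N) : Continuous (criticalExp p) :=
  (continuous_const.mul p.continuous_toFun).div (continuous_const.sub p.continuous_toFun)
    fun x => by linarith [sub_hi_le p x]

/-- The difference at $x,y$ is $p(x)-p(y)$ times $N(N-1)/((N-p(x))(N-p(y)))$, whose denominator is
at least $(N-p^+)^2$. -/
theorem exists_lipschitzWith_gnsExp (hpN : p.hi < N)
    (hp : ∃ K : ℝ≥0, LipschitzWith K p.toFun) : ∃ L : ℝ≥0, LipschitzWith L (gnsExp p) := by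
  obtain ⟨K, hK⟩ := hp
  have h3 := one_lt_natCast_of_hi_lt hpN
  have hd : (0 : ℝ) < N - p.hi := by linarith
  set c : ℝ := N * (N - 1) / (N - p.hi) ^ 2 with hc
  have hc0 : 0 ≤ c := div_nonneg (mul_nonneg (by linarith) (by linarith)) (by positivity)
  refine ⟨Real.toNNReal c * K, LipschitzWith.of_dist_le_mul fun x y => ?_⟩
  have hx := sub_hi_le p x
  have hy := sub_hi_le p y
  have e : gnsExp p x - gnsExp p y
      = N * (N - 1) / ((N - p x) * (N - p y)) * (p x - p y) := by
    have : (N : ℝ) - p x ≠ 0 := by linarith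
    have : (N : ℝ) - p y ≠ 0 := by linarith
    rw [gnsExp, gnsExp]
    field_simp
    ring
  have hle : (N * (N - 1) / ((N - p x) * (N - p y)) : ℝ) ≤ c := by
    rw [hc, sq]
    have : (0 : ℝ) ≤ N - 1 := by linarith
    have : (0 : ℝ) ≤ N - p x := by linarith
    gcongr
  have h0 : (0 : ℝ) ≤ N * (N - 1) / ((N - p x) * (N - p y)) :=
    div_nonneg (mul_nonneg (by linarith) (by linarith)) (mul_nonneg (by linarith) (by linarith))
  have hKd := hK.dist_le_mul x y
  rw [Real.dist_eq] at hKd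
  rw [Real.dist_eq, e, abs_mul, abs_of_nonneg h0, NNReal.coe_mul, Real.coe_toNNReal c hc0,
    mul_assoc]
  gcongr

/-- Pointwise bound for the right-hand side of the variable exponent inequality. -/
theorem exists_gns_integrand_le (hpN : p.hi < N) (b : ℝ) (hb : 0 ≤ b) (L : ℝ≥0) {δ : ℝ}
    (hδ : 0 < δ) : ∃ C : ℝ≥0, ∀ (x : Eu N) (t : ℝ) (g : Eu N),
      ENNReal.ofReal (b * |t| ^ (gnsExp p x - 1)) * ‖g‖ₑ
        + ENNReal.ofReal (L * (|t| ^ gnsExp p x * |Real.log (|t|)|))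
      ≤ ENNReal.ofReal δ * ‖t‖ₑ ^ criticalExp p x + C * (‖t‖ₑ ^ p x + ‖g‖ₑ ^ p x) := by
  have h3 := one_lt_natCast_of_hi_lt hpN
  have hlo : 1 < p.lo := p.one_lt_iInf
  -- The budget $\delta$ is halved: $b\delta_1$ and $L\delta_2$ are at most $\delta/2$ each. The
  -- summands $+1$ cover $b=0$ and $L=0$.
  set δ₁ : ℝ := min 1 (δ / (2 * (b + 1))) with hδ₁
  have hδ₁0 : 0 < δ₁ := lt_min one_pos (by positivity)
  set δ₂ : ℝ := δ / (2 * (L + 1)) with hδ₂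
  have hδ₂0 : 0 < δ₂ := by have := L.coe_nonneg; positivity
  -- Then $2\varepsilon$ is below both gaps, since $p^\star-\gamma\ge 1/N$ and
  -- $\gamma-p\ge(p^--1)/N$.
  set ε : ℝ := min 1 (p.lo - 1) / (2 * N) with hε
  have hε0 : 0 < ε := div_pos (lt_min one_pos (by linarith)) (by linarith)
  obtain ⟨C₂, hC₂0, hC₂⟩ := exists_rpow_mul_abs_log_le (M := N * p.hi / (N - p.hi)) hε0 hδ₂0
  set C₁ : ℝ := (1 / δ₁) ^ p.hi with hC₁
  have hC₁0 : 0 ≤ C₁ := by positivity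
  have h2ε : 2 * ε = min 1 (p.lo - 1) / N := by
    rw [hε]; field_simp
  refine ⟨Real.toNNReal (b * C₁ + L * C₂), fun x t g => ?_⟩
  have hsx := sub_hi_le p x
  have hpx := p.one_lt x
  have hq := one_div_le_div_sub hpN x
  have hN0 : (0 : ℝ) < N := by linarith
  have y1 := rpow_mul_le_add (abs_nonneg t) (norm_nonneg g) hδ₁0 (min_le_left _ _)
    (m := N / (N - p x)) hpx (p.le_hi x)
  rw [show N / (N - p x) * (p x - 1) = gnsExp p x - 1 by rw [gnsExp_eq hpN x]; ring,
    ← criticalExp_eq] at y1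
  have hε1 : 2 * ε ≤ 1 / N := by
    rw [h2ε]; gcongr; exact min_le_left _ _
  have hε2 : 2 * ε ≤ 1 / N * (p x - 1) := by
    rw [h2ε, div_mul_eq_mul_div, one_mul]; gcongr
    exact (min_le_right _ _).trans (by linarith [p.lo_le x])
  have y2 := hC₂ (a := |t|) (p := p x) (γ := gnsExp p x) (P := criticalExp p x) (abs_nonneg t)
    (p.pos x) (by
      have := gnsExp_sub hpN x
      have : 1 / N * (p x - 1) ≤ p x / (N - p x) * (p x - 1) := by gcongr
      linarith)
    (by
      have := criticalExp_sub_gnsExp hpN x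
      linarith) (criticalExp_le hpN x)
  have hcr : 0 < criticalExp p x := (p.pos x).trans_le (le_criticalExp hpN x)
  simp only [← ofReal_norm, Real.norm_eq_abs]
  rw [ENNReal.ofReal_rpow_of_nonneg (abs_nonneg _) hcr.le,
    ENNReal.ofReal_rpow_of_nonneg (abs_nonneg _) (p.pos x).le,
    ENNReal.ofReal_rpow_of_nonneg (norm_nonneg _) (p.pos x).le,
    ← ENNReal.ofReal_mul (by positivity), ← ENNReal.ofReal_mul (by positivity),
    ← ENNReal.ofReal_add (by positivity) (by positivity),
    ← ENNReal.ofReal_add (by positivity) (by positivity), ENNReal.ofNNReal_toNNReal,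
    ← ENNReal.ofReal_mul (by positivity), ← ENNReal.ofReal_add (by positivity) (by positivity)]
  refine ENNReal.ofReal_le_ofReal ?_
  have z1 : b * δ₁ ≤ δ / 2 := by
    have : δ₁ * (2 * (b + 1)) ≤ δ := by
      rw [← le_div_iff₀ (by positivity)]; exact min_le_right _ _
    nlinarith
  have z2 : L * δ₂ ≤ δ / 2 := by
    have hL := L.coe_nonneg
    have : δ₂ * (2 * (L + 1)) = δ := by rw [hδ₂]; field_simp
    nlinarith
  have y1' := mul_le_mul_of_nonneg_left y1 hb
  have y2' := mul_le_mul_of_nonneg_left y2 L.coe_nonneg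
  have hP : 0 ≤ |t| ^ criticalExp p x := by positivity
  have w1 := mul_le_mul_of_nonneg_right z1 hP
  have w2 := mul_le_mul_of_nonneg_right z2 hP
  have w3 : 0 ≤ b * C₁ * |t| ^ p x := by positivity
  have w4 : 0 ≤ L * C₂ * ‖g‖ ^ p x := by positivity
  linarith

end Exponents

/-! ### Sobolev inequality for truncations and its bootstrap -/

section Embedding

variable {N : ℕ} {p : CPlus N}

theorem enorm_smoothTrunc_le {k : ℝ} (hk : 0 < k) (t : ℝ) : ‖smoothTrunc k t‖ₑ ≤ ‖t‖ₑ :=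
  enorm_le_iff_norm_le.2 (abs_smoothTrunc_le hk t)

theorem modular_mono (p : CPlus N) {E F : Type*} [NormedAddCommGroup E] [NormedSpace ℝ E]
    [NormedAddCommGroup F] [NormedSpace ℝ F] {u : Eu N → E} {v : Eu N → F}
    (h : ∀ x, ‖u x‖ₑ ≤ ‖v x‖ₑ) : modular p u ≤ modular p v :=
  lintegral_mono fun x => ENNReal.rpow_le_rpow (h x) (p.pos x).le

/-- A smallness-conditional Sobolev inequality for truncations. -/
theorem exists_lintegral_smoothTrunc_le (hpN : p.hi < N)
    (hp : ∃ K : ℝ≥0, LipschitzWith K p.toFun) :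
    ∃ K : ℝ≥0, ∀ {u : Eu N → ℝ} {G : Eu N → Eu N} {k R : ℝ}, HasWeakGrad u G →
      Integrable G volume → (∀ x, R < ‖x‖ → u x = 0) → 0 < k →
      ∫⁻ x, ‖smoothTrunc k (u x)‖ₑ ^ criticalExp p x ≤ 1 →
      ∫⁻ x, ‖smoothTrunc k (u x)‖ₑ ^ criticalExp p x ≤ K * (modular p u + modular p G) := by
  have hN1 := one_lt_natCast_of_hi_lt hpN
  have hN : 2 ≤ N := by exact_mod_cast hN1
  obtain ⟨C, hC⟩ := gns_variable_rpow (N := N) hN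
  obtain ⟨L, hL⟩ := exists_lipschitzWith_gnsExp hpN hp
  set σ : ℝ := N / (N - 1) with hσ
  have hσ1 : 1 ≤ σ := by rw [hσ, le_div_iff₀ (by linarith)]; linarith
  set c : ℝ≥0 := C ^ (1 / σ) with hc
  -- This $\delta$ satisfies $c\delta\le 1/2$, so half of $X$ can be absorbed.
  have hδ : (0 : ℝ) < 1 / (2 * (c + 1)) := by positivity
  set b : ℝ := p.hi * (N - 1) / (N - p.hi) with hb
  have hlo : 1 < p.lo := p.one_lt_iInf
  have hb0 : 0 ≤ b := by linarith [gnsExp_le hpN 0, le_gnsExp hpN 0]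
  obtain ⟨D, hD⟩ := exists_gns_integrand_le hpN b hb0 L hδ
  refine ⟨2 * (c * D), fun {u G k R} huG hG hR hk hX => ?_⟩
  set X := ∫⁻ x, ‖smoothTrunc k (u x)‖ₑ ^ criticalExp p x with hXdef
  have h1 := hC (k := k) huG hG hR hL hlo (le_gnsExp hpN) (gnsExp_le hpN) hk
  simp only [← hb] at h1
  have e : ∫⁻ x, ‖smoothTrunc k (u x)‖ₑ ^ (gnsExp p x * σ) = X := by
    simp only [hσ, gnsExp_mul hpN, hXdef]
  rw [e] at h1
  have hwm : AEMeasurable (fun x => ‖smoothTrunc k (u x)‖ₑ ^ criticalExp p x) volume :=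
    ((contDiff_smoothTrunc k).continuous.comp_aestronglyMeasurable
      huG.1.aestronglyMeasurable).enorm.pow (continuous_criticalExp hpN).measurable.aemeasurable
  have hum := aemeasurable_modular p huG.1.aestronglyMeasurable
  have h2 := (le_lintegral_add (μ := (volume : Measure (Eu N)))
    (fun x => ENNReal.ofReal (b * |smoothTrunc k (u x)| ^ (gnsExp p x - 1)) * ‖G x‖ₑ)
    (fun x => ENNReal.ofReal (L * (|smoothTrunc k (u x)| ^ gnsExp p x *
      |Real.log (|smoothTrunc k (u x)|)|)))).trans
    (lintegral_mono (g := fun x => ENNReal.ofReal (1 / (2 * (c + 1))) *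
      ‖smoothTrunc k (u x)‖ₑ ^ criticalExp p x + D * (‖u x‖ₑ ^ p x + ‖G x‖ₑ ^ p x))
      fun x => (hD x _ _).trans (add_le_add le_rfl
        (mul_le_mul_right (add_le_add (ENNReal.rpow_le_rpow (enorm_smoothTrunc_le hk _)
          (p.pos x).le) le_rfl) _)))
  rw [lintegral_add_left' (hwm.const_mul _), lintegral_const_mul' _ _ ENNReal.ofReal_ne_top,
    lintegral_const_mul' _ _ ENNReal.coe_ne_top, lintegral_add_left' hum, ← hXdef] at h2
  change _ ≤ _ + D * (modular p u + modular p G) at h2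
  -- The inequality controls $X^{1/\sigma}$ by a multiple of $X$ plus data. Smallness gives $X\le
  -- X^{1/\sigma}$, without which a lower power of $X$ could not absorb.
  have h3 : X ≤ c * (ENNReal.ofReal (1 / (2 * (c + 1))) * X + D * (modular p u + modular p G)) := by
    calc X ≤ X ^ (1 / σ) := by
          simpa using ENNReal.rpow_le_rpow_of_exponent_ge hX
            (show 1 / σ ≤ 1 by rw [div_le_one (by linarith)]; exact hσ1)
      _ ≤ _ := ENNReal.rpow_le_rpow h1 (by positivity)
      _ = c * _ := by
          rw [ENNReal.mul_rpow_of_nonneg _ _ (by positivity), ← ENNReal.rpow_mul,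
            mul_one_div_cancel (by linarith), ENNReal.rpow_one, hc,
            ENNReal.coe_rpow_of_nonneg _ (by positivity)]
      _ ≤ _ := by gcongr
  have h4 : c * ENNReal.ofReal (1 / (2 * (c + 1))) ≤ 2⁻¹ := by
    rw [← ENNReal.ofReal_coe_nnreal, ← ENNReal.ofReal_mul c.coe_nonneg,
      show (2⁻¹ : ℝ≥0∞) = ENNReal.ofReal 2⁻¹ by
        rw [ENNReal.ofReal_inv_of_pos two_pos, ENNReal.ofReal_ofNat]]
    refine ENNReal.ofReal_le_ofReal ?_
    have := c.coe_nonneg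
    rw [mul_one_div, div_le_iff₀ (by positivity)]
    linarith
  have h5 : X / 2 + X / 2 ≤ X / 2 + c * D * (modular p u + modular p G) := by
    rw [ENNReal.add_halves]
    calc X ≤ _ := h3
      _ = c * ENNReal.ofReal (1 / (2 * (c + 1))) * X + c * D * (modular p u + modular p G) := by
          ring
      _ ≤ _ := by
          rw [ENNReal.div_eq_inv_mul]
          gcongr
  have h6 := (ENNReal.add_le_add_iff_left
    (ENNReal.div_lt_top (hX.trans_lt ENNReal.one_lt_top).ne two_ne_zero).ne).1 h5
  rw [ENNReal.div_le_iff two_ne_zero ENNReal.ofNat_ne_top] at h6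
  refine h6.trans (le_of_eq ?_)
  push_cast
  ring

/-- Bootstrapping a bound that holds under smallness along dyadic scales. -/
theorem le_max_of_dyadic {Y : ℕ → ℝ≥0∞} {B : ℝ≥0∞} {P : ℝ} (hP : 0 ≤ P) (h0 : Y 0 ≠ ⊤)
    (h1 : ∀ j, Y j ≤ (2 ^ j)⁻¹ * Y 0) (h2 : ∀ j, Y 0 ≤ (2 ^ j) ^ P * Y j)
    (h3 : ∀ j, Y j ≤ 2 ^ P * Y (j + 1)) (h4 : ∀ j, Y j ≤ 1 → Y j ≤ (2 ^ j)⁻¹ * B) :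
    Y 0 ≤ max 1 ((2 ^ P * B) ^ P) := by
  by_cases hY : Y 0 ≤ 1
  · exact hY.trans (le_max_left _ _)
  have hex : ∃ j, Y j ≤ 1 := by
    obtain ⟨n, hn⟩ := ENNReal.exists_nat_gt h0
    refine ⟨n, (h1 n).trans ?_⟩
    rw [mul_comm, ← div_eq_mul_inv, ENNReal.div_le_iff (by simp) (by simp), one_mul]
    refine hn.le.trans ?_
    exact_mod_cast Nat.lt_two_pow_self.le
  classical
  -- Here $l+1$ is the first scale with $Y\le 1$. From $Y_l>1$ follows $Y_{l+1}\ge 2^{-P}$, against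
  -- $Y_{l+1}\le 2^{-(l+1)}B$; hence $2^{l+1}\le 2^PB$, and undoing the scaling bounds $Y_0$.
  obtain ⟨l, hl⟩ := Nat.exists_eq_succ_of_ne_zero (n := Nat.find hex) fun h => hY (by
    have := Nat.find_spec hex
    rwa [h] at this)
  have hspec : Y (l + 1) ≤ 1 := by
    have := Nat.find_spec hex
    rwa [hl] at this
  have hmin : 1 < Y l := not_le.1 (Nat.find_min hex (by omega))
  have h5 : (2 : ℝ≥0∞) ^ (l + 1) ≤ 2 ^ P * B := by
    have h6 : 1 ≤ (2 ^ P * B) / 2 ^ (l + 1) := by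
      calc 1 ≤ 2 ^ P * Y (l + 1) := hmin.le.trans (h3 l)
        _ ≤ 2 ^ P * ((2 ^ (l + 1))⁻¹ * B) := by gcongr; exact h4 _ hspec
        _ = _ := by rw [div_eq_mul_inv]; ring
    rwa [ENNReal.le_div_iff_mul_le (by simp) (by simp), one_mul] at h6
  refine le_trans ?_ (le_max_right _ _)
  calc Y 0 ≤ (2 ^ (l + 1)) ^ P * Y (l + 1) := h2 _
    _ ≤ (2 ^ P * B) ^ P * 1 := by gcongr
    _ = _ := mul_one _

theorem lintegral_inv_mul_rpow_le {α : Type*} [MeasurableSpace α] {μ : Measure α}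
    {w : α → ℝ≥0∞} {e : α → ℝ} (he : ∀ x, 1 ≤ e x) {c : ℝ≥0∞} (hc : 1 ≤ c) :
    ∫⁻ x, (c⁻¹ * w x) ^ e x ∂μ ≤ c⁻¹ * ∫⁻ x, w x ^ e x ∂μ := by
  have h : c⁻¹ ≤ 1 := ENNReal.inv_le_one.2 hc
  rw [← lintegral_const_mul' _ _ (h.trans_lt ENNReal.one_lt_top).ne]
  refine lintegral_mono fun x => ?_
  rw [ENNReal.mul_rpow_of_nonneg _ _ (by linarith [he x])]
  gcongr
  simpa using ENNReal.rpow_le_rpow_of_exponent_ge h (he x)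

theorem lintegral_rpow_le_mul_inv {α : Type*} [MeasurableSpace α] {μ : Measure α}
    {w : α → ℝ≥0∞} {e : α → ℝ} {M : ℝ} (he : ∀ x, 0 ≤ e x) (hM0 : 0 ≤ M) (hM : ∀ x, e x ≤ M)
    {c : ℝ≥0∞} (hc : 1 ≤ c) (hc' : c ≠ ⊤) :
    ∫⁻ x, w x ^ e x ∂μ ≤ c ^ M * ∫⁻ x, (c⁻¹ * w x) ^ e x ∂μ := by
  rw [← lintegral_const_mul' _ _ (ENNReal.rpow_ne_top_of_nonneg hM0 hc')]
  refine lintegral_mono fun x => ?_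
  calc w x ^ e x = (c * (c⁻¹ * w x)) ^ e x := by
        rw [← mul_assoc, ENNReal.mul_inv_cancel (zero_lt_one.trans_le hc).ne' hc', one_mul]
    _ = c ^ e x * (c⁻¹ * w x) ^ e x := ENNReal.mul_rpow_of_nonneg _ _ (he x)
    _ ≤ _ := by
        gcongr
        exact hM x

/-- The Sobolev embedding in modular form, for truncations of compactly supported functions. -/
theorem exists_lintegral_smoothTrunc_le_of_modular_le (hpN : p.hi < N)
    (hp : ∃ K : ℝ≥0, LipschitzWith K p.toFun) (M : ℝ≥0) :
    ∃ T : ℝ≥0, ∀ {u : Eu N → ℝ} {G : Eu N → Eu N} {k R : ℝ}, HasWeakGrad u G →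
      Integrable G volume → (∀ x, R < ‖x‖ → u x = 0) → 0 < k →
      modular p u + modular p G ≤ M →
      ∫⁻ x, ‖smoothTrunc k (u x)‖ₑ ^ criticalExp p x ≤ T := by
  obtain ⟨K, hK⟩ := exists_lintegral_smoothTrunc_le hpN hp
  set P : ℝ := N * p.hi / (N - p.hi) with hP
  have hcr : ∀ x, 1 ≤ criticalExp p x := fun x => (p.one_lt x).le.trans (le_criticalExp hpN x)
  have hP0 : 0 ≤ P := by linarith [hcr 0, criticalExp_le hpN 0]
  refine ⟨max 1 ((2 ^ P * (K * M)) ^ P), fun {u G k R} huG hG hR hk hM => ?_⟩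
  set w : Eu N → ℝ≥0∞ := fun x => ‖smoothTrunc k (u x)‖ₑ with hw
  -- Shrinking $w$ eventually makes its $p^\star$-modular small, while the $p$-modulars of $u$ and
  -- its gradient shrink at least by $2^{-j}$.
  set Y : ℕ → ℝ≥0∞ := fun j => ∫⁻ x, ((2 ^ j)⁻¹ * w x) ^ criticalExp p x with hY
  have hY0 : ∫⁻ x, w x ^ criticalExp p x = Y 0 := by simp [hY]
  have h2j : ∀ j : ℕ, (1 : ℝ≥0∞) ≤ 2 ^ j := fun j => one_le_pow₀ (by norm_num)
  have key := le_max_of_dyadic (Y := Y) (B := K * M) hP0 ?_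
    (fun j => by rw [← hY0]; exact lintegral_inv_mul_rpow_le hcr (h2j j))
    (fun j => by
      rw [← hY0]
      exact lintegral_rpow_le_mul_inv (fun x => zero_le_one.trans (hcr x)) hP0
        (criticalExp_le hpN) (h2j j) (by simp))
    (fun j => by
      refine (lintegral_rpow_le_mul_inv (c := 2) (fun x => zero_le_one.trans (hcr x)) hP0
        (criticalExp_le hpN) (by norm_num) (by simp)).trans (le_of_eq ?_)
      congr 1
      refine lintegral_congr fun x => ?_
      rw [← mul_assoc, pow_succ, ENNReal.mul_inv (by simp) (by simp), mul_comm (2⁻¹ : ℝ≥0∞)])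
    (fun j hj => ?_)
  · rw [hY0]
    refine key.trans (le_of_eq ?_)
    push_cast [ENNReal.coe_rpow_of_nonneg _ hP0]
    rfl
  -- Finiteness of $Y_0$ comes from truncation and compact support: the function is bounded and
  -- vanishes outside a ball.
  · rw [← hY0]
    have hle : ∀ x, w x ^ criticalExp p x ≤ (Metric.closedBall (0 : Eu N) R).indicator
        (fun _ => (ENNReal.ofReal (2 * k + 1)) ^ P) x := by
      intro x
      by_cases hx : x ∈ Metric.closedBall (0 : Eu N) R
      · rw [indicator_of_mem hx]
        have h1 : w x ≤ ENNReal.ofReal (2 * k + 1) := by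
          simp only [hw]
          rw [Real.enorm_eq_ofReal_abs]
          exact ENNReal.ofReal_le_ofReal (by linarith [abs_smoothTrunc_le_const hk (u x)])
        have h2 : 1 ≤ ENNReal.ofReal (2 * k + 1) := by
          rw [← ENNReal.ofReal_one]; exact ENNReal.ofReal_le_ofReal (by linarith)
        exact (ENNReal.rpow_le_rpow h1 (zero_le_one.trans (hcr x))).trans
          (ENNReal.rpow_le_rpow_of_exponent_le h2 (criticalExp_le hpN x))
      · rw [indicator_of_notMem hx]
        have h1 : R < ‖x‖ := by simpa using hx
        simp only [hw]
        rw [hR x h1, smoothTrunc_zero]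
        simp [zero_lt_one.trans_le (hcr x)]
    refine ((lintegral_mono hle).trans_lt ?_).ne
    rw [lintegral_indicator measurableSet_closedBall, setLIntegral_const]
    exact ENNReal.mul_lt_top (ENNReal.rpow_lt_top_of_nonneg hP0 ENNReal.ofReal_ne_top)
      measure_closedBall_lt_top
  · have hcj : (0 : ℝ) < (2 ^ j)⁻¹ := by positivity
    have hcj1 : ((2 : ℝ) ^ j)⁻¹ ≤ 1 := inv_le_one_of_one_le₀ (one_le_pow₀ (by norm_num))
    have ec : ENNReal.ofReal ((2 : ℝ) ^ j)⁻¹ = (2 ^ j)⁻¹ := by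
      rw [ENNReal.ofReal_inv_of_pos (by positivity), ENNReal.ofReal_pow (by norm_num),
        ENNReal.ofReal_ofNat]
    have eY : Y j = ∫⁻ x, ‖smoothTrunc (((2 : ℝ) ^ j)⁻¹ * k) (((2 : ℝ) ^ j)⁻¹ • u x)‖ₑ
        ^ criticalExp p x := by
      refine lintegral_congr fun x => ?_
      rw [smul_eq_mul, smoothTrunc_mul hcj, enorm_mul, Real.enorm_of_nonneg hcj.le, ec]
    rw [eY] at hj ⊢
    refine (hK (huG.smul ((2 ^ j)⁻¹)) (hG.fun_smul _)
      (fun x hx => by rw [hR x hx, smul_zero]) (mul_pos hcj hk) hj).trans ?_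
    calc (K : ℝ≥0∞) * (modular p (fun x => ((2 : ℝ) ^ j)⁻¹ • u x)
          + modular p fun x => ((2 : ℝ) ^ j)⁻¹ • G x)
        ≤ K * ((2 ^ j)⁻¹ * modular p u + (2 ^ j)⁻¹ * modular p G) := by
          rw [← ec]
          gcongr
          · exact modular_smul_le p u hcj.le hcj1
          · exact modular_smul_le p G hcj.le hcj1
      _ = (2 ^ j)⁻¹ * (K * (modular p u + modular p G)) := by ring
      _ ≤ _ := by gcongr

end Embedding

/-! ### Cut-off functions and the product rule -/

section Cutoff

variable {N : ℕ}

/-- Cut-off functions with uniformly bounded gradients. -/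
theorem exists_cutoff (N : ℕ) : ∃ c : ℝ≥0, ∀ n : ℕ, ∃ χ : Eu N → ℝ, ContDiff ℝ ∞ χ ∧
    HasCompactSupport χ ∧ (∀ x, |χ x| ≤ 1) ∧ (∀ x, ‖x‖ ≤ n → χ x = 1) ∧
    ∀ x, ‖fderiv ℝ χ x‖ ≤ c := by
  let χ : ContDiffBump (0 : Eu N) := ⟨1, 2, one_pos, one_lt_two⟩
  have hχ : ContDiff ℝ ∞ χ := χ.contDiff
  obtain ⟨c, hc⟩ := (hχ.continuous_fderiv (by simp)).bounded_above_of_compact_support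
    (χ.hasCompactSupport.fderiv ℝ)
  have hc0 : 0 ≤ c := (norm_nonneg _).trans (hc 0)
  refine ⟨c.toNNReal, fun n => ?_⟩
  -- Dilating one fixed bump by a factor at least 1 does not increase its gradient; $n+1$ also
  -- covers $n=0$.
  have hn : (0 : ℝ) < n + 1 := by positivity
  have hi : (0 : ℝ) < (n + 1 : ℝ)⁻¹ := by positivity
  refine ⟨fun x => χ ((n + 1 : ℝ)⁻¹ • x), hχ.comp (contDiff_const_smul _),
    χ.hasCompactSupport.comp_smul hi.ne', fun x => ?_, fun x hx => ?_, fun x => ?_⟩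
  · rw [abs_of_nonneg χ.nonneg]
    exact χ.le_one
  · refine χ.one_of_mem_closedBall ?_
    rw [mem_closedBall_zero_iff, norm_smul, Real.norm_of_nonneg hi.le]
    change (n + 1 : ℝ)⁻¹ * ‖x‖ ≤ 1
    rw [inv_mul_le_iff₀ hn]
    linarith
  · have h1 : fderiv ℝ (fun x => χ ((n + 1 : ℝ)⁻¹ • x)) x
        = (n + 1 : ℝ)⁻¹ • fderiv ℝ χ ((n + 1 : ℝ)⁻¹ • x) := fderiv_comp_smul _
    rw [h1, norm_smul, Real.norm_of_nonneg hi.le, Real.coe_toNNReal c hc0]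
    refine (mul_le_of_le_one_left (norm_nonneg _) (inv_le_one_of_one_le₀ ?_)).trans (hc _)
    linarith [(Nat.cast_nonneg n : (0 : ℝ) ≤ n)]

theorem gradient_apply_coord (χ : Eu N → ℝ) (x : Eu N) (i : Fin N) :
    gradient χ x i = fderiv ℝ χ x (EuclideanSpace.single i 1) := by
  rw [← inner_gradient_left, EuclideanSpace.inner_single_right]
  simp

theorem continuous_gradient {χ : Eu N → ℝ} (hχ : ContDiff ℝ ∞ χ) : Continuous (gradient χ) :=
  (InnerProductSpace.toDual ℝ (Eu N)).symm.continuous.comp (hχ.continuous_fderiv (by simp))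

theorem hasCompactSupport_gradient {χ : Eu N → ℝ} (hc : HasCompactSupport χ) :
    HasCompactSupport (gradient χ) :=
  (hc.fderiv ℝ).comp_left (g := (InnerProductSpace.toDual ℝ (Eu N)).symm) (map_zero _)

theorem norm_gradient (χ : Eu N → ℝ) (x : Eu N) : ‖gradient χ x‖ = ‖fderiv ℝ χ x‖ :=
  (InnerProductSpace.toDual ℝ (Eu N)).symm.norm_map _

theorem HasWeakGrad.integrable_cutoff {u χ : Eu N → ℝ} {g : Eu N → Eu N} (h : HasWeakGrad u g)
    (hχ : ContDiff ℝ ∞ χ) (hc : HasCompactSupport χ) :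
    Integrable (fun x => χ x • g x + u x • gradient χ x) volume :=
  (h.2.1.integrable_smul_left_of_hasCompactSupport hχ.continuous hc).add
    (h.1.integrable_smul_right_of_hasCompactSupport (continuous_gradient hχ)
      (hasCompactSupport_gradient hc))

/-- The product rule for weak gradients and test functions. -/
theorem HasWeakGrad.cutoff {u χ : Eu N → ℝ} {g : Eu N → Eu N} (h : HasWeakGrad u g)
    (hχ : ContDiff ℝ ∞ χ) (hc : HasCompactSupport χ) :
    HasWeakGrad (fun x => u x * χ x) (fun x => χ x • g x + u x • gradient χ x) := by
  refine ⟨(integrable_mul_of_locallyIntegrable h.1 hχ.continuous hc).locallyIntegrable,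
    (h.integrable_cutoff hχ hc).locallyIntegrable, fun φ hφ hφc i => ?_⟩
  have hd : ∀ x, fderiv ℝ (fun x => χ x * φ x) x (EuclideanSpace.single i 1)
      = χ x * fderiv ℝ φ x (EuclideanSpace.single i 1)
        + φ x * fderiv ℝ χ x (EuclideanSpace.single i 1) := fun x => by
    rw [fderiv_fun_mul (hχ.differentiable (by simp) x) (hφ.differentiable (by simp) x)]
    simp
  -- The product $\chi\varphi$ is again a test function; the part carrying $\varphi\nabla\chi$
  -- becomes the zeroth-order term of the new gradient.
  have h1 := h.2.2 (fun x => χ x * φ x) (hχ.mul hφ) hc.mul_right i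
  simp only [hd, mul_add] at h1
  have i1 : Integrable (fun x => u x * (χ x * fderiv ℝ φ x (EuclideanSpace.single i 1))) volume :=
    integrable_mul_of_locallyIntegrable h.1 (hχ.continuous.mul (continuous_fderiv_single hφ i))
      hc.mul_right
  have i2 : Integrable (fun x => u x * (φ x * fderiv ℝ χ x (EuclideanSpace.single i 1))) volume :=
    integrable_mul_of_locallyIntegrable h.1 (hφ.continuous.mul (continuous_fderiv_single hχ i))
      hφc.mul_right
  have i3 : Integrable (fun x => g x i * (χ x * φ x)) volume :=
    integrable_mul_of_locallyIntegrable (locallyIntegrable_coord h.2.1 i)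
      (hχ.continuous.mul hφ.continuous) hc.mul_right
  rw [integral_add i1 i2] at h1
  have e1 : ∫ x, u x * χ x * fderiv ℝ φ x (EuclideanSpace.single i 1)
      = ∫ x, u x * (χ x * fderiv ℝ φ x (EuclideanSpace.single i 1)) := by
    simp only [mul_assoc]
  have e2 : ∫ x, (χ x • g x + u x • gradient χ x) i * φ x
      = ∫ x, (g x i * (χ x * φ x) + u x * (φ x * fderiv ℝ χ x (EuclideanSpace.single i 1))) := by
    refine integral_congr_ae (ae_of_all _ fun x => ?_)
    simp only [PiLp.add_apply, PiLp.smul_apply, smul_eq_mul, gradient_apply_coord]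
    ring
  rw [e1, e2, integral_add i3 i2]
  linarith

theorem enorm_cutoff_grad_le {u χ : Eu N → ℝ} {g : Eu N → Eu N} {c : ℝ≥0}
    (hχ1 : ∀ x, |χ x| ≤ 1) (hc : ∀ x, ‖fderiv ℝ χ x‖ ≤ c) (x : Eu N) :
    ‖χ x • g x + u x • gradient χ x‖ₑ ≤ ‖g x‖ₑ + c * ‖u x‖ₑ := by
  refine (enorm_add_le _ _).trans (add_le_add ?_ ?_)
  · rw [enorm_smul]
    refine mul_le_of_le_one_left' ?_
    rw [Real.enorm_eq_ofReal_abs, ← ENNReal.ofReal_one]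
    exact ENNReal.ofReal_le_ofReal (hχ1 x)
  · rw [enorm_smul, mul_comm]
    gcongr
    rw [← ofReal_norm, norm_gradient, ← ENNReal.ofReal_coe_nnreal]
    exact ENNReal.ofReal_le_ofReal (hc x)

end Cutoff

/-! ### The critical embedding and the intermediate exponents -/

section Embedding

variable {N : ℕ} {p : CPlus N}

/-- Some $\alpha<1$ has modular of $u/\alpha$ at most 1, and $|u|\le|u/\alpha|$. -/
theorem modular_le_one_of_luxNorm_lt_one {G : Type*} [NormedAddCommGroup G] [NormedSpace ℝ G]
    {u : Eu N → G} (hu : MemLpVar p u) (h : luxNorm p u < 1) : modular p u ≤ 1 := by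
  obtain ⟨α, ⟨hα, hα1⟩, hlt⟩ := exists_lt_of_csInf_lt (luxSet_nonempty hu) h
  refine le_trans (modular_mono p fun x => ?_) hα1
  rw [enorm_smul]
  refine le_mul_of_one_le_left' ?_
  rw [Real.enorm_of_nonneg (by positivity), ← ENNReal.ofReal_one]
  exact ENNReal.ofReal_le_ofReal ((one_le_inv₀ hα).2 hlt.le)

theorem modular_cutoff_grad_le {u χ : Eu N → ℝ} {g : Eu N → Eu N} {c : ℝ≥0}
    (hg : AEStronglyMeasurable g volume)
    (hχ1 : ∀ x, |χ x| ≤ 1) (hc : ∀ x, ‖fderiv ℝ χ x‖ ≤ c) :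
    modular p (fun x => χ x • g x + u x • gradient χ x)
      ≤ 2 ^ p.hi * (modular p g + (1 + c) ^ p.hi * modular p u) := by
  have hhi : 0 ≤ p.hi := (p.pos 0).le.trans (p.le_hi 0)
  have hne : ((1 : ℝ≥0∞) + c) ^ p.hi ≠ ⊤ :=
    ENNReal.rpow_ne_top_of_nonneg hhi (by simp)
  unfold modular
  rw [← lintegral_const_mul' _ _ hne, ← lintegral_add_left' (aemeasurable_modular p hg),
    ← lintegral_const_mul' _ _ (ENNReal.rpow_ne_top_of_nonneg hhi ENNReal.ofNat_ne_top)]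
  refine lintegral_mono fun x => ?_
  refine (ENNReal.rpow_le_rpow (enorm_cutoff_grad_le hχ1 hc x) (p.pos x).le).trans
    ((enn_add_rpow_le _ _ (p.pos x).le (p.le_hi x)).trans ?_)
  rw [ENNReal.mul_rpow_of_nonneg _ _ (p.pos x).le]
  gcongr 2 ^ p.hi * (_ + ?_ * _)
  calc (c : ℝ≥0∞) ^ p x ≤ (1 + c) ^ p x := ENNReal.rpow_le_rpow le_add_self (p.pos x).le
    _ ≤ _ := ENNReal.rpow_le_rpow_of_exponent_le le_self_add (p.le_hi x)

/-- The Sobolev embedding `W^{1,p(x)}(ℝᴺ) → L^{p*(x)}(ℝᴺ)`, in modular form. -/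
theorem modularBounded_criticalExp (hpN : p.hi < N)
    (hp : ∃ K : ℝ≥0, LipschitzWith K p.toFun) : ModularBounded p (criticalExp p) := by
  obtain ⟨c, hc⟩ := exists_cutoff N
  choose χ hχ hχc hχ1 hχn hχd using hc
  have hhi : 0 ≤ p.hi := (p.pos 0).le.trans (p.le_hi 0)
  -- The constant bounds the $p$-modulars of $\chi_nu$ and of its weak gradient for all $n$ at once,
  -- when those of $u$ and $\nabla u$ are at most 1.
  obtain ⟨T, hT⟩ := exists_lintegral_smoothTrunc_le_of_modular_le hpN hp
    (1 + 2 ^ p.hi * (1 + (1 + c) ^ p.hi))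
  refine ⟨T, fun u hu => ?_⟩
  have hu1 : modular p u ≤ 1 := modular_le_one_of_luxNorm_lt_one u.memLpVar (by
    linarith [W1p.norm_def u, luxNorm_nonneg p u.grad])
  have hg1 : modular p u.grad ≤ 1 := modular_le_one_of_luxNorm_lt_one u.memLpVar_grad (by
    linarith [W1p.norm_def u, luxNorm_nonneg p u])
  have hbound : ∀ n : ℕ, ∫⁻ x, ‖smoothTrunc (n + 1) (u x * χ n x)‖ₑ ^ criticalExp p x ≤ T := by
    intro n
    obtain ⟨R, hR⟩ := (hχc n).isCompact.isBounded.subset_closedBall 0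
    refine hT (R := R) (u.hasWeakGrad.cutoff (hχ n) (hχc n))
      (u.hasWeakGrad.integrable_cutoff (hχ n) (hχc n)) (fun x hx => ?_) (by positivity) ?_
    · have h0 : χ n x = 0 := by
        refine image_eq_zero_of_notMem_tsupport fun hmem => ?_
        have := hR hmem
        rw [mem_closedBall_zero_iff] at this
        linarith
      simp only [h0, mul_zero]
    · have h1 : modular p (fun x => u x * χ n x) ≤ modular p u := modular_mono p fun x => by
        rw [enorm_mul]
        refine mul_le_of_le_one_right' ?_
        rw [Real.enorm_eq_ofReal_abs, ← ENNReal.ofReal_one]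
        exact ENNReal.ofReal_le_ofReal (hχ1 n x)
      have h2 := modular_cutoff_grad_le (p := p) (u := u) u.memLpVar_grad.1 (hχ1 n) (hχd n)
      push_cast [ENNReal.coe_rpow_of_nonneg _ hhi]
      refine add_le_add (h1.trans hu1) (h2.trans ?_)
      gcongr
      exact mul_le_of_le_one_right' hu1
  -- Cut-off radius and truncation height tend to infinity together; the functions converge
  -- pointwise to $u$ and Fatou's lemma carries the uniform bound over.
  calc ∫⁻ x, ‖u x‖ₑ ^ criticalExp p x
      ≤ ∫⁻ x, liminf (fun n : ℕ => ‖smoothTrunc (n + 1) (u x * χ n x)‖ₑ ^ criticalExp p x)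
          atTop := by
        refine lintegral_mono fun x => le_of_eq ?_
        have h1 : Tendsto (fun n : ℕ => smoothTrunc (n + 1) (u x * χ n x)) atTop (nhds (u x)) := by
          refine (tendsto_smoothTrunc (u x)).congr' ?_
          obtain ⟨m, hm⟩ := exists_nat_ge ‖x‖
          filter_upwards [eventually_ge_atTop m] with n hn
          rw [hχn n x (hm.trans (by exact_mod_cast hn)), mul_one]
        exact (((ENNReal.continuous_rpow_const (y := criticalExp p x)).tendsto _).comp
          h1.enorm).liminf_eq.symm
    _ ≤ liminf (fun n : ℕ => ∫⁻ x, ‖smoothTrunc (n + 1) (u x * χ n x)‖ₑ ^ criticalExp p x)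
          atTop := by
        refine lintegral_liminf_le' fun n => ?_
        exact (((contDiff_smoothTrunc _).continuous.comp_aestronglyMeasurable
          (u.memLpVar.1.mul (hχ n).continuous.aestronglyMeasurable)).enorm).pow
            (continuous_criticalExp hpN).measurable.aemeasurable
    _ ≤ liminf (fun _ : ℕ => (T : ℝ≥0∞)) atTop :=
        liminf_le_liminf (Eventually.of_forall hbound)
    _ = T := liminf_const _

/-- Pointwise $t^{e}\le t^{p}+t^{e'}$: the first term serves $t\le 1$, the second $t\ge 1$. -/
theorem ModularBounded.of_between {e e' : Eu N → ℝ} (he : ∀ x, p x ≤ e x)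
    (he' : ∀ x, e x ≤ e' x) (h : ModularBounded p e') : ModularBounded p e := by
  obtain ⟨K, hK⟩ := h
  refine ⟨1 + K, fun u hu => ?_⟩
  have hu1 : modular p u ≤ 1 := modular_le_one_of_luxNorm_lt_one u.memLpVar (by
    linarith [W1p.norm_def u, luxNorm_nonneg p u.grad])
  calc ∫⁻ x, ‖u x‖ₑ ^ e x ≤ ∫⁻ x, (‖u x‖ₑ ^ p x + ‖u x‖ₑ ^ e' x) := by
        refine lintegral_mono fun x => ?_
        rcases le_total ‖u x‖ₑ 1 with h1 | h1
        · exact (ENNReal.rpow_le_rpow_of_exponent_ge h1 (he x)).trans le_self_add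
        · exact (ENNReal.rpow_le_rpow_of_exponent_le h1 (he' x)).trans le_add_self
    _ = modular p u + ∫⁻ x, ‖u x‖ₑ ^ e' x :=
        lintegral_add_left' (aemeasurable_modular p u.memLpVar.1) _
    _ ≤ _ := by
        push_cast
        exact add_le_add hu1 (hK u hu)

theorem modularBounded_of_mem_classM (hpN : p.hi < N)
    (hp : ∃ K : ℝ≥0, LipschitzWith K p.toFun) {q r : CPlus N} (hr : r ∈ classM p q) :
    ModularBounded p (fun x => r x * q.lo) ∧ ModularBounded p (fun x => r x * q.hi) := by
  have h := modularBounded_criticalExp hpN hp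
  exact ⟨h.of_between (fun x => (hr x).1) fun x => (hr x).2.1.trans (hr x).2.2,
    h.of_between (fun x => (hr x).1.trans (hr x).2.1) fun x => (hr x).2.2⟩

end Embedding

end

theorem lemma3p2 (N : ℕ) (p : CPlus N) (hpLip : ∃ K : ℝ≥0, LipschitzWith K p.toFun)
    (hpN : p.hi < N)
    (q : CPlus N) (lam : Eu N → Eu N → ℝ)
    (hlam : ∀ x y, 1 / q x + lam x y / N + 1 / q y = 2)
    (Λ : ℝ) (hΛN : Λ < N) (hlamN : ∀ x y, lam x y ≤ Λ)
    (f : Eu N → ℝ → ℝ) (hf : Continuous fun z : Eu N × ℝ => f z.1 z.2)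
    (r s : CPlus N) (hr : r ∈ classM p q) (hs : s ∈ classM p q)
    (C₁ : ℝ) (hC₁ : 0 < C₁)
    (hf₁ : ∀ x t, |f x t| ≤ C₁ * (|t| ^ (r x - 1) + |t| ^ (s x - 1))) :
    (∀ u : W1p p, Integrable (fun z : Eu N × Eu N => psiIntegrand f lam u z.1 z.2) volume) ∧
    ContDiff ℝ 1 (Psi p f lam) ∧
    ∀ u v : W1p p,
      Integrable (fun z : Eu N × Eu N => dpsiIntegrand f lam u v z.1 z.2) volume ∧
      fderiv ℝ (Psi p f lam) u v = ∫ y, ∫ x, dpsiIntegrand f lam u v x y := by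
  -- Positivity of the dimension is implied by $1<p\le p^+<N$.
  have hN : 0 < N := by
    have := one_lt_natCast_of_hi_lt hpN
    exact_mod_cast zero_lt_one.trans this
  obtain ⟨hr₁, hr₂⟩ := modularBounded_of_mem_classM hpN hpLip hr
  obtain ⟨hs₁, hs₂⟩ := modularBounded_of_mem_classM hpN hpLip hs
  exact psi_contDiff_of_modularBounded N hN p q lam hlam Λ hΛN hlamN f hf r s hr₁ hr₂ hs₁ hs₂
    C₁ hC₁ hf₁
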